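/- **Conventions.** Put $\kappa=1$ (bosonic case) or $\kappa=-1$ (fermionic case). A Krein space is a complex separable space $V=V^+\oplus V^-$ with a fixed orthogonal decomposition and an inner product $\{\cdot,\cdot\}$ (conjugate linear in the first argument) that is positive definite on $V^+$ and negative definite on $V^-$, such that reversing the sign on $V^-$ gives a Hilbert space. Put $[v]=0$ for $v\in V^+$ and $[v]=1$ for $0\neq v\in V^-$. A subspace $W$ is adapted if $W=(W\cap V^+)\oplus(W\cap V^-)$. An ON-basis of a finite-dimensional adapted complex subspace $E$ is a union of ON-bases of $E\cap V^+$ and of $E\cap V^-$ (sign of the inner product reversed). **Classical data.** A spacetime system consists of hypersurfaces and regions with orientation reversal $\Sigma\mapsto\overline\Sigma$, disjoint unions, boundaries $\partial M$, slice regions and gluings. A linear classical theory assigns to each hypersurface $\Sigma$ a Krein space $L_\Sigma$, with a conjugate linear involutive identification $L_\Sigma\to L_{\overline\Sigma}$ satisfying $\{\phi',\phi\}_{\overline\Sigma}=\kappa\overline{\{\phi',\phi\}_\Sigma}$ and isometric isomorphisms $L_{\Sigma_1}\oplus\dots\oplus L_{\Sigma_n}\cong L_\Sigma$ for disjoint unions;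 and to each region $M$ a real vector space $L_M$ with a real linear map $r_M:L_M\to L_{\partial M}$ whose image $L_{\tilde M}$ is * in the bosonic case, a closed adapted Lagrangian subspace for $\tfrac12\operatorname{Im}\{\cdot,\cdot\}$; * in the fermionic case, a subspace equal to its orthogonal companion for $\operatorname{Re}\{\cdot,\cdot\}$ (hypermaximal neutral) such that the involutive real anti-isometry of $L_{\partial M}$ that interchanges $L_{\partial M}^\pm$ and has fixed point set $L_{\tilde M}$ is conjugate linear. For a disjoint union $M=M_1\cup M_2$ one has $L_M=L_{M_1}\oplus L_{M_2}$ and $r_M=r_{M_1}+r_{M_2}$. If $\partial M=\Sigma_1\cup\Sigma\cup\overline{\Sigma'}$ is a disjoint union, $\Sigma'$ a copy of $\Sigma$, and $M_1$ is the region obtained by gluing $M$ to itself along $\Sigma,\overline{\Sigma'}$ (so $\partial M_1=\Sigma_1$), there is an injective linear map $L_{M_1}\to L_M$ whose image is the set of $x$ for which the components of $r_M(x)$ in $L_\Sigma$ and in $L_{\overline{\Sigma'}}\cong L_\Sigma$ agree, and $r_{M_1}$ is this map followed by $r_M$ and the projection to $L_{\Sigma_1}$. **Quantization.** For a permutation $\sigma$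 let $|\sigma|\in\{0,1\}$ be its parity. The Fock space $\mathcal H_\Sigma$ over $L_\Sigma$ is the completion of the sum over $n$ of spaces of $n$-linear functions on $L_\Sigma$, symmetric for $\kappa=1$ and antisymmetric for $\kappa=-1$. Its dense subspace $\mathcal H_\Sigma^\circ$ is spanned by $\mathbf 1$ (degree $0$) and the generating states $$\psi[\xi_1,\dots,\xi_n](\eta_1,\dots,\eta_n)=\frac1{n!}\sum_{\sigma\in S^n}\kappa^{|\sigma|}\prod_{i=1}^n\{\xi_i,\eta_{\sigma(i)}\}.$$ Put $(\iota_\Sigma\psi)(\xi_1,\dots,\xi_n)=\overline{\psi(\xi_n,\dots,\xi_1)}$, and let $\tau$ be the map $$\tau(\psi_1\otimes\psi_2)\big((\eta_1,\xi_1),\dots,(\eta_{m+n},\xi_{m+n})\big)=\frac1{(m+n)!}\sum_{\sigma\in S^{m+n}}\kappa^{|\sigma|}\psi_1(\eta_{\sigma(1)},\dots,\eta_{\sigma(m)})\,\psi_2(\xi_{\sigma(m+1)},\dots,\xi_{\sigma(m+n)})$$ for $\psi_1,\psi_2$ of degrees $m,n$, and iterations of it. Every $\xi\in L_{\partial M}$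 is uniquely $\xi=\xi^{R}+i\xi^{I}$ with $\xi^R,\xi^I\in L_{\tilde M}$; put $\{\hat\xi,\hat\eta\}=\{\xi^R,\eta^R\}-i\{\xi^R,\eta^I\}-i\{\xi^I,\eta^R\}-\{\xi^I,\eta^I\}$. The amplitude $\rho_M:\mathcal H_{\partial M}^\circ\to\mathbb C$ is the linear map with $\rho_M(\mathbf 1)=1$, $\rho_M(\psi[\xi_1,\dots,\xi_n])=0$ for odd $n$, and $$\rho_M(\psi[\xi_1,\dots,\xi_{2n}])=\frac1{n!}\sum_{\sigma\in S^{2n}}\kappa^{|\sigma|}\prod_{j=1}^n\{\hat\xi_{\sigma(j)},\hat\xi_{\sigma(2n+1-j)}\}.$$ **Anomaly factor.** Let $M$ be glued to $M_1$ along $\Sigma,\overline{\Sigma'}$ as above, and let $A$ be the directed set of finite-dimensional adapted complex subspaces of $L_\Sigma$. For $\alpha\in A$ with ON-basis $\xi_1,\dots,\xi_d$ put $$c_\alpha=\sum_{m=0}^\infty\frac1{2^m m!}\sum_{a_1,\dots,a_m=1}^d(-1)^{\sum_i[\xi_{a_i}]}\rho_M\big(\tau(\mathbf 1\otimes\psi[\xi_{a_1},\dots,\xi_{a_m}]\otimes\iota_\Sigma(\psi[\xi_{a_1},\dots,\xi_{a_m}]))\big)$$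 if the sum over $m$ converges absolutely (this does not depend on the basis). The anomaly factor $c=c(M;\Sigma,\overline{\Sigma'})$ is well defined if, for some $c\in\mathbb C$, for every $\epsilon>0$ there is $\beta\in A$ such that $c_\gamma$ is well defined with $|c_\gamma-c|<\epsilon$ for all $\gamma\ge\beta$. **Theorem.** Assume that $c=c(M;\Sigma,\overline{\Sigma'})$ is well defined and nonzero. Then $\tau(\psi\otimes\xi\otimes\iota_\Sigma(\xi))\in\mathcal H_{\partial M}^\circ$ for all $\psi\in\mathcal H_{\partial M_1}^\circ$ and $\xi\in\mathcal H_\Sigma^\circ$, and for all $\psi\in\mathcal H_{\partial M_1}^\circ$ $$\rho_{M_1}(\psi)\cdot c=\sum_{i}(-1)^{[\zeta_i]}\rho_M\big(\tau(\psi\otimes\zeta_i\otimes\iota_\Sigma(\zeta_i))\big)$$ in the following sense. For every $\epsilon>0$ there is $\beta\in A$ such that for all $\gamma\ge\beta$ in $A$ and every ON-basis $\xi_1,\dots,\xi_d$ of $\gamma$, the sum taken over the induced ON-basis of the Fock space over $\gamma$, $$\zeta_a=\frac1{\sqrt{2^mK_a}}\,\psi[\xi_{a_1},\dots,\xi_{a_m}],\quad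 m\ge0,\quad a_1\le\dots\le a_m\ (\kappa=1),\quad a_1<\dots<a_m\ (\kappa=-1),\qquad[\zeta_a]=\sum_i[\xi_{a_i}],$$ where $K_a$ is the number of permutations fixing $(a_1,\dots,a_m)$, and ordered by degree (a finite sum for each $m$, then an absolutely convergent sum over $m$), differs from $\rho_{M_1}(\psi)\cdot c$ by less than $\epsilon$. This holds in the bosonic and in the fermionic case. -/

import Mathlib

open scoped ComplexConjugate

universe u v w

namespace GBF

/-- The two cases: bosonic and fermionic. -/
inductive Statistics where
  | boson
  | fermion

namespace Statistics

/-- The sign `κ`: `1` for bosons, `-1` for fermions. -/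
def kappa : Statistics → ℂ
  | boson => 1
  | fermion => -1

/-- `κ ^ |σ|`, where `|σ|` is the parity of the permutation `σ`. -/
def permSign (κ : Statistics) {n : ℕ} (σ : Equiv.Perm (Fin n)) : ℂ :=
  match κ with
  | boson => 1
  | fermion => ((Equiv.Perm.sign σ : ℤ) : ℂ)

theorem permSign_mul (κ : Statistics) {n : ℕ} (σ τ : Equiv.Perm (Fin n)) :
    κ.permSign (σ * τ) = κ.permSign σ * κ.permSign τ := by
  cases κ <;> simp [permSign]

theorem permSign_inv (κ : Statistics) {n : ℕ} (σ : Equiv.Perm (Fin n)) :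
    κ.permSign σ⁻¹ = κ.permSign σ := by
  cases κ <;> simp [permSign]

theorem permSign_mul_self (κ : Statistics) {n : ℕ} (σ : Equiv.Perm (Fin n)) :
    κ.permSign σ * κ.permSign σ = 1 := by
  cases κ
  · simp [permSign]
  · rcases Int.units_eq_one_or (Equiv.Perm.sign σ) with h | h <;> simp [permSign, h]

end Statistics

/-- A separable complex Krein space with a fixed decomposition `V = V⁺ ⊕ V⁻`. It is given by the Hilbert
space `V⁺ ⊕ (V⁻ with reversed inner product)` and the unitary involution `sym` that is `1` on `V⁺`
and `-1` on `V⁻`. -/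
structure KreinSpace where
  carrier : Type u
  [normed : NormedAddCommGroup carrier]
  [hilbert : InnerProductSpace ℂ carrier]
  [complete : CompleteSpace carrier]
  [separable : TopologicalSpace.SeparableSpace carrier]
  sym : carrier ≃ₗᵢ[ℂ] carrier
  sym_sym : ∀ v, sym (sym v) = v

attribute [instance] KreinSpace.normed KreinSpace.hilbert KreinSpace.complete KreinSpace.separable

instance : CoeSort KreinSpace.{u} (Type u) := ⟨KreinSpace.carrier⟩

namespace KreinSpace

variable {V : KreinSpace.{u}}

/-- The indefinite inner product `{v, w}`, conjugate linear in `v` and linear in `w`. -/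
noncomputable def form (v w : V) : ℂ := inner ℂ v (V.sym w)

/-- The positive part `V⁺`. -/
def pos (V : KreinSpace.{u}) : Set V := {v | V.sym v = v}

/-- The negative part `V⁻`. -/
def neg (V : KreinSpace.{u}) : Set V := {v | V.sym v = -v}

open Classical in
/-- The degree of a homogeneous vector: `0` on `V⁺`, `1` on nonzero elements of `V⁻`. -/
noncomputable def sig (v : V) : ℕ := if v ∈ V.pos then 0 else 1

/-- `W = W⁺ ⊕ W⁻` with `W⁺ ⊆ V⁺` and `W⁻ ⊆ V⁻`. -/
def IsAdapted {R : Type*} [Semiring R] [Module R V] (W : Submodule R V) : Prop :=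
  ∀ v ∈ W, ∃ a ∈ W, ∃ b ∈ W, a ∈ V.pos ∧ b ∈ V.neg ∧ v = a + b

/-- `W` equals its orthogonal companion for the real part of the inner product. -/
def IsHypermaximalNeutral (W : Submodule ℝ V) : Prop :=
  ∀ v : V, v ∈ W ↔ ∀ w ∈ W, (form v w).re = 0

/-- `W` equals its complement for the symplectic form, half the imaginary part of the inner product. -/
def IsLagrangian (W : Submodule ℝ V) : Prop :=
  ∀ v : V, v ∈ W ↔ ∀ w ∈ W, (form v w).im = 0

/-- `s` is an involutive adapted real anti-isometry with fixed point set `W`. For a hypermaximal neutral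
`W` there is exactly one such `s`. -/
structure IsInduced (W : Submodule ℝ V) (s : V →ₗ[ℝ] V) : Prop where
  invol : ∀ v, s (s v) = v
  map_pos : ∀ v ∈ V.pos, s v ∈ V.neg
  map_neg : ∀ v ∈ V.neg, s v ∈ V.pos
  anti : ∀ v w, (form (s v) (s w)).re = -(form v w).re
  fixed : ∀ v, v ∈ W ↔ s v = v

/-- The involution with fixed point set `W` is conjugate linear. -/
def IsCompatible (W : Submodule ℝ V) : Prop :=
  ∀ s : V →ₗ[ℝ] V, IsInduced W s → ∀ v, s (Complex.I • v) = -(Complex.I • s v)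

/-- The condition on the space of boundary values of solutions in a region: a closed adapted Lagrangian
subspace for bosons, a compatible real hypermaximal neutral subspace for fermions. -/
def IsDynamical (κ : Statistics) (W : Submodule ℝ V) : Prop :=
  match κ with
  | .boson => IsClosed (W : Set V) ∧ IsAdapted W ∧ IsLagrangian W
  | .fermion => IsHypermaximalNeutral W ∧ IsCompatible W


theorem sym_inner (v w : V) : inner ℂ (V.sym v) w = inner ℂ v (V.sym w) := by
  rw [← V.sym.inner_map_map, V.sym_sym]

theorem form_symm (v w : V) : conj (form v w) = form w v := by
  unfold form
  rw [inner_conj_symm, sym_inner]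

theorem form_add_left (a b c : V) : form (a + b) c = form a c + form b c := inner_add_left _ _ _

theorem form_smul_left (z : ℂ) (a c : V) : form (z • a) c = conj z * form a c :=
  inner_smul_left _ _ _

theorem form_add_right (a b c : V) : form a (b + c) = form a b + form a c := by
  simp [form]

theorem form_smul_right (z : ℂ) (a c : V) : form a (z • c) = z * form a c := by
  simp [form]

theorem eq_zero_of_form_self {a : V} (h : form a (V.sym a) = 0) : a = 0 := by
  simpa [form, V.sym_sym] using h

/-- A hypermaximal neutral subspace projects onto the positive part. -/
theorem exists_mem_add {E : Type*} [NormedAddCommGroup E] [InnerProductSpace ℂ E] [CompleteSpace E]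
    (θ : E →L[ℂ] E) (hθ : ∀ v, θ (θ v) = v) (hs : ∀ v w, inner ℂ (θ v) w = inner ℂ v (θ w))
    (W : Submodule ℝ E) (hW : ∀ v, v ∈ W ↔ ∀ w ∈ W, (inner ℂ v (θ w)).re = 0)
    (v : E) (hv : θ v = v) : ∃ w ∈ W, w + θ w = (2 : ℂ) • v := by
  let _ : InnerProductSpace ℝ E := InnerProductSpace.rclikeToReal ℂ E
  have hre : ∀ x y : E, inner ℝ x y = (inner ℂ x y).re := fun x y => rfl
  have hWc : IsClosed (W : Set E) := by
    have : (W : Set E) = ⋂ w ∈ W, {v | (inner ℂ v (θ w)).re = 0} := by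
      ext x; simp [hW x]
    rw [this]
    refine isClosed_biInter fun w _ => isClosed_eq ?_ continuous_const
    exact Complex.continuous_re.comp (continuous_id.inner continuous_const)
  let P : E →L[ℝ] E := (ContinuousLinearMap.id ℂ E + θ).restrictScalars ℝ
  have hP : ∀ x, P x = x + θ x := fun x => rfl
  have hθn : ∀ x, ‖θ x‖ = ‖x‖ := by
    intro x
    have h1 : inner ℂ (θ x) (θ x) = inner ℂ x x := by rw [hs, hθ]
    rw [inner_self_eq_norm_sq_to_K, inner_self_eq_norm_sq_to_K] at h1
    have h2 : ‖θ x‖ ^ 2 = ‖x‖ ^ 2 := by exact_mod_cast h1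
    exact (sq_eq_sq₀ (norm_nonneg _) (norm_nonneg _)).1 h2
  have hPn : ∀ x ∈ W, ‖x‖ ≤ ‖P x‖ := by
    intro x hx
    have h0 : inner ℝ x (θ x) = 0 := (hW x).1 hx x hx
    have h1 : ‖x + θ x‖ * ‖x + θ x‖ = ‖x‖ * ‖x‖ + ‖θ x‖ * ‖θ x‖ :=
      norm_add_sq_eq_norm_sq_add_norm_sq_real h0
    rw [hP]
    nlinarith [norm_nonneg x, norm_nonneg (x + θ x), hθn x]
  let M : Submodule ℝ E := W.map (P : E →ₗ[ℝ] E)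
  have hMc : IsComplete (M : Set E) := by
    have hWcomp : IsComplete (W : Set E) := hWc.isComplete
    have : CompleteSpace W := hWcomp.completeSpace_coe
    let Q : W →L[ℝ] E := P.comp W.subtypeL
    have hQ : AntilipschitzWith 1 Q := by
      refine ContinuousLinearMap.antilipschitz_of_bound Q fun x => ?_
      have h := hPn x x.2
      rw [NNReal.coe_one, one_mul]
      exact h
    have hr : (M : Set E) = Set.range Q := by
      refine Set.ext fun y => ⟨?_, ?_⟩
      · rintro ⟨x, hx, rfl⟩
        exact ⟨⟨x, hx⟩, rfl⟩
      · rintro ⟨x, rfl⟩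
        exact ⟨x, x.2, rfl⟩
    rw [hr]
    exact hQ.isComplete_range Q.uniformContinuous
  have : CompleteSpace M := hMc.completeSpace_coe
  obtain ⟨m, hm, hmo⟩ := Submodule.HasOrthogonalProjection.exists_orthogonal (K := M) v
  obtain ⟨x, hx, rfl⟩ := hm
  have hθP : ∀ x, θ (P x) = P x := by intro x; simp [hP, hθ, add_comm]
  set n : E := v - (P : E →ₗ[ℝ] E) x with hn
  have hθnn : θ n = n := by
    rw [hn, map_sub, hv]; congr 1; exact hθP x
  have hno : ∀ w ∈ W, (inner ℂ n (θ w)).re = 0 := by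
    intro w hw
    have h1 : inner ℝ (P w) n = 0 := hmo (P w) ⟨w, hw, rfl⟩
    rw [real_inner_comm, hP, inner_add_right] at h1
    have h2 : inner ℝ n w = inner ℝ n (θ w) := by
      rw [hre, hre, ← hs, hθnn]
    rw [h2] at h1
    have : inner ℝ n (θ w) = 0 := by linarith
    exact this
  have hnW : n ∈ W := (hW n).2 hno
  have h3 := hno n hnW
  rw [hθnn] at h3
  have h4 : n = 0 := by
    have : inner ℝ n n = 0 := h3
    exact inner_self_eq_zero.1 this
  refine ⟨(2 : ℝ) • x, W.smul_mem _ hx, ?_⟩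
  have h5 : v = P x := sub_eq_zero.1 h4
  rw [h5, hP]
  have h6 : θ ((2 : ℝ) • x) = (2 : ℝ) • θ x := by
    exact (θ.restrictScalars ℝ).map_smul 2 x
  rw [h6, ← smul_add]
  norm_num [← Complex.coe_smul]


theorem IsHypermaximalNeutral.pos_eq_zero {W : Submodule ℝ V} (hW : IsHypermaximalNeutral W)
    {w : V} (hw : w ∈ W) (h : w + V.sym w = 0) : w = 0 := by
  have h1 := (hW w).1 hw w hw
  rw [form, eq_neg_of_add_eq_zero_right h, inner_neg_right, Complex.neg_re, neg_eq_zero] at h1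
  exact inner_self_eq_zero.1 (Complex.ext h1 (inner_self_im (𝕜 := ℂ) w))

theorem IsHypermaximalNeutral.neg_eq_zero {W : Submodule ℝ V} (hW : IsHypermaximalNeutral W)
    {w : V} (hw : w ∈ W) (h : w - V.sym w = 0) : w = 0 := by
  have h1 := (hW w).1 hw w hw
  rw [form, ← sub_eq_zero.1 h] at h1
  exact inner_self_eq_zero.1 (Complex.ext h1 (inner_self_im (𝕜 := ℂ) w))

theorem IsHypermaximalNeutral.exists_pos {W : Submodule ℝ V} (hW : IsHypermaximalNeutral W)
    (v : V) : ∃ w ∈ W, w + V.sym w = v + V.sym v := by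
  obtain ⟨w, hw, h⟩ := exists_mem_add (V.sym : V →L[ℂ] V) (fun v => V.sym_sym v)
    (fun v w => sym_inner v w) W hW ((2 : ℂ)⁻¹ • (v + V.sym v))
    (by simp [V.sym_sym, add_comm])
  exact ⟨w, hw, by simpa using h⟩

theorem IsHypermaximalNeutral.exists_neg {W : Submodule ℝ V} (hW : IsHypermaximalNeutral W)
    (v : V) : ∃ w ∈ W, w - V.sym w = v - V.sym v := by
  obtain ⟨w, hw, h⟩ := exists_mem_add (-(V.sym : V →L[ℂ] V)) (fun v => by simp [V.sym_sym])
    (fun v w => by simp [sym_inner v w]) W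
    (fun v => by rw [hW v]; simp [form]) ((2 : ℂ)⁻¹ • (v - V.sym v))
    (by simp [V.sym_sym])
  exact ⟨w, hw, by simpa [sub_eq_add_neg] using h⟩

theorem IsHypermaximalNeutral.exists_induced {W : Submodule ℝ V} (hW : IsHypermaximalNeutral W) :
    ∃ s : V →ₗ[ℝ] V, IsInduced W s := by
  choose f hfW hf using hW.exists_pos
  choose g hgW hg using hW.exists_neg
  have symr : ∀ (r : ℝ) (x : V), V.sym (r • x) = r • V.sym x := fun r x =>
    ((V.sym : V →L[ℂ] V).restrictScalars ℝ).map_smul r x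
  have funiq : ∀ v w, w ∈ W → w + V.sym w = v + V.sym v → f v = w := fun v w hw h =>
    sub_eq_zero.1 (hW.pos_eq_zero (W.sub_mem (hfW v) hw) (by
      rw [map_sub, sub_add_sub_comm, hf, h, sub_self]))
  have guniq : ∀ v w, w ∈ W → w - V.sym w = v - V.sym v → g v = w := fun v w hw h =>
    sub_eq_zero.1 (hW.neg_eq_zero (W.sub_mem (hgW v) hw) (by
      rw [map_sub, sub_sub_sub_comm, hg, h, sub_self]))
  let s : V →ₗ[ℝ] V :=
    { toFun := fun v => (2 : ℝ)⁻¹ • ((f v - V.sym (f v)) + (g v + V.sym (g v)))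
      map_add' := fun v w => by
        rw [funiq (v + w) (f v + f w) (W.add_mem (hfW v) (hfW w)) (by
            rw [map_add, add_add_add_comm, hf, hf, map_add]; abel),
          guniq (v + w) (g v + g w) (W.add_mem (hgW v) (hgW w)) (by
            rw [map_add, add_sub_add_comm, hg, hg, map_add]; abel), ← smul_add]
        congr 1
        simp only [map_add]
        abel
      map_smul' := fun r v => by
        rw [funiq (r • v) (r • f v) (W.smul_mem r (hfW v)) (by
            rw [symr, symr, ← smul_add, ← smul_add, hf]),
          guniq (r • v) (r • g v) (W.smul_mem r (hgW v)) (by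
            rw [symr, symr, ← smul_sub, ← smul_sub, hg]), symr, symr, RingHom.id_apply,
          smul_comm r]
        congr 1
        simp only [smul_add, smul_sub] }
  have hs : ∀ v, s v = (2 : ℝ)⁻¹ • ((f v - V.sym (f v)) + (g v + V.sym (g v))) := fun _ => rfl
  have hsym : ∀ v, V.sym (s v) = (2 : ℝ)⁻¹ • (-(f v - V.sym (f v)) + (g v + V.sym (g v))) := by
    intro v
    rw [hs, symr]
    congr 1
    simp only [map_add, map_sub, V.sym_sym]
    abel
  have hhalf : ∀ x : V, (2 : ℝ)⁻¹ • (x + x) = x := by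
    intro x
    rw [← two_smul ℝ x, smul_smul]
    norm_num
  have hfs : ∀ v, f (s v) = g v := fun v => funiq _ _ (hgW v) (by
    rw [hsym, hs, ← smul_add]
    rw [show ∀ a b : V, a + b + (-a + b) = b + b from fun a b => by abel, hhalf])
  have hgs : ∀ v, g (s v) = f v := fun v => guniq _ _ (hfW v) (by
    rw [hsym, hs, ← smul_sub]
    rw [show ∀ a b : V, a + b - (-a + b) = a + a from fun a b => by abel, hhalf])
  have hv : ∀ v, v = (2 : ℝ)⁻¹ • ((f v + V.sym (f v)) + (g v - V.sym (g v))) := by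
    intro v
    rw [hf, hg, show v + V.sym v + (v - V.sym v) = v + v by abel, hhalf]
  refine ⟨s, ?_, ?_, ?_, ?_, ?_⟩
  · intro v
    rw [hs, hfs, hgs]
    conv_rhs => rw [hv v]
    congr 1
    abel
  · intro v h
    have h0 : g v = 0 := guniq v 0 W.zero_mem (by
      rw [show V.sym v = v from h]; simp)
    change V.sym (s v) = -(s v)
    rw [hsym, hs, h0, ← smul_neg]
    congr 1
    simp
  · intro v h
    have h0 : f v = 0 := funiq v 0 W.zero_mem (by
      rw [show V.sym v = -v from h]; simp)
    change V.sym (s v) = s v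
    rw [hsym, hs, h0]
    simp
  · intro v w
    have key : form (s v) (s w) + form v w = form (f v) (f w) + form (g v) (g w) := by
      have hc : ∀ x : V, (2 : ℝ)⁻¹ • x = ((2 : ℂ)⁻¹) • x := by
        intro x
        rw [← Complex.coe_smul]
        norm_num
      have e1 := hv v
      have e2 := hv w
      have e3 := hs v
      have e4 := hs w
      generalize f v = F at *
      generalize f w = F' at *
      generalize g v = G at *
      generalize g w = G' at *
      generalize s v = p at *
      generalize s w = q at *
      subst e3 e4
      rw [e1, e2]
      simp only [hc, form_smul_left, form_smul_right]
      have i1 : ∀ x y : V, form (V.sym x) (V.sym y) = form x y := fun x y => by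
        rw [form, V.sym.inner_map_map, form]
      have i2 : ∀ x y : V, form (V.sym x) y = form x (V.sym y) := fun x y => by
        rw [form, sym_inner, form]
      have i3 : ∀ x y z : V, form (x - y) z = form x z - form y z := fun x y z =>
        inner_sub_left _ _ _
      have i4 : ∀ x y z : V, form x (y - z) = form x y - form x z := fun x y z => by
        rw [form, map_sub, inner_sub_right, form, form]
      simp only [form_add_left, form_add_right, i3, i4, i1, i2]
      simp only [map_inv₀, Complex.conj_ofNat]
      ring
    have h1 := congrArg Complex.re key
    have h2 : (form (f v) (f w)).re = 0 := (hW _).1 (hfW v) _ (hfW w)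
    have h3 : (form (g v) (g w)).re = 0 := (hW _).1 (hgW v) _ (hgW w)
    simp only [Complex.add_re] at h1
    linarith
  · intro v
    constructor
    · intro h
      rw [hs, funiq v v h rfl, guniq v v h rfl, show v - V.sym v + (v + V.sym v) = v + v by abel,
        hhalf]
    · intro h
      have h1 : f v = g v := by rw [← hfs v, h]
      have h2 := hv v
      rw [← h1, show f v + V.sym (f v) + (f v - V.sym (f v)) = f v + f v by abel, hhalf] at h2
      rw [h2]
      exact hfW v

/-- Every vector splits as `a + i b` with `a`, `b` in the subspace, in exactly one way. -/
theorem IsDynamical.exists_split {κ : Statistics} {W : Submodule ℝ V} (hW : IsDynamical κ W)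
    (v : V) : ∃ a ∈ W, ∃ b ∈ W, v = a + Complex.I • b := by
  cases κ with
  | boson =>
    obtain ⟨hc, ha, hl⟩ := hW
    let _ : InnerProductSpace ℝ V := InnerProductSpace.rclikeToReal ℂ V
    have : CompleteSpace W := hc.isComplete.completeSpace_coe
    obtain ⟨m, hm, hmo⟩ := Submodule.HasOrthogonalProjection.exists_orthogonal (K := W) v
    refine ⟨m, hm, -(Complex.I • (v - m)), ?_, ?_⟩
    · refine (hl _).2 fun w hw => ?_
      obtain ⟨x, hx, y, hy, hxp, hyn, rfl⟩ := ha w hw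
      have h1 : (inner ℂ (x - y) (v - m)).re = 0 := hmo _ (W.sub_mem hx hy)
      have h2 : V.sym (x + y) = x - y := by
        rw [map_add, show V.sym x = x from hxp, show V.sym y = -y from hyn, sub_eq_add_neg]
      have h3 : (inner ℂ (v - m) (x - y)).re = 0 := by
        rw [← inner_conj_symm, Complex.conj_re, h1]
      rw [form, h2, inner_neg_left, inner_smul_left, Complex.conj_I, neg_mul, neg_neg,
        Complex.I_mul_im, h3]
    · rw [smul_neg, smul_smul, Complex.I_mul_I]
      simp
  | fermion =>
    obtain ⟨hn, hcomp⟩ := hW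
    obtain ⟨s, hs⟩ := hn.exists_induced
    have hI := hcomp s hs
    have hc : ∀ x : V, (2 : ℝ)⁻¹ • x = ((2 : ℂ)⁻¹) • x := by
      intro x
      rw [← Complex.coe_smul]
      norm_num
    refine ⟨(2 : ℝ)⁻¹ • (v + s v), ?_, (2 : ℝ)⁻¹ • -(Complex.I • (v - s v)), ?_, ?_⟩
    · rw [hs.fixed, map_smul, map_add, hs.invol, add_comm]
    · rw [hs.fixed, map_smul, map_neg, hI, map_sub, hs.invol, neg_neg, ← smul_neg, neg_sub]
    · rw [hc, hc, smul_comm, ← smul_add, smul_neg, smul_smul, Complex.I_mul_I, neg_one_smul, neg_neg,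
        show v + s v + (v - s v) = (2 : ℂ) • v by rw [two_smul]; abel, smul_smul]
      norm_num

theorem IsDynamical.split_eq_zero {κ : Statistics} {W : Submodule ℝ V} (hW : IsDynamical κ W)
    {a b : V} (ha : a ∈ W) (hb : b ∈ W) (h : a + Complex.I • b = 0) : a = 0 ∧ b = 0 := by
  suffices ha0 : a = 0 by
    subst ha0
    refine ⟨rfl, ?_⟩
    rw [zero_add] at h
    exact (smul_eq_zero.1 h).resolve_left Complex.I_ne_zero
  have hab : a = -(Complex.I • b) := eq_neg_of_add_eq_zero_left h
  cases κ with
  | boson =>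
    obtain ⟨hc, had, hl⟩ := hW
    have hz : ∀ w ∈ W, form a w = 0 := by
      intro w hw
      have h1 := (hl a).1 ha w hw
      have h2 := (hl b).1 hb w hw
      have h3 : form a w = Complex.I * form b w := by
        rw [hab, ← neg_smul, form_smul_left]
        simp
      refine Complex.ext ?_ h1
      rw [h3]
      simp [h2]
    obtain ⟨x, hx, y, hy, hxp, hyn, hxy⟩ := had a ha
    refine eq_zero_of_form_self ?_
    have h2 : V.sym a = x - y := by
      rw [hxy, map_add, show V.sym x = x from hxp, show V.sym y = -y from hyn, sub_eq_add_neg]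
    rw [h2]
    exact hz _ (W.sub_mem hx hy)
  | fermion =>
    obtain ⟨hn, hcomp⟩ := hW
    obtain ⟨s, hs⟩ := hn.exists_induced
    have h1 := (hs.fixed a).1 ha
    have h2 := (hs.fixed b).1 hb
    rw [hab, map_neg, hcomp s hs, h2, neg_neg, ← hab] at h1
    have h3 : Complex.I • b = a := by simpa [hab] using h1
    rw [h3] at h
    have h4 : (2 : ℂ) • a = 0 := by rw [two_smul]; exact h
    exact (smul_eq_zero.1 h4).resolve_left two_ne_zero


/-- The pair `(vᴿ, vᴵ)` of elements of `W` with `v = vᴿ + i vᴵ`. -/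
noncomputable def split (W : Submodule ℝ V) (v : V) : V × V :=
  Classical.epsilon fun p : V × V => p.1 ∈ W ∧ p.2 ∈ W ∧ v = p.1 + Complex.I • p.2

/-- The value `{v̂, ŵ}` of the complex bilinear extension of `{·,·}` from `W` to its complexification, at
`v̂ = vᴿ - i vᴵ` and `ŵ = wᴿ - i wᴵ`. -/
noncomputable def hatForm (W : Submodule ℝ V) (v w : V) : ℂ :=
  form (split W v).1 (split W w).1 - Complex.I * form (split W v).1 (split W w).2
    - Complex.I * form (split W v).2 (split W w).1 - form (split W v).2 (split W w).2

theorem IsDynamical.split_spec {κ : Statistics} {W : Submodule ℝ V} (hW : IsDynamical κ W) (v : V) :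
    (split W v).1 ∈ W ∧ (split W v).2 ∈ W ∧ v = (split W v).1 + Complex.I • (split W v).2 := by
  obtain ⟨a, ha, b, hb, h⟩ := hW.exists_split v
  exact Classical.epsilon_spec (p := fun p : V × V => p.1 ∈ W ∧ p.2 ∈ W ∧ v = p.1 + Complex.I • p.2)
    ⟨(a, b), ha, hb, h⟩

theorem IsDynamical.split_eq {κ : Statistics} {W : Submodule ℝ V} (hW : IsDynamical κ W)
    {v a b : V} (ha : a ∈ W) (hb : b ∈ W) (h : v = a + Complex.I • b) : split W v = (a, b) := by
  obtain ⟨h1, h2, h3⟩ := hW.split_spec v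
  have h4 := hW.split_eq_zero (W.sub_mem h1 ha) (W.sub_mem h2 hb) (by
    rw [smul_sub, sub_add_sub_comm, ← h3, ← h, sub_self])
  exact Prod.ext (sub_eq_zero.1 h4.1) (sub_eq_zero.1 h4.2)

theorem IsDynamical.split_add {κ : Statistics} {W : Submodule ℝ V} (hW : IsDynamical κ W)
    (v w : V) : split W (v + w) = split W v + split W w := by
  obtain ⟨h1, h2, h3⟩ := hW.split_spec v
  obtain ⟨k1, k2, k3⟩ := hW.split_spec w
  refine hW.split_eq (W.add_mem h1 k1) (W.add_mem h2 k2) ?_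
  conv_lhs => rw [h3, k3]
  rw [smul_add]
  abel

theorem IsDynamical.split_smul {κ : Statistics} {W : Submodule ℝ V} (hW : IsDynamical κ W)
    (z : ℂ) (v : V) : split W (z • v) =
      ((z.re : ℂ) • (split W v).1 - (z.im : ℂ) • (split W v).2,
        (z.im : ℂ) • (split W v).1 + (z.re : ℂ) • (split W v).2) := by
  obtain ⟨h1, h2, h3⟩ := hW.split_spec v
  have hr : ∀ (r : ℝ) {x : V}, x ∈ W → (r : ℂ) • x ∈ W := fun r x hx => by
    rw [Complex.coe_smul]
    exact W.smul_mem r hx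
  refine hW.split_eq (W.sub_mem (hr _ h1) (hr _ h2)) (W.add_mem (hr _ h1) (hr _ h2)) ?_
  conv_lhs => rw [h3, ← Complex.re_add_im z]
  generalize (split W v).1 = a
  generalize (split W v).2 = b
  match_scalars
  · ring
  · linear_combination (z.im : ℂ) * Complex.I_mul_I

theorem IsDynamical.hatForm_add_left {κ : Statistics} {W : Submodule ℝ V} (hW : IsDynamical κ W)
    (a b c : V) : hatForm W (a + b) c = hatForm W a c + hatForm W b c := by
  simp only [hatForm, hW.split_add, Prod.fst_add, Prod.snd_add, form_add_left]
  ring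

theorem IsDynamical.hatForm_add_right {κ : Statistics} {W : Submodule ℝ V} (hW : IsDynamical κ W)
    (a b c : V) : hatForm W a (b + c) = hatForm W a b + hatForm W a c := by
  simp only [hatForm, hW.split_add, Prod.fst_add, Prod.snd_add, form_add_right]
  ring

theorem IsDynamical.hatForm_smul_left {κ : Statistics} {W : Submodule ℝ V} (hW : IsDynamical κ W)
    (z : ℂ) (a c : V) : hatForm W (z • a) c = conj z * hatForm W a c := by
  have i3 : ∀ x y z : V, form (x - y) z = form x z - form y z := fun x y z => inner_sub_left _ _ _
  have hz : conj z = (z.re : ℂ) - z.im * Complex.I := by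
    apply Complex.ext <;> simp
  simp only [hatForm, hW.split_smul, i3, form_add_left, form_smul_left, Complex.conj_ofReal]
  rw [hz]
  ring_nf
  rw [Complex.I_sq]
  ring

theorem IsDynamical.hatForm_smul_right {κ : Statistics} {W : Submodule ℝ V} (hW : IsDynamical κ W)
    (z : ℂ) (a c : V) : hatForm W a (z • c) = conj z * hatForm W a c := by
  have i4 : ∀ x y z : V, form x (y - z) = form x y - form x z := fun x y z => by
    rw [form, map_sub, inner_sub_right, form, form]
  have hz : conj z = (z.re : ℂ) - z.im * Complex.I := by
    apply Complex.ext <;> simp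
  simp only [hatForm, hW.split_smul, i4, form_add_right, form_smul_right]
  rw [hz]
  ring_nf
  rw [Complex.I_sq]
  ring

end KreinSpace

open KreinSpace

/-- States over `V` as families of `n`-argument functions, one for each degree `n`. The Fock space of `V`
consists of families of continuous `n`-linear functions, symmetric or antisymmetric. All states that
are used below are combinations of the generating states, and so lie in the Fock space. -/
abbrev FockState (V : KreinSpace.{u}) : Type u := ∀ n : ℕ, (Fin n → V) → ℂ

section Fock

variable {V : KreinSpace.{u}} (κ : Statistics)

/-- The generating state `ψ[ξ₁, …, ξₙ]`, of degree `n`: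
`ψ[ξ](η) = (1 / n!) ∑ σ, κ ^ |σ| ∏ i, {ξ i, η (σ i)}`. -/
noncomputable def genState {n : ℕ} (ξ : Fin n → V) : FockState V :=
  Pi.single n fun η => (n.factorial : ℂ)⁻¹ *
    ∑ σ : Equiv.Perm (Fin n), κ.permSign σ * ∏ i, form (ξ i) (η (σ i))

/-- The vacuum `𝟏`, of degree `0`. -/
def vacuum (V : KreinSpace.{u}) : FockState V := Pi.single 0 fun _ => 1

/-- The dense subspace of the Fock space that is spanned by the generating states and the vacuum (the
latter is the generating state of degree `0`). Amplitude maps are defined on it. -/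
noncomputable def stateDom (V : KreinSpace.{u}) : Submodule ℂ (FockState V) :=
  Submodule.span ℂ (Set.range fun p : Σ n : ℕ, Fin n → V => genState κ p.2)

theorem genState_zero (ξ : Fin 0 → V) : genState κ ξ = vacuum V := by
  unfold genState vacuum
  congr 1
  funext η
  cases κ <;> simp [Statistics.permSign]

/-- The amplitude of `ψ[ξ₁, …, ξₙ]`: zero for odd `n`, and for `n = 2 k`
`(1 / k!) ∑ σ, κ ^ |σ| ∏ j ≤ k, {ξ̂ (σ j), ξ̂ (σ (2 k + 1 - j))}`. -/
noncomputable def amplValue (W : Submodule ℝ V) {n : ℕ} (ξ : Fin n → V) : ℂ :=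
  if Even n then
    ((n / 2).factorial : ℂ)⁻¹ * ∑ σ : Equiv.Perm (Fin n), κ.permSign σ *
      ∏ j : Fin (n / 2), hatForm W (ξ (σ (Fin.castLE (Nat.div_le_self n 2) j)))
        (ξ (σ (Fin.rev (Fin.castLE (Nat.div_le_self n 2) j))))
  else 0

theorem amplValue_perm (W : Submodule ℝ V) {n : ℕ} (ξ : Fin n → V) (τ : Equiv.Perm (Fin n)) :
    amplValue κ W (ξ ∘ τ) = κ.permSign τ * amplValue κ W ξ := by
  unfold amplValue
  split_ifs
  · rw [mul_left_comm]
    congr 1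
    rw [Finset.mul_sum]
    conv_rhs => rw [← Equiv.sum_comp (Equiv.mulLeft τ)]
    refine Finset.sum_congr rfl fun σ _ => ?_
    simp only [Equiv.coe_mulLeft, κ.permSign_mul, Equiv.Perm.mul_apply, Function.comp_apply]
    rw [← mul_assoc, ← mul_assoc, κ.permSign_mul_self, one_mul]
  · simp


/-- The amplitude value is additive and conjugate homogeneous in each argument. -/
theorem amplValue_update {κ : Statistics} {W : Submodule ℝ V} (hW : IsDynamical κ W) {n : ℕ}
    (ξ : Fin n → V) (i : Fin n) :
    (∀ x y, amplValue κ W (Function.update ξ i (x + y)) =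
      amplValue κ W (Function.update ξ i x) + amplValue κ W (Function.update ξ i y)) ∧
    ∀ (z : ℂ) x, amplValue κ W (Function.update ξ i (z • x)) =
      conj z * amplValue κ W (Function.update ξ i x) := by
  by_cases hn : Even n
  swap
  · simp [amplValue, hn]
  have key : ∀ σ : Equiv.Perm (Fin n), ∃ (C : ℂ) (v : V) (l : Prop), ∀ x,
      ∏ j : Fin (n / 2), hatForm W
        ((Function.update ξ i x) (σ (Fin.castLE (Nat.div_le_self n 2) j)))
        ((Function.update ξ i x) (σ (Fin.rev (Fin.castLE (Nat.div_le_self n 2) j)))) =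
      C * (open Classical in if l then hatForm W x v else hatForm W v x) := by
    intro σ
    have hdis : ∀ j : Fin (n / 2), Fin.castLE (Nat.div_le_self n 2) j ≠
        Fin.rev (Fin.castLE (Nat.div_le_self n 2) j) := by
      intro j h
      have := congrArg Fin.val h
      simp only [Fin.val_castLE, Fin.val_rev] at this
      omega
    obtain ⟨j₀, hj₀⟩ : ∃ j : Fin (n / 2), σ.symm i = Fin.castLE (Nat.div_le_self n 2) j ∨
        σ.symm i = Fin.rev (Fin.castLE (Nat.div_le_self n 2) j) := by
      obtain ⟨m, hm⟩ := hn
      by_cases h : (σ.symm i : ℕ) < n / 2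
      · exact ⟨⟨_, h⟩, Or.inl (Fin.ext rfl)⟩
      · refine ⟨⟨n - 1 - (σ.symm i : ℕ), by omega⟩, Or.inr (Fin.ext ?_)⟩
        simp only [Fin.val_castLE, Fin.val_rev]
        omega
    have hoth : ∀ j : Fin (n / 2), j ≠ j₀ → σ.symm i ≠ Fin.castLE (Nat.div_le_self n 2) j ∧
        σ.symm i ≠ Fin.rev (Fin.castLE (Nat.div_le_self n 2) j) := by
      intro j hj
      have hj' : (j : ℕ) ≠ j₀ := fun h => hj (Fin.ext h)
      constructor <;> intro h <;> rcases hj₀ with h' | h' <;>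
      · have := congrArg Fin.val (h.symm.trans h')
        simp only [Fin.val_castLE, Fin.val_rev] at this
        omega
    have hne : ∀ k, σ.symm i ≠ k → ∀ x, Function.update ξ i x (σ k) = ξ (σ k) := fun k hk x =>
      Function.update_of_ne (fun h => hk (by rw [← h, Equiv.symm_apply_apply])) _ _
    have heq : ∀ k, σ.symm i = k → ∀ x, Function.update ξ i x (σ k) = x := fun k hk x => by
      rw [← hk, Equiv.apply_symm_apply, Function.update_self]
    refine ⟨∏ j ∈ Finset.univ.erase j₀, hatForm W
        (ξ (σ (Fin.castLE (Nat.div_le_self n 2) j)))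
        (ξ (σ (Fin.rev (Fin.castLE (Nat.div_le_self n 2) j)))), ?_⟩
    have hC : ∀ x, ∏ j ∈ Finset.univ.erase j₀, hatForm W
        ((Function.update ξ i x) (σ (Fin.castLE (Nat.div_le_self n 2) j)))
        ((Function.update ξ i x) (σ (Fin.rev (Fin.castLE (Nat.div_le_self n 2) j)))) =
      ∏ j ∈ Finset.univ.erase j₀, hatForm W
        (ξ (σ (Fin.castLE (Nat.div_le_self n 2) j)))
        (ξ (σ (Fin.rev (Fin.castLE (Nat.div_le_self n 2) j)))) := fun x =>
      Finset.prod_congr rfl fun j hj => by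
        have h := hoth j (Finset.ne_of_mem_erase hj)
        rw [hne _ h.1, hne _ h.2]
    rcases hj₀ with h | h
    · refine ⟨ξ (σ (Fin.rev (Fin.castLE (Nat.div_le_self n 2) j₀))), True, fun x => ?_⟩
      rw [← Finset.prod_erase_mul _ _ (Finset.mem_univ j₀), hC, if_pos trivial, heq _ h,
        hne _ (fun h' => hdis j₀ (h.symm.trans h'))]
    · refine ⟨ξ (σ (Fin.castLE (Nat.div_le_self n 2) j₀)), False, fun x => ?_⟩
      rw [← Finset.prod_erase_mul _ _ (Finset.mem_univ j₀), hC, if_neg id, heq _ h,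
        hne _ (fun h' => hdis j₀ (h'.symm.trans h))]
  choose C v l h using key
  have hval : ∀ x, amplValue κ W (Function.update ξ i x) = ((n / 2).factorial : ℂ)⁻¹ *
      ∑ σ : Equiv.Perm (Fin n), κ.permSign σ *
        (C σ * (open Classical in if l σ then hatForm W x (v σ) else hatForm W (v σ) x)) := by
    intro x
    rw [amplValue, if_pos hn]
    simp only [h]
  constructor
  · intro x y
    rw [hval, hval, hval, ← mul_add, ← Finset.sum_add_distrib]
    congr 1
    refine Finset.sum_congr rfl fun σ _ => ?_
    split_ifs
    · rw [hW.hatForm_add_left]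
      ring
    · rw [hW.hatForm_add_right]
      ring
  · intro z x
    rw [hval, hval, mul_left_comm]
    congr 1
    rw [Finset.mul_sum]
    refine Finset.sum_congr rfl fun σ _ => ?_
    split_ifs
    · rw [hW.hatForm_smul_left]
      ring
    · rw [hW.hatForm_smul_right]
      ring

/-- Expansion of an amplitude value in a finite family of vectors. -/
theorem amplValue_sum {κ : Statistics} {W : Submodule ℝ V} (hW : IsDynamical κ W) {n d : ℕ}
    (e : Fin d → V) (c : Fin n → Fin d → ℂ) :
    amplValue κ W (fun i => ∑ j, conj (c i j) • e j) =
      ∑ a : Fin n → Fin d, (∏ i, c i (a i)) * amplValue κ W (e ∘ a) := by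
  let T : (Fin d → ℂ) → V := fun x => ∑ j, conj (x j) • e j
  have hTu : ∀ (m : Fin n → Fin d → ℂ) (i : Fin n) (x : Fin d → ℂ),
      (fun k => T (Function.update m i x k)) = Function.update (fun k => T (m k)) i (T x) :=
    fun m i x => funext fun k => Function.apply_update (fun _ => T) m i x k
  let F : MultilinearMap ℂ (fun _ : Fin n => Fin d → ℂ) ℂ :=
    { toFun := fun m => amplValue κ W fun i => T (m i)
      map_update_add' := fun {inst} m i x y => by
        obtain rfl : inst = instDecidableEqFin n := Subsingleton.elim _ _
        rw [hTu, hTu, hTu, ← (amplValue_update hW _ i).1]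
        congr 2
        simp only [T, Pi.add_apply, map_add, add_smul, Finset.sum_add_distrib]
      map_update_smul' := fun {inst} m i z x => by
        obtain rfl : inst = instDecidableEqFin n := Subsingleton.elim _ _
        have h : T (z • x) = conj z • T x := by
          simp only [T, Pi.smul_apply, smul_eq_mul, map_mul, mul_smul, Finset.smul_sum]
        rw [hTu, hTu, h, (amplValue_update hW _ i).2, Complex.conj_conj, smul_eq_mul] }
  have hF : ∀ m, F m = amplValue κ W fun i => T (m i) := fun _ => rfl
  have h1 : F c = F fun i => ∑ j, c i j • Pi.single j (1 : ℂ) := by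
    congr 1
    funext i
    exact pi_eq_sum_univ' (c i)
  have h2 : F c = amplValue κ W (fun i => ∑ j, conj (c i j) • e j) := rfl
  rw [← h2, h1, MultilinearMap.map_sum]
  refine Finset.sum_congr rfl fun a _ => ?_
  rw [MultilinearMap.map_smul_univ, smul_eq_mul, hF]
  congr 2
  funext i
  simp [T, Pi.single_apply, apply_ite]

/-- The amplitude value of a generating state, recovered from the state alone. -/
theorem amplValue_eq_genState {κ : Statistics} {W : Submodule ℝ V} (hW : IsDynamical κ W)
    {n d : ℕ} (e : Fin d → V) (ξ : Fin n → V)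
    (hξ : ∀ i, ξ i = ∑ j, inner ℂ (e j) (ξ i) • e j) :
    amplValue κ W ξ =
      ∑ a : Fin n → Fin d, genState κ ξ n (fun i => V.sym (e (a i))) * amplValue κ W (e ∘ a) := by
  have hf : ∀ v j, form v (V.sym (e j)) = inner ℂ v (e j) := fun v j => by
    rw [form, V.sym_sym]
  have hexp : amplValue κ W ξ =
      ∑ a : Fin n → Fin d, (∏ i, inner ℂ (ξ i) (e (a i))) * amplValue κ W (e ∘ a) := by
    conv_lhs => rw [show ξ = fun i => ∑ j, conj (inner ℂ (ξ i) (e j)) • e j from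
      funext fun i => by simp only [inner_conj_symm]; exact hξ i]
    exact amplValue_sum hW e _
  simp only [genState, Pi.single_eq_same, hf, Finset.sum_mul, Finset.mul_sum]
  rw [Finset.sum_comm]
  have hσ : ∀ σ : Equiv.Perm (Fin n), ∑ a : Fin n → Fin d,
      (n.factorial : ℂ)⁻¹ * (κ.permSign σ * ∏ i, inner ℂ (ξ i) (e (a (σ i)))) *
        amplValue κ W (e ∘ a) = (n.factorial : ℂ)⁻¹ * amplValue κ W ξ := by
    intro σ
    rw [hexp, Finset.mul_sum, ← Equiv.sum_comp (Equiv.arrowCongr σ (Equiv.refl (Fin d)))]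
    refine Finset.sum_congr rfl fun a _ => ?_
    have h1 : e ∘ (Equiv.arrowCongr σ (Equiv.refl (Fin d))) a = (e ∘ a) ∘ (σ⁻¹ : Equiv.Perm _) := by
      funext i; rfl
    rw [h1, amplValue_perm, κ.permSign_inv]
    simp only [Equiv.arrowCongr_apply, Function.comp_apply, Equiv.symm_apply_apply, Equiv.refl_apply]
    rw [mul_assoc, mul_mul_mul_comm, κ.permSign_mul_self, one_mul]
  rw [Finset.sum_congr rfl fun σ _ => hσ σ, Finset.sum_const, Finset.card_univ, Fintype.card_perm,
    Fintype.card_fin, nsmul_eq_mul, ← mul_assoc, mul_inv_cancel₀, one_mul]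
  exact_mod_cast n.factorial_ne_zero


/-- A linear relation between generating states is one between their amplitude values. -/
theorem amplValue_wellDefined {κ : Statistics} {W : Submodule ℝ V} (hW : IsDynamical κ W)
    (x : (Σ n : ℕ, Fin n → V) →₀ ℂ)
    (hx : Finsupp.linearCombination ℂ (fun p : Σ n : ℕ, Fin n → V => genState κ p.2) x = 0) :
    Finsupp.linearCombination ℂ (fun p : Σ n : ℕ, Fin n → V => amplValue κ W p.2) x = 0 := by
  let E : Submodule ℂ V := Submodule.span ℂ (⋃ p ∈ x.support, Set.range p.2)
  have : FiniteDimensional ℂ E := FiniteDimensional.span_of_finite ℂ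
    (x.support.finite_toSet.biUnion fun p _ => Set.finite_range _)
  let b := stdOrthonormalBasis ℂ E
  let e : Fin (Module.finrank ℂ E) → V := fun j => b j
  let N := x.support.sup (fun p => p.1) + 1
  let Λ : FockState V →ₗ[ℂ] ℂ := ∑ n ∈ Finset.range N, ∑ a : Fin n → Fin (Module.finrank ℂ E),
    amplValue κ W (e ∘ a) • ((LinearMap.proj (fun i => V.sym (e (a i)))) ∘ₗ
      (LinearMap.proj n : FockState V →ₗ[ℂ] ((Fin n → V) → ℂ)))
  have hΛ : ∀ p ∈ x.support, Λ (genState κ p.2) = amplValue κ W p.2 := by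
    intro p hp
    have hpN : p.1 ∈ Finset.range N :=
      Finset.mem_range.2 (Nat.lt_succ_of_le (Finset.le_sup (f := fun p => p.1) hp))
    have hspan : ∀ i, p.2 i = ∑ j, inner ℂ (e j) (p.2 i) • e j := by
      intro i
      have hmem : p.2 i ∈ E := Submodule.subset_span (Set.mem_biUnion hp ⟨i, rfl⟩)
      have h := congrArg (Subtype.val) (b.sum_repr' ⟨p.2 i, hmem⟩)
      simp only [Submodule.coe_sum, Submodule.coe_smul, Submodule.coe_inner] at h
      exact h.symm
    rw [amplValue_eq_genState hW e p.2 hspan]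
    simp only [Λ, LinearMap.sum_apply, LinearMap.smul_apply, LinearMap.comp_apply,
      LinearMap.proj_apply, smul_eq_mul]
    rw [Finset.sum_eq_single_of_mem p.1 hpN]
    · exact Finset.sum_congr rfl fun a _ => mul_comm _ _
    · intro n _ hn
      refine Finset.sum_eq_zero fun a _ => ?_
      rw [genState, Pi.single_eq_of_ne hn]
      simp
  have h := congrArg Λ hx
  rw [map_zero, Finsupp.linearCombination_apply, map_finsuppSum] at h
  rw [Finsupp.linearCombination_apply, ← h]
  refine Finsupp.sum_congr fun p hp => ?_
  rw [map_smul, hΛ p hp]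

theorem exists_amplitude {κ : Statistics} {W : Submodule ℝ V} (hW : IsDynamical κ W) :
    ∃ ρ : stateDom κ V →ₗ[ℂ] ℂ, ∀ (n : ℕ) (ξ : Fin n → V),
      ρ ⟨genState κ ξ, Submodule.subset_span ⟨⟨n, ξ⟩, rfl⟩⟩ = amplValue κ W ξ := by
  let f := Finsupp.linearCombination ℂ (fun p : Σ n : ℕ, Fin n → V => genState κ p.2)
  let a := Finsupp.linearCombination ℂ (fun p : Σ n : ℕ, Fin n → V => amplValue κ W p.2)
  have hker : LinearMap.ker f ≤ LinearMap.ker a := fun x hx => amplValue_wellDefined hW x hx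
  have hr : stateDom κ V = LinearMap.range f := (Finsupp.range_linearCombination _).symm
  refine ⟨((LinearMap.ker f).liftQ a hker) ∘ₗ f.quotKerEquivRange.symm.toLinearMap ∘ₗ
    (LinearEquiv.ofEq _ _ hr).toLinearMap, fun n ξ => ?_⟩
  have h1 : f (Finsupp.single ⟨n, ξ⟩ 1) = genState κ ξ := by
    simp [f]
  have h2 : LinearEquiv.ofEq _ _ hr ⟨genState κ ξ, Submodule.subset_span ⟨⟨n, ξ⟩, rfl⟩⟩ =
      f.quotKerEquivRange (Submodule.Quotient.mk (Finsupp.single ⟨n, ξ⟩ 1)) := by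
    apply Subtype.ext
    rw [LinearMap.quotKerEquivRange_apply_mk, h1]
    rfl
  rw [LinearMap.comp_apply, LinearMap.comp_apply, LinearEquiv.coe_coe, LinearEquiv.coe_coe, h2,
    LinearEquiv.symm_apply_apply, Submodule.liftQ_apply]
  simp [a]

/-- The amplitude map of a region whose boundary values of solutions form `W`: the linear map with the
values `amplValue` on generating states. -/
noncomputable def amplitude {κ : Statistics} {W : Submodule ℝ V} (hW : IsDynamical κ W) :
    stateDom κ V →ₗ[ℂ] ℂ :=
  Classical.choose (exists_amplitude hW)

theorem amplitude_genState {κ : Statistics} {W : Submodule ℝ V} (hW : IsDynamical κ W) {n : ℕ}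
    (ξ : Fin n → V) :
    amplitude hW ⟨genState κ ξ, Submodule.subset_span ⟨⟨n, ξ⟩, rfl⟩⟩ = amplValue κ W ξ :=
  Classical.choose_spec (exists_amplitude hW) n ξ

/-- The antilinear map of states that comes with a conjugate linear identification `b`:
`(ι ψ)(b ξ₁, …, b ξₙ)` is the complex conjugate of `ψ(ξₙ, …, ξ₁)`. -/
noncomputable def iota {U : KreinSpace.{u}} (b : V ≃L⋆[ℂ] U) (ψ : FockState V) : FockState U :=
  fun n η => conj (ψ n fun i => b.symm (η (Fin.rev i)))

/-- The state over `V` that a linear map `pr : V → U` makes of a state over `U`. -/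
def pull {U : KreinSpace.{u}} (pr : V →L[ℂ] U) (ψ : FockState U) : FockState V :=
  fun n ζ => ψ n fun i => pr (ζ i)

/-- The graded symmetrized product of states: for `ψ`, `φ` of degrees `m`, `k` and `n = m + k`,
`(1 / n!) ∑ σ, κ ^ |σ| ψ(ζ (σ 1), …, ζ (σ m)) φ(ζ (σ (m + 1)), …, ζ (σ n))`. -/
noncomputable def stateMul (ψ φ : FockState V) : FockState V := fun n ζ =>
  (n.factorial : ℂ)⁻¹ * ∑ σ : Equiv.Perm (Fin n), κ.permSign σ *
    ∑ p : {p : ℕ × ℕ // p ∈ Finset.HasAntidiagonal.antidiagonal n},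
      ψ p.1.1 (fun i => ζ (σ (Fin.cast (Finset.HasAntidiagonal.mem_antidiagonal.1 p.2) (Fin.castAdd p.1.2 i)))) *
      φ p.1.2 (fun j => ζ (σ (Fin.cast (Finset.HasAntidiagonal.mem_antidiagonal.1 p.2) (Fin.natAdd p.1.1 j))))

/-- An orthonormal basis of a (finite-dimensional) subspace `E`, as a Krein space: it consists of
orthonormal bases of `E ∩ V⁺` and of `E ∩ V⁻` with reversed inner product. -/
structure IsKreinBasis (E : Submodule ℂ V) {d : ℕ} (ξ : Fin d → V) : Prop where
  homogeneous : ∀ i, ξ i ∈ V.pos ∨ ξ i ∈ V.neg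
  orthonormal : Orthonormal ℂ ξ
  span_eq : Submodule.span ℂ (Set.range ξ) = E

/-- The sign `(-1) ^ ([ξ (a 1)] + … + [ξ (a m)])`. This is `(-1) ^ [ζ]` for a state `ζ` proportional
to `ψ[ξ (a 1), …, ξ (a m)]`. -/
noncomputable def sigSign {d m : ℕ} (ξ : Fin d → V) (a : Fin m → Fin d) : ℂ :=
  (-1) ^ ∑ i, sig (ξ (a i))

open Classical in
/-- The indices of degree `m` of the orthonormal basis of the Fock space of a `d`-dimensional space:
`a 1 ≤ … ≤ a m` for bosons, `a 1 < … < a m` for fermions. -/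
noncomputable def fockIndex (m d : ℕ) : Finset (Fin m → Fin d) :=
  match κ with
  | .boson => Finset.univ.filter fun a => Monotone a
  | .fermion => Finset.univ.filter fun a => StrictMono a

/-- The element `ψ[ξ (a 1), …, ξ (a m)] / √(2 ^ m K)` of the orthonormal basis of Fock space induced
by the basis `ξ`, where `K` is the number of permutations that leave `a` unchanged (`K = 1` for
fermions). -/
noncomputable def fockBasis {d m : ℕ} (ξ : Fin d → V) (a : Fin m → Fin d) : FockState V :=
  ((Real.sqrt (2 ^ m * Nat.card {σ : Equiv.Perm (Fin m) // a ∘ σ = a}) : ℝ) : ℂ)⁻¹ •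
    genState κ (ξ ∘ a)

end Fock

/-- The data of a spacetime system on which axioms for field theories depend: hypersurfaces and regions
(regular regions and slice regions), with orientation reversal, decompositions into disjoint unions,
boundaries, and gluings of a region to itself. The theory only sees these operations, so no manifold
structure is recorded. -/
structure SpacetimeSystem where
  /-- hypersurfaces -/
  Hyp : Type u
  /-- regions -/
  Reg : Type u
  /-- orientation reversal -/
  rev : Hyp → Hyp
  rev_rev : ∀ S, rev (rev S) = S
  /-- the ways in which a hypersurface is the disjoint union of the members of a finite family -/
  Decomp : Hyp → {n : ℕ} → (Fin n → Hyp) → Type u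
  /-- the boundary of a region -/
  bdry : Reg → Hyp
  /-- the slice region of a hypersurface -/
  slice : Hyp → Reg
  slice_rev : ∀ S, slice (rev S) = slice S
  sliceDecomp : ∀ S, Decomp (bdry (slice S)) ![S, rev S]
  /-- the ways in which a region `M` is the disjoint union of `M₁` and `M₂` -/
  DisjUnion : Reg → Reg → Reg → Type u
  unionDecomp : ∀ {M M₁ M₂}, DisjUnion M M₁ M₂ → Decomp (bdry M) ![bdry M₁, bdry M₂]
  /-- the ways in which `M₁` is the gluing of `M` to itself along `S` and the reverse of a copy of `S`,
  both contained in the boundary of `M`; a copy of `S` is `S` itself, listed a second time -/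
  Gluing : Reg → Hyp → Reg → Type u
  gluingDecomp : ∀ {M S M₁}, Gluing M S M₁ → Decomp (bdry M) ![bdry M₁, S, rev S]

/-- A linear classical field theory on a spacetime system. -/
structure ClassicalTheory (κ : Statistics) (X : SpacetimeSystem.{u}) where
  /-- the Krein space of a hypersurface -/
  L : X.Hyp → KreinSpace.{v}
  /-- the conjugate linear identification under reversal of orientation -/
  bar : ∀ S, L S ≃L⋆[ℂ] L (X.rev S)
  bar_bar : ∀ S φ, HEq (bar (X.rev S) (bar S φ)) φ
  form_bar : ∀ S φ φ', form (bar S φ') (bar S φ) = κ.kappa * conj (form φ' φ)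
  /-- the isometric isomorphism from the orthogonal direct sum for a disjoint decomposition -/
  iso : ∀ {S : X.Hyp} {n : ℕ} {p : Fin n → X.Hyp}, X.Decomp S p → (∀ i, L (p i)) ≃L[ℂ] L S
  form_iso : ∀ {S : X.Hyp} {n : ℕ} {p : Fin n → X.Hyp} (D : X.Decomp S p) (x y : ∀ i, L (p i)),
    form (iso D x) (iso D y) = ∑ i, form (x i) (y i)
  /-- the real vector space of solutions in a region -/
  Sol : X.Reg → Type w
  [solGroup : ∀ M, AddCommGroup (Sol M)]
  [solModule : ∀ M, Module ℝ (Sol M)]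
  /-- boundary values of solutions -/
  r : ∀ M, Sol M →ₗ[ℝ] L (X.bdry M)
  isDynamical : ∀ M, IsDynamical κ (LinearMap.range (r M))
  /-- solutions in a disjoint union of regions -/
  solUnion : ∀ {M M₁ M₂}, X.DisjUnion M M₁ M₂ → (Sol M₁ × Sol M₂) ≃ₗ[ℝ] Sol M
  r_solUnion : ∀ {M M₁ M₂} (h : X.DisjUnion M M₁ M₂) (x : Sol M₁ × Sol M₂),
    (iso (X.unionDecomp h)).symm (r M (solUnion h x)) 0 = r M₁ x.1 ∧
    (iso (X.unionDecomp h)).symm (r M (solUnion h x)) 1 = r M₂ x.2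
  /-- the map from solutions in a glued region to solutions in the original region -/
  unglue : ∀ {M S M₁}, X.Gluing M S M₁ → Sol M₁ →ₗ[ℝ] Sol M
  unglue_injective : ∀ {M S M₁} (g : X.Gluing M S M₁), Function.Injective (unglue g)
  mem_range_unglue : ∀ {M S M₁} (g : X.Gluing M S M₁) (x : Sol M),
    x ∈ LinearMap.range (unglue g) ↔
      bar S ((iso (X.gluingDecomp g)).symm (r M x) 1) = (iso (X.gluingDecomp g)).symm (r M x) 2
  r_unglue : ∀ {M S M₁} (g : X.Gluing M S M₁) (y : Sol M₁),
    (iso (X.gluingDecomp g)).symm (r M (unglue g y)) 0 = r M₁ y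

attribute [instance] ClassicalTheory.solGroup ClassicalTheory.solModule

namespace ClassicalTheory

variable {κ : Statistics} {X : SpacetimeSystem.{u}} (T : ClassicalTheory.{u, v, w} κ X)

/-- The orthogonal projection to a component of a decomposed hypersurface. -/
noncomputable def proj {S : X.Hyp} {n : ℕ} {p : Fin n → X.Hyp} (D : X.Decomp S p) (i : Fin n) :
    T.L S →L[ℂ] T.L (p i) :=
  (ContinuousLinearMap.proj i).comp ((T.iso D).symm : T.L S →L[ℂ] ∀ i, T.L (p i))

/-- The domain of the amplitude maps in the state space of a hypersurface. -/
noncomputable def dom (S : X.Hyp) : Submodule ℂ (FockState (T.L S)) := stateDom κ (T.L S)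

open Classical in
/-- The amplitude map of a region, given the value `0` outside of its domain. -/
noncomputable def ampl (M : X.Reg) (ψ : FockState (T.L (X.bdry M))) : ℂ :=
  if h : ψ ∈ T.dom (X.bdry M) then amplitude (T.isDynamical M) ⟨ψ, h⟩ else 0

variable {M M₁ : X.Reg} {S : X.Hyp} (g : X.Gluing M S M₁)

/-- The state `τ(ψ ⊗ ξ ⊗ ι(ξ))` on the boundary of `M`, for states `ψ` on the boundary of the glued
region and `ξ` on the hypersurface along which `M` is glued. -/
noncomputable def gluedState (ψ : FockState (T.L (X.bdry M₁))) (ξ : FockState (T.L S)) :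
    FockState (T.L (X.bdry M)) :=
  stateMul κ (pull (T.proj (X.gluingDecomp g) 0) ψ)
    (stateMul κ (pull (T.proj (X.gluingDecomp g) 1) ξ)
      (pull (T.proj (X.gluingDecomp g) 2) (iota (T.bar S) ξ)))

/-- The summand of degree `m` of the restricted gluing anomaly factor, in a basis `ξ` of a
finite-dimensional Krein subspace. -/
noncomputable def anomalyTerm {d : ℕ} (ξ : Fin d → T.L S) (m : ℕ) : ℂ :=
  (2 ^ m * (m.factorial : ℂ))⁻¹ * ∑ a : Fin m → Fin d,
    sigSign ξ a * T.ampl M (T.gluedState g (vacuum _) (genState κ (ξ ∘ a)))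

/-- The gluing anomaly factor is well defined and equal to `c`: it is the limit of the restricted
anomaly factors, over the directed set of finite-dimensional Krein subspaces. Sums over the degree
have to converge absolutely, and the choice of the basis is irrelevant. -/
def IsAnomalyFactor (c : ℂ) : Prop :=
  ∀ ε > 0, ∃ E : Submodule ℂ (T.L S), FiniteDimensional ℂ E ∧ IsAdapted E ∧
    ∀ F : Submodule ℂ (T.L S), E ≤ F → FiniteDimensional ℂ F → IsAdapted F →
      ∃ (d : ℕ) (ξ : Fin d → T.L S) (z : ℂ), IsKreinBasis F ξ ∧ HasSum (T.anomalyTerm g ξ) z ∧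
        ‖z - c‖ < ε

/-- The summands of degree `m` of `∑ (-1) ^ [ζ] ρ(τ(ψ ⊗ ζ ⊗ ι(ζ)))`, where `ζ` runs over the
orthonormal basis of Fock space induced by `ξ`. -/
noncomputable def gluingTerm (ψ : FockState (T.L (X.bdry M₁))) {d : ℕ} (ξ : Fin d → T.L S)
    (m : ℕ) : ℂ :=
  ∑ a ∈ fockIndex κ m d, sigSign ξ a * T.ampl M (T.gluedState g ψ (fockBasis κ ξ a))

/-- The sum `∑ (-1) ^ [ζ] ρ(τ(ψ ⊗ ζ ⊗ ι(ζ)))` exists and equals `z`, as the limit over the directed set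
of finite-dimensional Krein subspaces of the corresponding sums, ordered by degree and absolutely
convergent, for any orthonormal basis of the subspace. -/
def HasGluingSum (ψ : FockState (T.L (X.bdry M₁))) (z : ℂ) : Prop :=
  ∀ ε > 0, ∃ E : Submodule ℂ (T.L S), FiniteDimensional ℂ E ∧ IsAdapted E ∧
    ∀ F : Submodule ℂ (T.L S), E ≤ F → FiniteDimensional ℂ F → IsAdapted F →
      ∀ (d : ℕ) (ξ : Fin d → T.L S), IsKreinBasis F ξ →
        ∃ s : ℂ, HasSum (T.gluingTerm g ψ ξ) s ∧ ‖s - z‖ < ε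

end ClassicalTheory

end GBF

/-! The amplitude is a Gaussian state: it satisfies Wick's rule, by which its first argument is
contracted in turn with every other argument, with signs `κ`. Gluing inserts pairs `(ξ_a, \bar ξ_a)`
into it. The sum over the degree `m` is the exponential of half the operator that inserts one such
pair (`pairSum`, `expTerm`). The factor `1 / (2^m K)` of the Fock basis becomes the factor `1 / (2^m
m!)` of this exponential when ordered index tuples are replaced by all tuples (`sum_fockIndex`).

Let `F_m(L)` be the term of degree `m` with further arguments `L`. Wick's rule passes to `F_m`
(`expTerm_succ_cons`): a first argument is contracted either with `L`, or with one member of an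
inserted pair, which leaves the other member as an argument of `F_{m-1}`. The solutions on the glued
region restrict to solutions on `M` that agree on the two copies of `Σ`. Therefore an argument `η`
from the glued boundary has an extension `v = η + u`, with `u` in the two copies of `Σ`, such that
`v` contracts with the glued boundary as `η` does for `M₁`, and such that its contractions with all
inserted pairs add up to exactly `F_{m-1}(u, L)`. Hence `F_m(v, L) = C_m + F_{m-1}(u, L)`, where
`C_m` contracts `η` with `L` only. After summation over `m` the shift of degree does not matter, `u`
cancels, and `∑ F_m(η, L) = ∑ C_m`. This is Wick's rule for `M₁`, and induction on the number of
arguments gives `ρ_{M₁}` times the restricted anomaly factor (`hasSum_gluedTerm`). The identity is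
exact over every finite-dimensional subspace containing finitely many boundary values; the limit is
then immediate.

Cancelling `u` requires that `∑ F_m(u, L)` converges, while the hypothesis only concerns `L = []`.
For fermions the sums are finite. For bosons, following a contraction from pair to pair gives powers
of a finite matrix `N`, and the numbers `F_m([])` are the Taylor coefficients of `det (1 - t
N)^(-1/2)`. If these are absolutely summable, the determinant has no zero in the closed unit disc,
so `N` has spectral radius less than `1`, and the powers of `N` are summable. This controls the sums
with any further arguments (`summable_expTerm`). -/

namespace GBF

/-! ### Inverse square roots of determinants as power series -/

section PowerSeriesDet

open PowerSeries

variable {ι : Type*} [Fintype ι] [DecidableEq ι]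

/-- The formal logarithmic derivative of `det (1 - X M)` is `-∑ j, tr (M ^ (j + 1)) X ^ j`. -/
theorem derivative_charpolyRev (M : Matrix ι ι ℂ) :
    d⁄dX ℂ (M.charpolyRev : ℂ⟦X⟧) =
      -((M.charpolyRev : ℂ⟦X⟧) * PowerSeries.mk fun j => (M ^ (j + 1)).trace) := by
  let A : Matrix ι ι ℂ⟦X⟧ := 1 - (X : ℂ⟦X⟧) • M.map (C : ℂ →+* ℂ⟦X⟧)
  -- The Neumann series of `(1 - X M)⁻¹`.
  let G : Matrix ι ι ℂ⟦X⟧ := Matrix.of fun p q => PowerSeries.mk fun j => (M ^ j) p q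
  have hAG : A * G = 1 := by
    ext p q n
    rw [sub_mul, Matrix.smul_mul, one_mul]
    simp only [Matrix.sub_apply, Matrix.smul_apply, Matrix.mul_apply, smul_eq_mul, map_sub]
    cases n with
    | zero => simp [G, Matrix.one_apply, apply_ite]
    | succ n =>
      rw [PowerSeries.coeff_succ_X_mul, map_sum]
      simp [G, Matrix.one_apply, apply_ite, PowerSeries.coeff_C_mul, pow_succ' M, Matrix.mul_apply,
        PowerSeries.coeff_one]
  -- The Taylor shift `p(X) ↦ p(T + X)`, with `T` the outer polynomial variable. The derivative in
  -- `T` at `T = 0` is the derivative of `p`, and for determinants of the form `det (1 + T N)` that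
  -- derivative is a trace.
  let φ : Polynomial ℂ →+* Polynomial ℂ⟦X⟧ :=
    Polynomial.eval₂RingHom (Polynomial.C.comp C) (Polynomial.X + Polynomial.C X)
  have hφX : φ Polynomial.X = Polynomial.X + Polynomial.C X := Polynomial.eval₂_X _ _
  have hφC : ∀ z, φ (Polynomial.C z) = Polynomial.C (C z) := fun z => Polynomial.eval₂_C _ _
  have hφ0 : ∀ p, (φ p).eval 0 = (p : ℂ⟦X⟧) := by
    intro p
    rw [← Polynomial.coe_evalRingHom, ← RingHom.comp_apply,
      ← Polynomial.coeToPowerSeries.ringHom_apply]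
    congr 1
    ext z
    · simp [hφC]
    · simp [hφX]
  have hφd : ∀ p, Polynomial.derivative (φ p) = φ (Polynomial.derivative p) := by
    intro p
    induction p using Polynomial.induction_on' with
    | add p q hp hq => simp only [map_add, hp, hq]
    | monomial n z =>
      rw [← Polynomial.C_mul_X_pow_eq_monomial]
      simp only [map_mul, map_pow, hφX, hφC, Polynomial.derivative_mul, Polynomial.derivative_C, zero_mul, zero_add,
        Polynomial.derivative_pow, map_add, Polynomial.derivative_X, add_zero, mul_one,
        map_natCast]
  have hD : (M.charpolyRev : ℂ⟦X⟧) = A.det := by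
    rw [← hφ0, ← Polynomial.coe_evalRingHom, Matrix.charpolyRev, RingHom.map_det, RingHom.map_det]
    congr 1
    ext p q : 1
    simp [A, hφX, hφC, Matrix.one_apply, apply_ite, mul_comm (X : ℂ⟦X⟧)]
  -- From `1 - (T + X) M = A (1 - T G M)`, as `A G = 1`.
  have hfac : φ M.charpolyRev = Polynomial.C A.det *
      (1 + (Polynomial.X : Polynomial ℂ⟦X⟧) •
        (-(G * M.map (C : ℂ →+* ℂ⟦X⟧))).map Polynomial.C).det := by
    rw [RingHom.map_det, ← Matrix.det_mul, Matrix.charpolyRev, RingHom.map_det]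
    congr 1
    have h1 : (Polynomial.C.mapMatrix A : Matrix ι ι (Polynomial ℂ⟦X⟧)) *
        (-(G * M.map (C : ℂ →+* ℂ⟦X⟧))).map Polynomial.C =
        -(M.map (C : ℂ →+* ℂ⟦X⟧)).map Polynomial.C := by
      change Polynomial.C.mapMatrix A * Polynomial.C.mapMatrix _ = -(Polynomial.C.mapMatrix _)
      rw [← map_mul, mul_neg, ← mul_assoc, hAG, one_mul, map_neg]
    rw [mul_add, Matrix.mul_smul, h1, mul_one]
    ext p q : 1
    simp [A, hφX, hφC, Matrix.one_apply, apply_ite, Matrix.sub_apply]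
    ring
  have h := congrArg (fun p => (Polynomial.derivative p).eval 0) hfac
  simp only [hφd, hφ0, Polynomial.derivative_mul, Polynomial.derivative_C, zero_mul, zero_add,
    Polynomial.eval_mul, Polynomial.eval_C, Matrix.derivative_det_one_add_X_smul] at h
  rw [PowerSeries.derivative_coe, h, hD, Matrix.trace_neg, mul_neg]
  congr 2
  ext n
  simp [Matrix.trace, G, Matrix.mul_apply, pow_succ, PowerSeries.coeff_mul_C]

/-- A power series with logarithmic derivative `½ ∑ j, tr (M ^ (j + 1)) X ^ j` is an inverse square
root of `det (1 - X M)`. -/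
theorem sq_mul_charpolyRev_eq_one (M : Matrix ι ι ℂ) (f : ℕ → ℂ) (h0 : f 0 = 1)
    (hf : ∀ m : ℕ, ((m : ℂ) + 1) * f (m + 1) =
      2⁻¹ * ∑ p ∈ Finset.HasAntidiagonal.antidiagonal m, (M ^ (p.1 + 1)).trace * f p.2) :
    PowerSeries.mk f * PowerSeries.mk f * (M.charpolyRev : ℂ⟦X⟧) = 1 := by
  have hd : d⁄dX ℂ (PowerSeries.mk f) =
      C 2⁻¹ * ((PowerSeries.mk fun j => (M ^ (j + 1)).trace) * PowerSeries.mk f) := by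
    ext m
    rw [PowerSeries.coeff_derivative, PowerSeries.coeff_C_mul, PowerSeries.coeff_mul]
    simp only [PowerSeries.coeff_mk]
    rw [← hf, mul_comm]
  have h2 : (C 2⁻¹ : ℂ⟦X⟧) + C 2⁻¹ = 1 := by
    rw [← map_add]; norm_num
  -- With `D` the determinant and `t` the trace series, `(f² D)' = 2 · ½ t f² D - f² D t = 0`, so
  -- only the constant coefficient remains to be compared.
  refine PowerSeries.derivative.ext ?_ ?_
  · rw [Derivation.leibniz, Derivation.leibniz, derivative_charpolyRev, hd,
      PowerSeries.derivative_one]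
    simp only [smul_eq_mul]
    linear_combination PowerSeries.mk f * PowerSeries.mk f * (M.charpolyRev : ℂ⟦X⟧) *
      (PowerSeries.mk fun j => (M ^ (j + 1)).trace) * h2
  · have h1 : PowerSeries.constantCoeff (M.charpolyRev : ℂ⟦X⟧) = 1 := by
      rw [← PowerSeries.coeff_zero_eq_constantCoeff_apply, Polynomial.coeff_coe,
        Polynomial.coeff_zero_eq_eval_zero, Matrix.eval_charpolyRev]
    have h3 : PowerSeries.constantCoeff (PowerSeries.mk f) = 1 := by
      rw [← PowerSeries.coeff_zero_eq_constantCoeff_apply, PowerSeries.coeff_mk, h0]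
    simp [h1, h3]

/-- By Gelfand's formula `‖a ^ n‖` is eventually below `r ^ n`, for any `r` strictly between the
spectral radius and `1`. -/
theorem summable_norm_pow_of_spectralRadius_lt_one {A : Type*} [NormedRing A] [NormedAlgebra ℂ A]
    [CompleteSpace A] (a : A) (h : spectralRadius ℂ a < 1) : Summable fun n : ℕ => ‖a ^ n‖ := by
  obtain ⟨r, hr1, hr2⟩ := ENNReal.lt_iff_exists_nnreal_btwn.1 h
  have hr2' : (r : ℝ) < 1 := by exact_mod_cast hr2
  have hev := (spectrum.pow_nnnorm_pow_one_div_tendsto_nhds_spectralRadius a).eventually_lt_const hr1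
  refine Summable.of_norm_bounded_eventually_nat (summable_geometric_of_lt_one r.2 hr2') ?_
  filter_upwards [hev, Filter.eventually_gt_atTop 0] with n hn hn0
  have hn0' : (0 : ℝ) < n := by exact_mod_cast hn0
  have h1 : (‖a ^ n‖₊ : ENNReal) < (r : ENNReal) ^ (n : ℝ) := by
    rwa [one_div, ENNReal.rpow_inv_lt_iff hn0'] at hn
  rw [ENNReal.rpow_natCast] at h1
  have h2 : ‖a ^ n‖₊ < r ^ n := by exact_mod_cast h1
  rw [norm_norm]
  exact_mod_cast h2.le

/-- If an inverse square root of `det (1 - X M)` converges absolutely at `1`, so does the resolvent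
series of `M`. -/
theorem summable_norm_pow_apply (M : Matrix ι ι ℂ) (f : ℕ → ℂ) (h0 : f 0 = 1)
    (hf : ∀ m : ℕ, ((m : ℂ) + 1) * f (m + 1) =
      2⁻¹ * ∑ p ∈ Finset.HasAntidiagonal.antidiagonal m, (M ^ (p.1 + 1)).trace * f p.2)
    (hs : Summable fun m => ‖f m‖) (p q : ι) : Summable fun n : ℕ => ‖(M ^ n) p q‖ := by
  have hsq := sq_mul_charpolyRev_eq_one M f h0 hf
  -- Absolute convergence at `1` gives absolute convergence for `‖t‖ ≤ 1`, where Cauchy products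
  -- turn the formal identity `f² D = 1` into an identity of numbers. A zero of `D` would then give
  -- `0 = 1`.
  have hev : ∀ t : ℂ, ‖t‖ ≤ 1 → M.charpolyRev.eval t ≠ 0 := by
    intro t ht hD
    have hft : Summable fun m => ‖f m * t ^ m‖ := by
      refine Summable.of_nonneg_of_le (fun m => norm_nonneg _) (fun m => ?_) hs
      rw [norm_mul, norm_pow]
      exact mul_le_of_le_one_right (norm_nonneg _) (pow_le_one₀ (norm_nonneg _) ht)
    have hDt : Summable fun m => ‖M.charpolyRev.coeff m * t ^ m‖ := by
      refine summable_of_ne_finset_zero (s := M.charpolyRev.support) fun m hm => ?_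
      rw [Polynomial.notMem_support_iff.1 hm, zero_mul, norm_zero]
    have hDe : ∑' m, M.charpolyRev.coeff m * t ^ m = M.charpolyRev.eval t := by
      rw [Polynomial.eval_eq_sum, Polynomial.sum]
      refine tsum_eq_sum fun m hm => ?_
      rw [Polynomial.notMem_support_iff.1 hm, zero_mul]
    have hmul : ∀ a b : ℂ⟦X⟧, ∀ n, ∑ k ∈ Finset.HasAntidiagonal.antidiagonal n,
        (coeff k.1 a * t ^ k.1) * (coeff k.2 b * t ^ k.2) = coeff n (a * b) * t ^ n := by
      intro a b n
      rw [coeff_mul, Finset.sum_mul]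
      refine Finset.sum_congr rfl fun k hk => ?_
      rw [← Finset.HasAntidiagonal.mem_antidiagonal.1 hk, pow_add]
      ring
    have e1 := tsum_mul_tsum_eq_tsum_sum_antidiagonal_of_summable_norm hft hft
    have s1 := summable_norm_sum_mul_antidiagonal_of_summable_norm hft hft
    have m1 := hmul (PowerSeries.mk f) (PowerSeries.mk f)
    simp only [coeff_mk] at m1
    simp only [m1] at e1 s1
    have e2 := tsum_mul_tsum_eq_tsum_sum_antidiagonal_of_summable_norm s1 hDt
    have m2 := hmul (PowerSeries.mk f * PowerSeries.mk f) M.charpolyRev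
    simp only [Polynomial.coeff_coe, hsq] at m2
    simp only [m2] at e2
    rw [hDe, hD, mul_zero, tsum_eq_single 0 (fun n hn => by simp [coeff_one, hn])] at e2
    simp at e2
  let _ : NormedRing (Matrix ι ι ℂ) := Matrix.linftyOpNormedRing
  let _ : NormedAlgebra ℂ (Matrix ι ι ℂ) := Matrix.linftyOpNormedAlgebra
  have : Nonempty ι := ⟨p⟩
  -- An eigenvalue `z` with `1 ≤ ‖z‖` would give the zero `z⁻¹` of the reversed characteristic
  -- polynomial in the closed unit disc.
  have hsp : spectralRadius ℂ M < 1 := by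
    refine spectrum.spectralRadius_lt_of_forall_lt M (r := 1) fun z hz => ?_
    by_contra hlt
    have hz1 : 1 ≤ ‖z‖ := by exact_mod_cast not_lt.1 hlt
    have hz0 : z ≠ 0 := norm_pos_iff.1 (by linarith)
    refine hev z⁻¹ (by rw [norm_inv]; exact inv_le_one_of_one_le₀ hz1) ?_
    have hr := Matrix.mem_spectrum_iff_isRoot_charpoly.1 hz
    rw [Polynomial.IsRoot.def] at hr
    rw [← Matrix.reverse_charpoly, ← Polynomial.eval₂_id]
    let _ : Invertible z := invertibleOfNonzero hz0
    rw [← invOf_eq_inv, Polynomial.eval₂_reverse_eq_zero_iff, Polynomial.eval₂_id, hr]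
  have hs := summable_norm_pow_of_spectralRadius_lt_one M hsp
  refine Summable.of_nonneg_of_le (fun m => norm_nonneg _) (fun m => ?_) hs
  have h1 : ‖(M ^ m) p q‖₊ ≤ ‖M ^ m‖₊ := by
    rw [Matrix.linfty_opNNNorm_def]
    exact (Finset.single_le_sum (f := fun j => ‖(M ^ m) p j‖₊) (fun _ _ => zero_le)
      (Finset.mem_univ q)).trans
      (Finset.le_sup (f := fun i => ∑ j, ‖(M ^ m) i j‖₊) (Finset.mem_univ p))
  exact_mod_cast h1

end PowerSeriesDet
-- Signed sums over permutations and the combinatorial Wick rule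
namespace Statistics

variable (κ : Statistics)

theorem kappa_mul_self : κ.kappa * κ.kappa = 1 := by
  cases κ <;> simp [kappa]

theorem kappa_pow_of_even {n : ℕ} (hn : Even n) : κ.kappa ^ n = 1 := by
  obtain ⟨k, rfl⟩ := hn
  rw [← mul_two, pow_mul', sq, kappa_mul_self, one_pow]

theorem permSign_swap {n : ℕ} (a b : Fin n) :
    κ.permSign (Equiv.swap a b) = if a = b then 1 else κ.kappa := by
  cases κ
  · simp [permSign, kappa]
  · simp only [permSign, kappa, Equiv.Perm.sign_swap']
    split_ifs <;> simp

theorem permSign_cycleRange {n : ℕ} (i : Fin n) : κ.permSign i.cycleRange = κ.kappa ^ (i : ℕ) := by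
  cases κ <;> simp [permSign, kappa, Fin.sign_cycleRange]

theorem permSign_finRotate (n : ℕ) : κ.permSign (finRotate n) = κ.kappa ^ (n - 1) := by
  cases κ <;> simp [permSign, kappa, sign_finRotate]

theorem permSign_decomposeFin_symm_zero {n : ℕ} (τ : Equiv.Perm (Fin n)) :
    κ.permSign (Equiv.Perm.decomposeFin.symm (0, τ)) = κ.permSign τ := by
  cases κ <;> simp [permSign]

end Statistics

section PermSums

theorem sum_perm_fix_zero {n : ℕ} (g : Equiv.Perm (Fin (n + 1)) → ℂ) :
    ∑ σ with σ 0 = 0, g σ = ∑ τ, g (Equiv.Perm.decomposeFin.symm (0, τ)) := by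
  rw [Finset.sum_filter, ← Equiv.sum_comp Equiv.Perm.decomposeFin.symm, Fintype.sum_prod_type]
  simp [Finset.sum_ite_irrel]

/-- Laplace expansion of a signed sum over permutations along the image of `0`. -/
theorem sum_permSign_succ (κ : Statistics) {n : ℕ} (f : Equiv.Perm (Fin (n + 1)) → ℂ) :
    ∑ σ, κ.permSign σ * f σ = ∑ j : Fin (n + 1), κ.kappa ^ (j : ℕ) * ∑ τ, κ.permSign τ *
      f (j.cycleRange.symm * Equiv.Perm.decomposeFin.symm (0, τ)) := by
  rw [← Finset.sum_fiberwise Finset.univ (fun σ : Equiv.Perm (Fin (n + 1)) => σ 0)]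
  refine Finset.sum_congr rfl fun j _ => ?_
  -- The cycle `j.cycleRange` sends `j` to `0`, so composing with it yields a permutation that fixes
  -- `0`. Its sign is the source of the factor `κ ^ j`.
  have h : ∑ σ with σ 0 = j, κ.permSign σ * f σ = ∑ σ with σ 0 = 0,
      κ.permSign (j.cycleRange⁻¹ * σ) * f (j.cycleRange⁻¹ * σ) := by
    refine Finset.sum_equiv (Equiv.mulLeft j.cycleRange) (fun σ => ?_) (fun σ _ => ?_)
    · simp only [Finset.mem_filter, Finset.mem_univ, true_and, Equiv.coe_mulLeft,
        Equiv.Perm.mul_apply]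
      rw [← Equiv.eq_symm_apply (j.cycleRange), Fin.cycleRange_symm_zero]
    · simp
  rw [h, sum_perm_fix_zero, Finset.mul_sum]
  refine Finset.sum_congr rfl fun τ _ => ?_
  rw [κ.permSign_mul, κ.permSign_inv, κ.permSign_cycleRange, κ.permSign_decomposeFin_symm_zero,
    mul_assoc]
  rfl

variable {I : Type*} (B : I → I → ℂ)

/-- The product of the values of `B` at the nested pairs `(ξ j, ξ (n + 1 - j))`. -/
def nestProd {n : ℕ} (ξ : Fin n → I) : ℂ :=
  ∏ j : Fin (n / 2), B (ξ (Fin.castLE (Nat.div_le_self n 2) j))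
    (ξ (Fin.rev (Fin.castLE (Nat.div_le_self n 2) j)))

theorem nestProd_add_two {n : ℕ} (ξ : Fin (n + 2) → I) :
    nestProd B ξ = B (ξ 0) (ξ (Fin.last _)) * nestProd B fun i : Fin n => ξ i.castSucc.succ := by
  have h : (n + 2) / 2 = n / 2 + 1 := by omega
  unfold nestProd
  rw [← Equiv.prod_comp (finCongr h).symm, Fin.prod_univ_succ]
  refine congrArg₂ _ (congrArg₂ _ (congrArg ξ ?_) (congrArg ξ ?_)) (Finset.prod_congr rfl fun j _ =>
    congrArg₂ _ (congrArg ξ ?_) (congrArg ξ ?_)) <;>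
  · ext
    simp [Fin.val_rev] <;> omega

theorem castLE_ne_rev {n : ℕ} (i j : Fin (n / 2)) : Fin.castLE (Nat.div_le_self n 2) i ≠
    Fin.rev (Fin.castLE (Nat.div_le_self n 2) j) := by
  intro h
  have := congrArg Fin.val h
  simp only [Fin.val_castLE, Fin.val_rev] at this
  omega

/-- Two whole pairs change places, so the factors of the product are merely reordered. -/
theorem nestProd_swap_pairs {n : ℕ} (ξ : Fin n → I) (p q : Fin (n / 2)) :
    nestProd B (ξ ∘ (Equiv.swap (Fin.castLE (Nat.div_le_self n 2) p)
      (Fin.castLE (Nat.div_le_self n 2) q) *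
      Equiv.swap (Fin.rev (Fin.castLE (Nat.div_le_self n 2) p))
      (Fin.rev (Fin.castLE (Nat.div_le_self n 2) q)) : Equiv.Perm (Fin n))) = nestProd B ξ := by
  have hinj := Fin.castLE_injective (Nat.div_le_self n 2)
  unfold nestProd
  conv_rhs => rw [← Equiv.prod_comp (Equiv.swap p q)]
  refine Finset.prod_congr rfl fun j _ => ?_
  simp only [Function.comp_apply, Equiv.Perm.mul_apply]
  rw [Equiv.swap_apply_of_ne_of_ne (castLE_ne_rev j p) (castLE_ne_rev j q), hinj.swap_apply,
    Fin.rev_injective.swap_apply, hinj.swap_apply,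
    Equiv.swap_apply_of_ne_of_ne (castLE_ne_rev p _).symm (castLE_ne_rev q _).symm]

theorem nestProd_flip (κ : Statistics) (hB : ∀ x y, B y x = κ.kappa * B x y) {n : ℕ} (ξ : Fin n → I)
    (p : Fin (n / 2)) :
    nestProd B (ξ ∘ (Equiv.swap (Fin.castLE (Nat.div_le_self n 2) p)
      (Fin.rev (Fin.castLE (Nat.div_le_self n 2) p)) : Equiv.Perm (Fin n))) =
      κ.kappa * nestProd B ξ := by
  have hinj := Fin.castLE_injective (Nat.div_le_self n 2)
  unfold nestProd
  rw [← Finset.prod_erase_mul _ _ (Finset.mem_univ p), ← Finset.prod_erase_mul _ _ (Finset.mem_univ p)]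
  simp only [Function.comp_apply, Equiv.swap_apply_left, Equiv.swap_apply_right]
  rw [hB, mul_left_comm]
  congr 2
  refine Finset.prod_congr rfl fun j hj => ?_
  have hj := Finset.ne_of_mem_erase hj
  rw [Equiv.swap_apply_of_ne_of_ne (hinj.ne hj) (castLE_ne_rev j p),
    Equiv.swap_apply_of_ne_of_ne (castLE_ne_rev p j).symm (Fin.rev_injective.ne (hinj.ne hj))]

/-- Any position can be moved to the first one by a permutation that preserves the nested pairs. -/
theorem exists_perm_nestProd (κ : Statistics) (hB : ∀ x y, B y x = κ.kappa * B x y) {n : ℕ}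
    (hn : Even n) (p : Fin (n + 2)) : ∃ π : Equiv.Perm (Fin (n + 2)), π 0 = p ∧
      ∀ ξ, κ.permSign π * nestProd B (ξ ∘ π) = nestProd B ξ := by
  let q₀ : Fin ((n + 2) / 2) := ⟨0, by omega⟩
  have h0 : (0 : Fin (n + 2)) = Fin.castLE (Nat.div_le_self (n + 2) 2) q₀ := rfl
  -- Carrying the outermost pair to the pair `q` is the identity or a product of two disjoint
  -- transpositions, hence has sign `1`. A position in the second half needs in addition a flip of
  -- the outermost pair; this changes both the sign and the product by `κ`.
  have key : ∀ q : Fin ((n + 2) / 2), ∃ π : Equiv.Perm (Fin (n + 2)),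
      π 0 = Fin.castLE (Nat.div_le_self (n + 2) 2) q ∧
      π (Fin.rev 0) = Fin.rev (Fin.castLE (Nat.div_le_self (n + 2) 2) q) ∧ κ.permSign π = 1 ∧
      ∀ ξ, nestProd B (ξ ∘ π) = nestProd B ξ := by
    intro q
    refine ⟨_, ?_, ?_, ?_, fun ξ => nestProd_swap_pairs B ξ q₀ q⟩
    · rw [Equiv.Perm.mul_apply, h0,
        Equiv.swap_apply_of_ne_of_ne (castLE_ne_rev _ _) (castLE_ne_rev _ _), Equiv.swap_apply_left]
    · rw [Equiv.Perm.mul_apply, h0, Equiv.swap_apply_left,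
        Equiv.swap_apply_of_ne_of_ne (castLE_ne_rev _ _).symm (castLE_ne_rev _ _).symm]
    · rw [κ.permSign_mul, κ.permSign_swap, κ.permSign_swap]
      simp only [Fin.rev_inj]
      split_ifs
      · simp
      · exact κ.kappa_mul_self
  by_cases hp : (p : ℕ) < (n + 2) / 2
  · obtain ⟨π, h1, -, h3, h4⟩ := key ⟨p, hp⟩
    exact ⟨π, h1, fun ξ => by rw [h3, one_mul, h4]⟩
  · obtain ⟨π, h1, h2, h3, h4⟩ := key ⟨n + 1 - p, by
      obtain ⟨k, rfl⟩ := hn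
      omega⟩
    refine ⟨π * Equiv.swap 0 (Fin.rev 0), ?_, fun ξ => ?_⟩
    · rw [Equiv.Perm.mul_apply, Equiv.swap_apply_left, h2]
      ext
      simp only [Fin.val_rev, Fin.val_castLE]
      omega
    · have h5 := nestProd_flip B κ hB (ξ ∘ π) q₀
      have h6 : (0 : Fin (n + 2)) ≠ Fin.rev 0 := castLE_ne_rev q₀ q₀
      rw [← h0, h4] at h5
      rw [Equiv.Perm.coe_mul, ← Function.comp_assoc, h5, κ.permSign_mul, h3, κ.permSign_swap,
        if_neg h6, one_mul, ← mul_assoc, κ.kappa_mul_self, one_mul]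

/-- The sum over permutations of nested products satisfies Wick's rule. -/
theorem sum_nestProd_add_two (κ : Statistics) (hB : ∀ x y, B y x = κ.kappa * B x y) {n : ℕ}
    (hn : Even n) (ξ : Fin (n + 2) → I) :
    ∑ σ, κ.permSign σ * nestProd B (ξ ∘ σ) = (n + 2) * ∑ j : Fin (n + 1), κ.kappa ^ (j : ℕ) *
      B (ξ 0) (ξ j.succ) * ∑ τ, κ.permSign τ *
        nestProd B ((fun i : Fin n => ξ (j.succAbove i).succ) ∘ τ) := by
  -- By the symmetries of the nested pairs, the position that `σ` gives to the argument `ξ 0` is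
  -- irrelevant. It may be taken to be the first position, at the price of the factor `n + 2`.
  have h1 : ∀ p : Fin (n + 2), ∑ σ with (σ.symm : Equiv.Perm (Fin (n + 2))) 0 = p,
      κ.permSign σ * nestProd B (ξ ∘ σ) = ∑ σ with σ 0 = 0, κ.permSign σ * nestProd B (ξ ∘ σ) := by
    intro p
    obtain ⟨π, hπ, hP⟩ := exists_perm_nestProd B κ hB hn p
    refine Finset.sum_equiv (Equiv.mulRight π) (fun σ => ?_) (fun σ _ => ?_)
    · simp only [Finset.mem_filter, Finset.mem_univ, true_and, Equiv.coe_mulRight,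
        Equiv.Perm.mul_apply, hπ]
      rw [Equiv.symm_apply_eq, eq_comm]
    · rw [Equiv.coe_mulRight, Equiv.Perm.coe_mul, ← Function.comp_assoc, κ.permSign_mul, mul_assoc, hP]
  rw [← Finset.sum_fiberwise Finset.univ (fun σ : Equiv.Perm (Fin (n + 2)) => σ.symm 0),
    Finset.sum_congr rfl fun p _ => h1 p, Finset.sum_const, Finset.card_univ, Fintype.card_fin,
    nsmul_eq_mul, sum_perm_fix_zero]
  congr 1
  · push_cast; ring
  -- The partner of the first position is the last one. The rotation moves it to the front of the
  -- remaining `n + 1` positions, so that the Laplace expansion runs over the partner of `ξ 0`. Its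
  -- sign `κ ^ n` is `1` because `n` is even.
  rw [← Equiv.sum_comp (Equiv.mulRight (finRotate (n + 1)))]
  have h2 : ∀ e : Equiv.Perm (Fin (n + 1)),
      κ.permSign (Equiv.Perm.decomposeFin.symm (0, Equiv.mulRight (finRotate (n + 1)) e)) *
        nestProd B (ξ ∘ (Equiv.Perm.decomposeFin.symm (0, Equiv.mulRight (finRotate (n + 1)) e))) =
      κ.permSign e * (B (ξ 0) (ξ (e 0).succ) * nestProd B fun i : Fin n => ξ (e i.succ).succ) := by
    intro e
    rw [κ.permSign_decomposeFin_symm_zero, Equiv.coe_mulRight, κ.permSign_mul, κ.permSign_finRotate,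
      Nat.add_sub_cancel, κ.kappa_pow_of_even hn, mul_one, nestProd_add_two]
    congr 2
    · simp only [Function.comp_apply, ← Fin.succ_last, Equiv.Perm.decomposeFin_symm_apply_zero,
        Equiv.Perm.decomposeFin_symm_apply_succ, Equiv.swap_self, Equiv.refl_apply,
        Equiv.Perm.mul_apply, finRotate_last]
    · congr 1
      funext i
      simp only [Function.comp_apply, Equiv.Perm.decomposeFin_symm_apply_succ, Equiv.swap_self,
        Equiv.refl_apply, Equiv.Perm.mul_apply]
      rw [finRotate_apply, Fin.coeSucc_eq_succ]
  rw [Finset.sum_congr rfl fun e _ => h2 e, sum_permSign_succ]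
  refine Finset.sum_congr rfl fun j _ => ?_
  rw [mul_assoc, Finset.mul_sum, Finset.mul_sum, Finset.mul_sum]
  refine Finset.sum_congr rfl fun τ _ => ?_
  simp only [Equiv.Perm.mul_apply, Equiv.Perm.decomposeFin_symm_apply_zero,
    Equiv.Perm.decomposeFin_symm_apply_succ, Equiv.swap_self, Equiv.refl_apply,
    Fin.cycleRange_symm_zero, Fin.cycleRange_symm_succ]
  rw [mul_left_comm (κ.permSign τ)]
  rfl

end PermSums

/-! ### Wick's rule for amplitudes -/

namespace KreinSpace

variable {V : KreinSpace.{u}} {κ : Statistics} {W : Submodule ℝ V}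

/-- On boundary values of solutions the Hermitian form is real for bosons and purely imaginary for
fermions. It is therefore symmetric or antisymmetric there, and so is its complex bilinear
extension. -/
theorem IsDynamical.form_comm (hW : IsDynamical κ W) {v w : V} (hv : v ∈ W) (hw : w ∈ W) :
    form w v = κ.kappa * form v w := by
  rw [← form_symm v w]
  cases κ with
  | boson =>
    rw [Statistics.kappa, one_mul, Complex.conj_eq_iff_im]
    exact (hW.2.2 v).1 hv w hw
  | fermion =>
    have h := (hW.1 v).1 hv w hw
    apply Complex.ext <;> simp [Statistics.kappa, h]

theorem IsDynamical.hatForm_comm (hW : IsDynamical κ W) (v w : V) :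
    hatForm W w v = κ.kappa * hatForm W v w := by
  obtain ⟨h1, h2, -⟩ := hW.split_spec v
  obtain ⟨k1, k2, -⟩ := hW.split_spec w
  unfold hatForm
  rw [hW.form_comm h1 k1, hW.form_comm h1 k2, hW.form_comm h2 k1, hW.form_comm h2 k2]
  ring

end KreinSpace

open KreinSpace

variable {V : KreinSpace.{u}} {κ : Statistics} {W : Submodule ℝ V}

theorem amplValue_zero (ξ : Fin 0 → V) : amplValue κ W ξ = 1 := by
  cases κ <;> simp [amplValue, Statistics.permSign]

theorem amplValue_of_not_even {n : ℕ} (hn : ¬ Even n) (ξ : Fin n → V) : amplValue κ W ξ = 0 :=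
  if_neg hn

/-- Wick's rule for amplitudes. -/
theorem amplValue_add_two (hW : IsDynamical κ W) {n : ℕ} (ξ : Fin (n + 2) → V) :
    amplValue κ W ξ = 2 * ∑ j : Fin (n + 1), κ.kappa ^ (j : ℕ) * hatForm W (ξ 0) (ξ j.succ) *
      amplValue κ W fun i => ξ (j.succAbove i).succ := by
  by_cases hn : Even n
  · have h2 : Even (n + 2) := hn.add even_two
    have e := sum_nestProd_add_two (hatForm W) κ hW.hatForm_comm hn ξ
    simp only [amplValue, if_pos hn, if_pos h2]
    unfold nestProd at e
    simp only [Function.comp_apply] at e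
    -- The normalizations combine to `(n + 2) / (n / 2 + 1)! = 2 / (n / 2)!`, which is the factor
    -- `2` in Wick's rule.
    rw [e, show (n + 2) / 2 = n / 2 + 1 by omega, Nat.factorial_succ, Finset.mul_sum, Finset.mul_sum,
      Finset.mul_sum]
    refine Finset.sum_congr rfl fun j _ => ?_
    have hk : ((n / 2 : ℕ) : ℂ) + 1 ≠ 0 := by exact_mod_cast (n / 2).succ_ne_zero
    have hk2 : (n : ℂ) = 2 * ((n / 2 : ℕ) : ℂ) := by
      exact_mod_cast (Nat.two_mul_div_two_of_even hn).symm
    rw [hk2]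
    generalize (∑ τ : Equiv.Perm (Fin n), _ : ℂ) = s
    push_cast
    rw [mul_inv]
    field_simp
  · have h2 : ¬ Even (n + 2) := by simpa [Nat.even_add] using hn
    simp [amplValue_of_not_even, hn, h2]

open KreinSpace

/-! ### Graded functions of lists and the insertion of pairs -/

section Graded

variable {I : Type*} (κ : Statistics)

/-- Interchanging two neighbouring arguments multiplies the value by `κ`. -/
def IsGraded (φ : List I → ℂ) : Prop :=
  ∀ A x y B, φ (A ++ x :: y :: B) = κ.kappa * φ (A ++ y :: x :: B)

variable {κ} {φ : List I → ℂ}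

theorem IsGraded.cons (h : IsGraded κ φ) (x : I) : IsGraded κ fun L => φ (x :: L) :=
  fun A => h (x :: A)

theorem IsGraded.move (h : IsGraded κ φ) (A : List I) (x : I) (B : List I) :
    φ (A ++ x :: B) = κ.kappa ^ A.length * φ (x :: (A ++ B)) := by
  induction A generalizing φ with
  | nil => simp
  | cons a A ih =>
    rw [List.cons_append, ih (h.cons a), List.length_cons, pow_succ, mul_assoc]
    exact congrArg _ (h [] a x (A ++ B))

/-- Passing two arguments costs `κ² = 1`. Hence inserted pairs may be moved past any argument
without a sign. -/
theorem IsGraded.rotate (h : IsGraded κ φ) (x y z : I) (L : List I) :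
    φ (x :: y :: z :: L) = φ (z :: x :: y :: L) := by
  have h1 := h [x] y z L
  have h2 := h [] x z (y :: L)
  simp only [List.nil_append, List.cons_append] at h1 h2
  rw [h1, h2, ← mul_assoc, κ.kappa_mul_self, one_mul]

/-- Two equal arguments can be made neighbours up to sign, and interchanging them changes the sign
of the value. -/
theorem IsGraded.eq_zero_of_not_nodup {φ : List I → ℂ} (h : IsGraded .fermion φ) {L : List I}
    (hL : ¬ L.Nodup) : φ L = 0 := by
  induction L generalizing φ with
  | nil => simp at hL
  | cons x L ih =>
    by_cases hx : x ∈ L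
    · obtain ⟨A, B, rfl⟩ := List.append_of_mem hx
      have h1 := (h.cons x).move A x B
      have h2 := h [] x x (A ++ B)
      simp only [List.nil_append, Statistics.kappa, neg_mul, one_mul] at h2
      have h3 : φ (x :: x :: (A ++ B)) = 0 := by
        linear_combination (1 / 2 : ℂ) * h2
      rw [h1, h3, mul_zero]
    · exact ih (h.cons x) fun hn => hL (List.nodup_cons.2 ⟨hx, hn⟩)

variable (κ)

/-- The signed sum over the entries of a list, with weight `g`, of the values at the list without
the entry. -/
def contract (g : I → ℂ) : (List I → ℂ) → List I → ℂ
  | _, [] => 0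
  | φ, x :: L => g x * φ L + κ.kappa * contract g (fun L' => φ (x :: L')) L

theorem contract_eq_sum (g : I → ℂ) (φ : List I → ℂ) (L : List I) :
    contract κ g φ L = ∑ j : Fin L.length, κ.kappa ^ (j : ℕ) * g (L.get j) * φ (L.eraseIdx j) := by
  induction L generalizing φ with
  | nil => simp [contract]
  | cons x L ih =>
    change _ = ∑ j : Fin (L.length + 1), _
    rw [contract, ih, Fin.sum_univ_succ, Finset.mul_sum]
    simp [pow_succ', mul_assoc]

theorem contract_smul (g : I → ℂ) (z : ℂ) (φ : List I → ℂ) (L : List I) :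
    contract κ g (fun L => z * φ L) L = z * contract κ g φ L := by
  simp only [contract_eq_sum, Finset.mul_sum]
  exact Finset.sum_congr rfl fun j _ => by ring

theorem contract_sum {ι : Type*} (s : Finset ι) (g : I → ℂ) (φ : ι → List I → ℂ) (L : List I) :
    contract κ g (fun L => ∑ a ∈ s, φ a L) L = ∑ a ∈ s, contract κ g (φ a) L := by
  simp only [contract_eq_sum, Finset.mul_sum]
  exact Finset.sum_comm

theorem length_eraseIdx_lt (L : List I) (j : Fin L.length) : (L.eraseIdx j).length < L.length := by
  rw [List.length_eraseIdx_of_lt j.2]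
  have := j.2
  omega

theorem hasSum_contract {β : Type*} {g : I → ℂ} {φ : β → List I → ℂ} {ψ : List I → ℂ}
    {L : List I} (h : ∀ L', L'.length < L.length → L' ⊆ L → HasSum (fun m => φ m L') (ψ L')) :
    HasSum (fun m => contract κ g (φ m) L) (contract κ g ψ L) := by
  simp only [contract_eq_sum]
  exact hasSum_sum fun j _ => (h _ (length_eraseIdx_lt L j)
    (List.eraseIdx_subset ..)).mul_left _

variable {d : ℕ} (s : Fin d → ℂ) (x y : Fin d → I)

/-- Insertion of the weighted sum of the pairs `(x a, y a)` in front of the arguments. -/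
def pairSum (φ : List I → ℂ) : List I → ℂ := fun L => ∑ a, s a * φ (x a :: y a :: L)

theorem IsGraded.pairSum (h : IsGraded κ φ) : IsGraded κ (pairSum s x y φ) := by
  intro A u v B
  rw [GBF.pairSum, GBF.pairSum, Finset.mul_sum]
  refine Finset.sum_congr rfl fun a _ => ?_
  rw [mul_left_comm]
  exact congrArg _ (h (x a :: y a :: A) u v B)

theorem IsGraded.pairSum_iterate (h : IsGraded κ φ) (m : ℕ) : IsGraded κ ((GBF.pairSum s x y)^[m] φ) := by
  induction m with
  | zero => exact h
  | succ m ih => rw [Function.iterate_succ_apply']; exact ih.pairSum κ s x y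

/-- Under Wick's rule the argument `v` is contracted with `L` or with a member of one of the `m`
inserted pairs. All pairs contribute equally, whence the factor `m`; the other member of the chosen
pair stays as an argument, beside `m - 1` intact pairs. -/
theorem pairSum_iterate_cons {B : I → I → ℂ} (h : IsGraded κ φ)
    (hw : ∀ v L, φ (v :: L) = 2 * contract κ (B v) φ L) (m : ℕ) (v : I) (L : List I) :
    (pairSum s x y)^[m] φ (v :: L) = 2 * contract κ (B v) ((pairSum s x y)^[m] φ) L +
      2 * m * ∑ a, s a * (B v (x a) * (pairSum s x y)^[m - 1] φ (y a :: L) +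
        κ.kappa * (B v (y a) * (pairSum s x y)^[m - 1] φ (x a :: L))) := by
  induction m generalizing v L with
  | zero => simp [hw]
  | succ m ih =>
    have hg := h.pairSum_iterate κ s x y m
    have hg' := h.pairSum_iterate κ s x y (m - 1)
    rw [Function.iterate_succ_apply']
    have hc : contract κ (B v) (pairSum s x y ((pairSum s x y)^[m] φ)) L =
        ∑ a, s a * contract κ (B v) (fun L' => (pairSum s x y)^[m] φ (x a :: y a :: L')) L := by
      simp only [← contract_smul, ← contract_sum]
      rfl
    -- A pair standing behind `u` is moved to the front and counted as one more insertion. The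
    -- prefactor `m` covers the case `m = 0`, where `m - 1` is truncated.
    have hm : ∀ u, (m : ℂ) * ∑ a, s a * (pairSum s x y)^[m - 1] φ (u :: x a :: y a :: L) =
        m * (pairSum s x y)^[m] φ (u :: L) := by
      intro u
      rcases m with - | m
      · simp
      · rw [Function.iterate_succ_apply', Nat.add_sub_cancel]
        congr 1
        exact Finset.sum_congr rfl fun a _ => by
          rw [Nat.add_sub_cancel] at hg'
          rw [hg'.rotate u]; exact congrArg _ (hg'.rotate _ _ _ _)
    -- The newest pair now belongs to the remaining arguments of the induction hypothesis. Its two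
    -- members give the first two terms of the contraction, and passing both gives `κ² = 1`.
    have h1 : ∀ a, (pairSum s x y)^[m] φ (x a :: y a :: v :: L) =
        2 * (B v (x a) * (pairSum s x y)^[m] φ (y a :: L) +
          κ.kappa * (B v (y a) * (pairSum s x y)^[m] φ (x a :: L)) +
          contract κ (B v) (fun L' => (pairSum s x y)^[m] φ (x a :: y a :: L')) L) +
        2 * m * ∑ b, s b * (B v (x b) * (pairSum s x y)^[m - 1] φ (y b :: x a :: y a :: L) +
          κ.kappa * (B v (y b) * (pairSum s x y)^[m - 1] φ (x b :: x a :: y a :: L))) := by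
      intro a
      rw [hg.rotate, ih]
      congr 2
      simp only [contract]
      rw [mul_add, ← mul_assoc κ.kappa κ.kappa, κ.kappa_mul_self]
      ring
    have h2 : ∑ a, s a * (2 * m * ∑ b, s b * (B v (x b) *
          (pairSum s x y)^[m - 1] φ (y b :: x a :: y a :: L) +
          κ.kappa * (B v (y b) * (pairSum s x y)^[m - 1] φ (x b :: x a :: y a :: L)))) =
        2 * m * ∑ b, s b * (B v (x b) * (pairSum s x y)^[m] φ (y b :: L) +
          κ.kappa * (B v (y b) * (pairSum s x y)^[m] φ (x b :: L))) := by
      calc _ = 2 * ∑ b, s b * (B v (x b) *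
            (m * ∑ a, s a * (pairSum s x y)^[m - 1] φ (y b :: x a :: y a :: L)) +
          κ.kappa * (B v (y b) *
            (m * ∑ a, s a * (pairSum s x y)^[m - 1] φ (x b :: x a :: y a :: L)))) := by
            simp only [Finset.mul_sum, ← Finset.sum_add_distrib]
            rw [Finset.sum_comm]
            exact Finset.sum_congr rfl fun b _ => Finset.sum_congr rfl fun a _ => by ring
        _ = _ := by
            simp only [hm, Finset.mul_sum]
            exact Finset.sum_congr rfl fun b _ => by ring
    rw [hc, GBF.pairSum, Finset.sum_congr rfl fun a _ => by rw [h1 a, mul_add],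
      Finset.sum_add_distrib, h2, Nat.add_sub_cancel]
    simp only [Finset.mul_sum, ← Finset.sum_add_distrib]
    refine Finset.sum_congr rfl fun a _ => ?_
    push_cast
    ring

/-- The arguments are brought into the order in which they occur in `τ(ψ ⊗ ξ ⊗ ι(ξ))`, where `ι`
reverses them. For each pair, `x b` passes `L` and `y b` passes `L` and `2 m` further arguments, so
the number of interchanges is even. -/
theorem pairSum_iterate_eq_sum (h : IsGraded κ φ) (m : ℕ) (L : List I) :
    (pairSum s x y)^[m] φ L = ∑ a : Fin m → Fin d, (∏ i, s (a i)) *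
      φ (L ++ (List.ofFn (x ∘ a) ++ (List.ofFn (y ∘ a)).reverse)) := by
  induction m generalizing L with
  | zero => simp
  | succ m ih =>
    rw [Function.iterate_succ_apply', ← (Fin.consEquiv fun _ => Fin d).sum_comp,
      Fintype.sum_prod_type, pairSum]
    refine Finset.sum_congr rfl fun b _ => ?_
    rw [ih, Finset.mul_sum]
    refine Finset.sum_congr rfl fun a _ => ?_
    have e0 : (Fin.consEquiv fun _ => Fin d) (b, a) = (Fin.cons b a : Fin (m + 1) → Fin d) := rfl
    simp only [e0, Fin.prod_univ_succ, Fin.cons_zero, Fin.cons_succ, mul_assoc]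
    congr 2
    have e1 : ∀ z : Fin d → I, List.ofFn (z ∘ (Fin.cons b a : Fin (m + 1) → Fin d)) =
        z b :: List.ofFn (z ∘ a) := by
      intro z
      rw [List.ofFn_succ]
      simp [Function.comp_def]
    rw [e1, e1, List.reverse_cons, List.cons_append (as := List.ofFn (x ∘ a)), h.move L (x b),
      show L ++ (List.ofFn (x ∘ a) ++ ((List.ofFn (y ∘ a)).reverse ++ [y b])) =
        (L ++ (List.ofFn (x ∘ a) ++ (List.ofFn (y ∘ a)).reverse)) ++ y b :: [] by simp,
      (h.cons (x b)).move, List.append_nil, ← mul_assoc, ← pow_add, κ.kappa_pow_of_even, one_mul]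
    · rfl
    · simp only [List.length_append, List.length_reverse, List.length_ofFn]
      exact ⟨L.length + m, by ring⟩

/-- The summands of degree `m` of the exponential of half of `pairSum`. -/
noncomputable def expTerm (φ : List I → ℂ) (m : ℕ) (L : List I) : ℂ :=
  (2 ^ m * (m.factorial : ℂ))⁻¹ * (pairSum s x y)^[m] φ L

theorem expTerm_zero (φ : List I → ℂ) (L : List I) : expTerm s x y φ 0 L = φ L := by
  simp [expTerm]

theorem IsGraded.expTerm (h : IsGraded κ φ) (m : ℕ) : IsGraded κ (GBF.expTerm s x y φ m) := by
  intro A u v B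
  rw [GBF.expTerm, h.pairSum_iterate κ s x y m, mul_left_comm]
  rfl

/-- With `P` the insertion operator, this is the differential equation of `exp (t P / 2)` in `t`,
read off coefficientwise. -/
theorem expTerm_succ (φ : List I → ℂ) (m : ℕ) (L : List I) :
    ((m : ℂ) + 1) * expTerm s x y φ (m + 1) L =
      2⁻¹ * ∑ a, s a * expTerm s x y φ m (x a :: y a :: L) := by
  have hm : (m : ℂ) + 1 ≠ 0 := by exact_mod_cast m.succ_ne_zero
  have h2 : ∑ a, s a * expTerm s x y φ m (x a :: y a :: L) = (2 ^ m * (m.factorial : ℂ))⁻¹ *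
      ∑ a, s a * (pairSum s x y)^[m] φ (x a :: y a :: L) := by
    rw [Finset.mul_sum]
    exact Finset.sum_congr rfl fun a _ => by rw [expTerm]; ring
  rw [h2, expTerm, Function.iterate_succ_apply', pairSum, Nat.factorial_succ]
  push_cast
  rw [pow_succ]
  field_simp

theorem expTerm_zero_cons {B : I → I → ℂ} (hw : ∀ v L, φ (v :: L) = 2 * contract κ (B v) φ L)
    (v : I) (L : List I) :
    expTerm s x y φ 0 (v :: L) = 2 * contract κ (B v) (expTerm s x y φ 0) L := by
  have : expTerm s x y φ 0 = φ := funext fun L => expTerm_zero s x y φ L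
  rw [this, hw]

/-- The coefficient `2 (m + 1) / (2^(m + 1) (m + 1)!)` is `1 / (2^m m!)`. Contraction with an
inserted pair thus lowers the degree by one and leaves coefficient `1`, which makes the cancellation
in the gluing sum possible. -/
theorem expTerm_succ_cons {B : I → I → ℂ} (h : IsGraded κ φ)
    (hw : ∀ v L, φ (v :: L) = 2 * contract κ (B v) φ L) (m : ℕ) (v : I) (L : List I) :
    expTerm s x y φ (m + 1) (v :: L) = 2 * contract κ (B v) (expTerm s x y φ (m + 1)) L +
      ∑ a, s a * (B v (x a) * expTerm s x y φ m (y a :: L) +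
        κ.kappa * (B v (y a) * expTerm s x y φ m (x a :: L))) := by
  have hm : (m : ℂ) + 1 ≠ 0 := by exact_mod_cast m.succ_ne_zero
  have hc : contract κ (B v) (expTerm s x y φ (m + 1)) L = (2 ^ (m + 1) * ((m + 1).factorial : ℂ))⁻¹ *
      contract κ (B v) ((pairSum s x y)^[m + 1] φ) L := contract_smul κ _ _ _ _
  have hs : ∑ a, s a * (B v (x a) * expTerm s x y φ m (y a :: L) +
        κ.kappa * (B v (y a) * expTerm s x y φ m (x a :: L))) = (2 ^ m * (m.factorial : ℂ))⁻¹ *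
      ∑ a, s a * (B v (x a) * (pairSum s x y)^[m] φ (y a :: L) +
        κ.kappa * (B v (y a) * (pairSum s x y)^[m] φ (x a :: L))) := by
    rw [Finset.mul_sum]
    exact Finset.sum_congr rfl fun a _ => by simp only [expTerm]; ring
  rw [hc, hs, expTerm, pairSum_iterate_cons κ s x y h hw, Nat.add_sub_cancel, Nat.factorial_succ]
  generalize contract κ (B v) ((pairSum s x y)^[m + 1] φ) L = c
  push_cast
  rw [pow_succ]
  field_simp

/-- More than `d` indices from a set of `d` contain a repetition, so some argument occurs twice. -/
theorem expTerm_eq_zero_of_lt {φ : List I → ℂ} (h : IsGraded .fermion φ) {m : ℕ} (hm : d < m)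
    (L : List I) : expTerm s x y φ m L = 0 := by
  rw [expTerm, pairSum_iterate_eq_sum .fermion s x y h, Finset.sum_eq_zero, mul_zero]
  intro a _
  rw [h.eq_zero_of_not_nodup, mul_zero]
  intro hn
  have h1 := hn.of_append_right.of_append_left
  rw [List.nodup_ofFn] at h1
  have h2 := Fintype.card_le_of_injective a h1.of_comp
  simp at h2
  omega

end Graded

/-! ### The amplitude as a graded function of lists -/

section AmplList

variable {V : KreinSpace.{u}} (κ : Statistics) (W : Submodule ℝ V)

/-- The amplitude of the generating state of a list of vectors. -/
noncomputable def amplList (L : List V) : ℂ := amplValue κ W L.get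

theorem amplList_ofFn {n : ℕ} (ξ : Fin n → V) : amplList κ W (List.ofFn ξ) = amplValue κ W ξ := by
  have h : ∀ p q : Σ n : ℕ, Fin n → V, p = q → amplValue κ W p.2 = amplValue κ W q.2 := by
    rintro p q rfl; rfl
  exact h ⟨_, (List.ofFn ξ).get⟩ ⟨n, ξ⟩ (List.equivSigmaTuple.apply_symm_apply ⟨n, ξ⟩)

theorem amplList_nil : amplList κ W [] = 1 := amplValue_zero _

theorem isGraded_amplList : IsGraded κ (amplList κ W) := by
  intro A x y B
  let i : Fin (A ++ y :: x :: B).length := ⟨A.length, by simp⟩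
  let j : Fin (A ++ y :: x :: B).length := ⟨A.length + 1, by simp⟩
  have hij : i ≠ j := fun h => by simpa [i, j] using congrArg Fin.val h
  have h : A ++ x :: y :: B = List.ofFn ((A ++ y :: x :: B).get ∘ Equiv.swap i j) := by
    refine List.ext_getElem (by simp; ring) fun k h1 h2 => ?_
    rw [List.getElem_ofFn, Function.comp_apply, Equiv.swap_apply_def]
    split_ifs with hi hj
    · have : k = A.length := congrArg Fin.val hi
      subst this
      simp [j, List.getElem_append_right]
    · have : k = A.length + 1 := congrArg Fin.val hj
      subst this
      simp [i, List.getElem_append_right]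
    · have hi' : k ≠ A.length := fun h => hi (Fin.ext h)
      have hj' : k ≠ A.length + 1 := fun h => hj (Fin.ext h)
      by_cases hk : k < A.length
      · simp [List.getElem_append_left, hk]
      · obtain ⟨l, rfl⟩ : ∃ l, k = A.length + (l + 2) := ⟨k - A.length - 2, by omega⟩
        simp [List.getElem_append_right]
  rw [h, amplList_ofFn, amplValue_perm, κ.permSign_swap, if_neg hij]
  rfl

variable {κ W}

/-- Recasting Wick's rule as a recursion on lists makes induction on the arguments possible. For a
single argument both sides vanish, by oddness on the left and as an empty sum on the right. -/
theorem amplList_cons (hW : IsDynamical κ W) (v : V) (L : List V) :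
    amplList κ W (v :: L) = 2 * contract κ (hatForm W v) (amplList κ W) L := by
  rw [contract_eq_sum]
  obtain ⟨n, ξ, rfl⟩ : ∃ n, ∃ ξ : Fin n → V, L = List.ofFn ξ := ⟨_, _, (List.ofFn_get L).symm⟩
  have h0 : v :: List.ofFn ξ = List.ofFn (Fin.cons v ξ : Fin (n + 1) → V) := by
    rw [List.ofFn_succ]; simp
  rw [h0, amplList_ofFn]
  cases n with
  | zero =>
    rw [amplValue_of_not_even (by simp)]
    exact (mul_eq_zero_of_right _ (Finset.sum_empty)).symm
  | succ n =>
    rw [amplValue_add_two hW, ← (finCongr (List.length_ofFn (f := ξ))).symm.sum_comp]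
    congr 1
    refine Finset.sum_congr rfl fun j _ => ?_
    have h1 : (List.ofFn ξ).eraseIdx (j : ℕ) = List.ofFn fun i => ξ (j.succAbove i) := by
      refine List.ext_getElem (by
        rw [List.length_eraseIdx_of_lt (by simp; omega)]
        simp) fun k h1 h2 => ?_
      simp only [List.getElem_eraseIdx, List.getElem_ofFn]
      split_ifs with hk
      · congr 1
        rw [Fin.succAbove_of_castSucc_lt _ _ hk]
        rfl
      · congr 1
        rw [Fin.succAbove_of_le_castSucc _ _ (not_lt.1 hk)]
        rfl
    simp only [Fin.cons_zero, Fin.cons_succ, finCongr_symm, finCongr_apply, Fin.val_cast]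
    rw [h1, amplList_ofFn, List.get_ofFn]
    rfl

theorem amplList_add (hW : IsDynamical κ W) (v w : V) (L : List V) :
    amplList κ W ((v + w) :: L) = amplList κ W (v :: L) + amplList κ W (w :: L) := by
  simp only [amplList_cons hW, contract_eq_sum, hW.hatForm_add_left, ← mul_add,
    ← Finset.sum_add_distrib]
  congr 1
  exact Finset.sum_congr rfl fun j _ => by ring

theorem amplList_smul (hW : IsDynamical κ W) (z : ℂ) (v : V) (L : List V) :
    amplList κ W ((z • v) :: L) = conj z * amplList κ W (v :: L) := by
  simp only [amplList_cons hW, contract_eq_sum, hW.hatForm_smul_left, Finset.mul_sum]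
  exact Finset.sum_congr rfl fun j _ => by ring

end AmplList

open KreinSpace

/-! ### Convergence with further arguments -/

section Summability

variable {I : Type*} {d : ℕ} {s : Fin d → ℂ} {x y : Fin d → I} {B : I → I → ℂ} {φ : List I → ℂ}

/-- The matrix by which an argument is passed on from one inserted pair to the next. -/
def transferMatrix (s : Fin d → ℂ) (x y : Fin d → I) (B : I → I → ℂ) :
    Matrix (Fin d ⊕ Fin d) (Fin d ⊕ Fin d) ℂ :=
  Matrix.of fun q p => B (Sum.elim y x q) (Sum.elim x y p) * Sum.elim s s p

theorem expTerm_succ_cons_boson (h : IsGraded .boson φ)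
    (hw : ∀ v L, φ (v :: L) = 2 * contract .boson (B v) φ L) (m : ℕ) (v : I) (L : List I) :
    expTerm s x y φ (m + 1) (v :: L) = 2 * contract .boson (B v) (expTerm s x y φ (m + 1)) L +
      ∑ p, B v (Sum.elim x y p) * Sum.elim s s p *
        expTerm s x y φ m (Sum.elim y x p :: L) := by
  rw [expTerm_succ_cons .boson s x y h hw, Fintype.sum_sum_type, ← Finset.sum_add_distrib]
  congr 1
  refine Finset.sum_congr rfl fun a _ => ?_
  simp only [Sum.elim_inl, Sum.elim_inr, Statistics.kappa]
  ring

/-- A contraction with a member of an inserted pair hands the role of first argument to the other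
member. After `k` such steps, which contribute an entry of the `k`-th power of the transfer matrix,
the current argument is contracted with `L`. -/
theorem expTerm_cons_eq_sum (h : IsGraded .boson φ)
    (hw : ∀ v L, φ (v :: L) = 2 * contract .boson (B v) φ L) (m : ℕ) (q : Fin d ⊕ Fin d)
    (L : List I) :
    expTerm s x y φ m (Sum.elim y x q :: L) = ∑ p, ∑ k ∈ Finset.HasAntidiagonal.antidiagonal m,
      (transferMatrix s x y B ^ k.1) q p *
        (2 * contract .boson (B (Sum.elim y x p)) (expTerm s x y φ k.2) L) := by
  induction m generalizing q with
  | zero =>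
    rw [expTerm_zero_cons .boson s x y hw]
    simp [Matrix.one_apply]
  | succ m ih =>
    rw [expTerm_succ_cons_boson h hw]
    simp only [Finset.Nat.sum_antidiagonal_succ, Finset.sum_add_distrib, pow_zero, Matrix.one_apply,
      ite_mul, one_mul, zero_mul, Finset.sum_ite_eq, Finset.mem_univ, if_true]
    congr 1
    simp only [ih, pow_succ', Matrix.mul_apply, Finset.mul_sum, Finset.sum_mul]
    rw [Finset.sum_comm]
    refine Finset.sum_congr rfl fun p _ => ?_
    rw [Finset.sum_comm]
    refine Finset.sum_congr rfl fun k _ => Finset.sum_congr rfl fun r _ => ?_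
    rw [transferMatrix, Matrix.of_apply]
    ring

/-- Without further arguments, the chain of contractions that leaves one end of a pair can only
close at its other end, and so gives a trace. This recursion is the logarithmic derivative of `det
(1 - t N)^(-1/2)`, for the transfer matrix `N`. -/
theorem expTerm_nil_succ (h : IsGraded .boson φ)
    (hw : ∀ v L, φ (v :: L) = 2 * contract .boson (B v) φ L) (m : ℕ) :
    ((m : ℂ) + 1) * expTerm s x y φ (m + 1) [] =
      2⁻¹ * ∑ k ∈ Finset.HasAntidiagonal.antidiagonal m,
        (transferMatrix s x y B ^ (k.1 + 1)).trace * expTerm s x y φ k.2 [] := by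
  rw [expTerm_succ]
  congr 1
  -- Symmetrizing over the two orders of the pair matches the index set `Fin d ⊕ Fin d`. The
  -- resulting `2⁻¹` cancels the `2` of Wick's rule.
  have h1 : ∑ a, s a * expTerm s x y φ m [x a, y a] = 2⁻¹ * ∑ q : Fin d ⊕ Fin d,
      Sum.elim s s q * expTerm s x y φ m [Sum.elim y x q, Sum.elim x y q] := by
    rw [Fintype.sum_sum_type, ← Finset.sum_add_distrib, Finset.mul_sum]
    refine Finset.sum_congr rfl fun a _ => ?_
    have h2 := (h.expTerm .boson s x y m) [] (y a) (x a) []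
    simp only [List.nil_append, Statistics.kappa, one_mul] at h2
    simp only [Sum.elim_inl, Sum.elim_inr, h2]
    ring
  rw [h1]
  simp only [expTerm_cons_eq_sum h hw, contract, Statistics.kappa, Matrix.trace, Matrix.diag_apply,
    pow_succ, Matrix.mul_apply, Finset.mul_sum, Finset.sum_mul]
  rw [Finset.sum_congr rfl fun q _ => Finset.sum_comm, Finset.sum_comm]
  refine Finset.sum_congr rfl fun k _ => Finset.sum_congr rfl fun q _ =>
    Finset.sum_congr rfl fun p _ => ?_
  rw [transferMatrix, Matrix.of_apply]
  ring

/-- The hypothesis at `[]` makes the entries of the powers of the transfer matrix absolutely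
summable. By `expTerm_cons_eq_sum` a further argument then leads to Cauchy products of these with
sums for shorter lists, and induction on the length applies. -/
theorem summable_expTerm_boson (h : IsGraded .boson φ) (h0 : φ [] = 1)
    (hw : ∀ v L, φ (v :: L) = 2 * contract .boson (B v) φ L)
    (hs : Summable fun m => expTerm s x y φ m []) (L : List I) :
    Summable fun m => expTerm s x y φ m L := by
  have hM := summable_norm_pow_apply (transferMatrix s x y B) (fun m => expTerm s x y φ m [])
    (by rw [expTerm_zero, h0]) (expTerm_nil_succ h hw) hs.norm
  induction hn : L.length using Nat.strong_induction_on generalizing L with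
  | _ n ih =>
  subst hn
  rcases L with - | ⟨v, L⟩
  · exact hs
  have hc : ∀ u, Summable fun m => 2 * contract .boson (B u) (expTerm s x y φ m) L := fun u =>
    ((hasSum_contract (ψ := fun L' => ∑' m, expTerm s x y φ m L') .boson fun L' hL' _ =>
      (ih _ (by rw [List.length_cons]; omega) L' rfl).hasSum).mul_left 2).summable
  have he : ∀ q, Summable fun m => expTerm s x y φ m (Sum.elim y x q :: L) := by
    intro q
    simp only [expTerm_cons_eq_sum h hw]
    exact summable_sum fun p _ => (summable_norm_sum_mul_antidiagonal_of_summable_norm (hM q p)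
      (hc (Sum.elim y x p)).norm).of_norm
  rw [← summable_nat_add_iff 1]
  simp only [expTerm_succ_cons_boson h hw]
  exact ((summable_nat_add_iff 1).2 (hc v)).add (summable_sum fun p _ => (he p).mul_left _)

/-- If the exponential of the inserted pairs converges in degree zero, it converges for any number of
further arguments. -/
theorem summable_expTerm {κ : Statistics} (h : IsGraded κ φ) (h0 : φ [] = 1)
    (hw : ∀ v L, φ (v :: L) = 2 * contract κ (B v) φ L)
    (hs : Summable fun m => expTerm s x y φ m []) (L : List I) :
    Summable fun m => expTerm s x y φ m L := by
  cases κ with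
  | boson => exact summable_expTerm_boson h h0 hw hs L
  | fermion =>
    refine summable_of_ne_finset_zero (s := Finset.range (d + 1)) fun m hm => ?_
    exact expTerm_eq_zero_of_lt s x y h (by simpa using hm) L

end Summability

/-! ### Conjugate linearity and orthonormal bases -/

section ConjLinear

variable {κ : Statistics} {V : KreinSpace.{u}}

/-- A graded function on lists of vectors that is conjugate linear in each argument. -/
structure IsConjForm (κ : Statistics) (φ : List V → ℂ) : Prop where
  graded : IsGraded κ φ
  add : ∀ v w L, φ ((v + w) :: L) = φ (v :: L) + φ (w :: L)
  smul : ∀ (z : ℂ) v L, φ ((z • v) :: L) = conj z * φ (v :: L)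

theorem isConjForm_amplList {W : Submodule ℝ V} (hW : IsDynamical κ W) :
    IsConjForm κ (amplList κ W) :=
  ⟨isGraded_amplList κ W, amplList_add hW, amplList_smul hW⟩

variable {φ : List V → ℂ}

theorem IsConjForm.sum (h : IsConjForm κ φ) {ι : Type*} (t : Finset ι) (c : ι → ℂ) (v : ι → V)
    (L : List V) : φ ((∑ b ∈ t, c b • v b) :: L) = ∑ b ∈ t, conj (c b) * φ (v b :: L) := by
  let f : V →ₗ⋆[ℂ] ℂ :=
    { toFun := fun v => φ (v :: L), map_add' := fun v w => h.add v w L,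
      map_smul' := fun z v => h.smul z v L }
  change f _ = _
  rw [map_sum]
  exact Finset.sum_congr rfl fun b _ => h.smul _ _ _

theorem IsConjForm.pairSum (h : IsConjForm κ φ) {d : ℕ} (s : Fin d → ℂ) (x y : Fin d → V) :
    IsConjForm κ (pairSum s x y φ) := by
  have hr : ∀ v L, GBF.pairSum s x y φ (v :: L) = ∑ a, s a * φ (v :: x a :: y a :: L) :=
    fun v L => Finset.sum_congr rfl fun a _ => by rw [h.graded.rotate]
  refine ⟨h.graded.pairSum κ s x y, fun v w L => ?_, fun z v L => ?_⟩
  · simp only [hr, h.add, mul_add, Finset.sum_add_distrib]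
  · simp only [hr, h.smul, Finset.mul_sum]
    exact Finset.sum_congr rfl fun a _ => by ring

theorem IsConjForm.pairSum_iterate (h : IsConjForm κ φ) {d : ℕ} (s : Fin d → ℂ) (x y : Fin d → V)
    (m : ℕ) : IsConjForm κ ((GBF.pairSum s x y)^[m] φ) := by
  induction m with
  | zero => exact h
  | succ m ih => rw [Function.iterate_succ_apply']; exact ih.pairSum s x y

theorem IsConjForm.expTerm (h : IsConjForm κ φ) {d : ℕ} (s : Fin d → ℂ) (x y : Fin d → V) (m : ℕ) :
    IsConjForm κ (GBF.expTerm s x y φ m) := by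
  have h1 := h.pairSum_iterate s x y m
  refine ⟨h.graded.expTerm κ s x y m, fun v w L => ?_, fun z v L => ?_⟩
  · simp only [GBF.expTerm, h1.add, mul_add]
  · simp only [GBF.expTerm, h1.smul]
    ring

end ConjLinear

open KreinSpace

section Basis

variable {V : KreinSpace.{u}} {F : Submodule ℂ V} {d : ℕ} {ξ : Fin d → V}

/-- The sign `(-1) ^ [v]`. -/
noncomputable def sgn (v : V) : ℂ := (-1) ^ sig v

theorem sgn_mul_self (v : V) : sgn v * sgn v = 1 := by
  rw [sgn, ← mul_pow]; norm_num

theorem conj_sgn (v : V) : conj (sgn v) = sgn v := by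
  simp [sgn]

theorem sym_eq_sgn_smul {v : V} (h : v ∈ V.pos ∨ v ∈ V.neg) : V.sym v = sgn v • v := by
  unfold sgn sig
  split_ifs with hp
  · rw [pow_zero, one_smul]
    exact hp
  · rw [pow_one, neg_one_smul]
    exact h.resolve_left hp

theorem IsKreinBasis.eq_sum (h : IsKreinBasis F ξ) {v : V} (hv : v ∈ F) :
    v = ∑ a, (sgn (ξ a) * form (ξ a) v) • ξ a := by
  have hf : ∀ a, sgn (ξ a) * form (ξ a) v = inner ℂ (ξ a) v := by
    intro a
    rw [form, ← sym_inner, sym_eq_sgn_smul (h.homogeneous a), inner_smul_left, conj_sgn, ← mul_assoc,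
      sgn_mul_self, one_mul]
  simp only [hf]
  rw [← h.span_eq, Submodule.mem_span_range_iff_exists_fun] at hv
  obtain ⟨c, rfl⟩ := hv
  exact Finset.sum_congr rfl fun a _ => by rw [h.orthonormal.inner_right_fintype]

theorem IsKreinBasis.mem (h : IsKreinBasis F ξ) (a : Fin d) : ξ a ∈ F := by
  rw [← h.span_eq]
  exact Submodule.subset_span ⟨a, rfl⟩

end Basis

/-! ### The gluing identity over a finite-dimensional subspace -/

section Gluing

variable {κ : Statistics} {V V₁ U : KreinSpace.{u}} {W : Submodule ℝ V} {W₁ : Submodule ℝ V₁}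
  {j₀ : V₁ →ₗ[ℂ] V} {j₁ : U →ₗ[ℂ] V} {j₂ : U →ₗ⋆[ℂ] V}

/-- Solutions with boundary values in `W₁` come from solutions with boundary values in `W`, which agree on
the two components `U` and its reverse of the boundary. -/
structure IsGluedFrom (κ : Statistics) (W : Submodule ℝ V) (W₁ : Submodule ℝ V₁)
    (j₀ : V₁ →ₗ[ℂ] V) (j₁ : U →ₗ[ℂ] V) (j₂ : U →ₗ⋆[ℂ] V) : Prop where
  form₀₀ : ∀ v w, form (j₀ v) (j₀ w) = form v w
  form₁₁ : ∀ v w, form (j₁ v) (j₁ w) = form v w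
  form₂₂ : ∀ v w, form (j₂ v) (j₂ w) = κ.kappa * conj (form v w)
  form₀₁ : ∀ v w, form (j₀ v) (j₁ w) = 0
  form₀₂ : ∀ v w, form (j₀ v) (j₂ w) = 0
  form₁₂ : ∀ v w, form (j₁ v) (j₂ w) = 0
  form₂₁ : ∀ v w, form (j₂ v) (j₁ w) = 0
  form₁₀ : ∀ v w, form (j₁ v) (j₀ w) = 0
  form₂₀ : ∀ v w, form (j₂ v) (j₀ w) = 0
  lift : ∀ η ∈ W₁, ∃ φ, j₀ η + j₁ φ + j₂ φ ∈ W

/-- The summands of the gluing sum with additional arguments `L`, for a basis `ξ`. -/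
noncomputable def gluedTerm (κ : Statistics) (W : Submodule ℝ V) (j₁ : U →ₗ[ℂ] V) (j₂ : U →ₗ⋆[ℂ] V)
    {d : ℕ} (ξ : Fin d → U) : ℕ → List V → ℂ :=
  expTerm (fun a => κ.kappa * sgn (ξ a)) (j₁ ∘ ξ) (j₂ ∘ ξ) (amplList κ W)

/-- The pairs inserted by gluing do not depend on the orthonormal basis. -/
theorem pairSum_eq_of_isKreinBasis {φ : List V → ℂ} (h : IsConjForm κ φ) {F : Submodule ℂ U}
    {d d' : ℕ} {ξ : Fin d → U} {ξ' : Fin d' → U} (hξ : IsKreinBasis F ξ) (hξ' : IsKreinBasis F ξ') :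
    pairSum (fun a => κ.kappa * sgn (ξ a)) (j₁ ∘ ξ) (j₂ ∘ ξ) φ =
      pairSum (fun a => κ.kappa * sgn (ξ' a)) (j₁ ∘ ξ') (j₂ ∘ ξ') φ := by
  funext L
  -- Expand the first member of the pair in the other basis. As `φ` is conjugate linear, the pair
  -- `(j₁ u, j₂ u)` is conjugate linear in its first `u` and linear in its second.
  have h1 : ∀ a, φ (j₁ (ξ a) :: j₂ (ξ a) :: L) =
      ∑ b, sgn (ξ' b) * form (ξ a) (ξ' b) * φ (j₁ (ξ' b) :: j₂ (ξ a) :: L) := by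
    intro a
    conv_lhs => rw [hξ'.eq_sum (hξ.mem a), map_sum]
    conv_rhs => simp only [← form_symm (ξ' _) (ξ a)]
    rw [← hξ'.eq_sum (hξ.mem a)]
    simp only [map_smul]
    rw [h.sum]
    simp only [map_mul, conj_sgn]
  have hsw : ∀ (v w : V) (L : List V), φ (v :: w :: L) = κ.kappa * φ (w :: v :: L) :=
    fun v w L => h.graded [] v w L
  -- The sum over the old basis now reassembles the vector `ξ' b` in the second member.
  have h2 : ∀ b, ∑ a, sgn (ξ a) * form (ξ a) (ξ' b) * φ (j₁ (ξ' b) :: j₂ (ξ a) :: L) =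
      φ (j₁ (ξ' b) :: j₂ (ξ' b) :: L) := by
    intro b
    conv_rhs => rw [hsw, hξ.eq_sum (hξ'.mem b), map_sum]
    rw [← hξ.eq_sum (hξ'.mem b)]
    simp only [LinearMap.map_smulₛₗ]
    rw [h.sum, Finset.mul_sum]
    refine Finset.sum_congr rfl fun a _ => ?_
    rw [hsw]
    simp only [Complex.conj_conj]
    ring
  simp only [pairSum, Function.comp_apply, h1, ← h2, Finset.mul_sum]
  rw [Finset.sum_comm]
  exact Finset.sum_congr rfl fun b _ => Finset.sum_congr rfl fun a _ => by ring

theorem gluedTerm_eq_of_isKreinBasis (hW : IsDynamical κ W) {F : Submodule ℂ U}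
    {d d' : ℕ} {ξ : Fin d → U} {ξ' : Fin d' → U} (hξ : IsKreinBasis F ξ) (hξ' : IsKreinBasis F ξ') :
    gluedTerm κ W j₁ j₂ ξ = gluedTerm κ W j₁ j₂ ξ' := by
  have h : ∀ m, (pairSum (fun a => κ.kappa * sgn (ξ a)) (j₁ ∘ ξ) (j₂ ∘ ξ))^[m] (amplList κ W) =
      (pairSum (fun a => κ.kappa * sgn (ξ' a)) (j₁ ∘ ξ') (j₂ ∘ ξ'))^[m] (amplList κ W) := by
    intro m
    induction m with
    | zero => rfl
    | succ m ih =>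
      rw [Function.iterate_succ_apply', Function.iterate_succ_apply', ih]
      exact pairSum_eq_of_isKreinBasis ((isConjForm_amplList hW).pairSum_iterate _ _ _ m) hξ hξ'
  funext m L
  rw [gluedTerm, gluedTerm, expTerm, expTerm, h]

/-- By the `κ`-symmetry of the form on `W`, the pairing `hatForm W v` is an inner product with the
conjugate of `v` in the real structure given by `W`. Only `v` needs to be split, so pairings with
the components of the boundary can be computed without splitting those. -/
theorem hatForm_eq_form (hW : IsDynamical κ W) (v w : V) :
    hatForm W v w = κ.kappa * form w ((split W v).1 - Complex.I • (split W v).2) := by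
  obtain ⟨h1, h2, -⟩ := hW.split_spec v
  obtain ⟨k1, k2, k3⟩ := hW.split_spec w
  conv_rhs => rw [k3, sub_eq_add_neg, ← neg_smul]
  simp only [form_add_left, form_add_right, form_smul_left, form_smul_right, Complex.conj_I]
  rw [hatForm, hW.form_comm k1 h1, hW.form_comm k1 h2, hW.form_comm k2 h1, hW.form_comm k2 h2]
  linear_combination (-κ.kappa * form (split W w).2 (split W v).2) * Complex.I_mul_I

/-- The values on `U` of solutions extending the real and the imaginary part of `η` can be found
in `F`. -/
def HasLiftIn (W : Submodule ℝ V) (W₁ : Submodule ℝ V₁) (j₀ : V₁ →ₗ[ℂ] V) (j₁ : U →ₗ[ℂ] V)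
    (j₂ : U →ₗ⋆[ℂ] V) (F : Submodule ℂ U) (η : V₁) : Prop :=
  ∃ φ ∈ F, ∃ χ ∈ F, j₀ (split W₁ η).1 + j₁ φ + j₂ φ ∈ W ∧ j₀ (split W₁ η).2 + j₁ χ + j₂ χ ∈ W

/-- A vector `η` on the glued boundary extends to a vector on the full boundary that is contracted like `η`
with the glued boundary, and like the extension with conjugate components on the rest. -/
theorem HasLiftIn.exists_extension (hg : IsGluedFrom κ W W₁ j₀ j₁ j₂) (hW : IsDynamical κ W)
    (hW₁ : IsDynamical κ W₁) {F : Submodule ℂ U} {η : V₁} (h : HasLiftIn W W₁ j₀ j₁ j₂ F η) :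
    ∃ α ∈ F, ∃ β ∈ F, (∀ θ, hatForm W (j₀ η + (j₁ α + j₂ β)) (j₀ θ) = hatForm W₁ η θ) ∧
      (∀ u, hatForm W (j₀ η + (j₁ α + j₂ β)) (j₁ u) = κ.kappa * form u β) ∧
      ∀ u, hatForm W (j₀ η + (j₁ α + j₂ β)) (j₂ u) = form α u := by
  obtain ⟨φ, hφ, χ, hχ, h1, h2⟩ := h
  obtain ⟨-, -, e3⟩ := hW₁.split_spec η
  -- The lifts of the real and imaginary parts are combined as `(real) + i (imaginary)`. Conjugate
  -- linearity of `j₂` turns `i j₂ χ` into `j₂ (-i χ)`, hence the opposite signs in the witnesses `α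
  -- = φ + i χ` and `β = φ - i χ`.
  have hs : split W (j₀ η + (j₁ (φ + Complex.I • χ) + j₂ (φ - Complex.I • χ))) =
      (j₀ (split W₁ η).1 + j₁ φ + j₂ φ, j₀ (split W₁ η).2 + j₁ χ + j₂ χ) := by
    refine hW.split_eq h1 h2 ?_
    conv_lhs => rw [e3]
    simp only [map_add, map_sub, map_smul, LinearMap.map_smulₛₗ, Complex.conj_I, smul_add, neg_smul]
    abel
  refine ⟨φ + Complex.I • χ, F.add_mem hφ (F.smul_mem _ hχ), φ - Complex.I • χ,
    F.sub_mem hφ (F.smul_mem _ hχ), fun θ => ?_, fun u => ?_, fun u => ?_⟩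
  · rw [hatForm_eq_form hW, hatForm_eq_form hW₁, hs]
    simp only [sub_eq_add_neg, ← neg_smul, form_add_right, form_smul_right, hg.form₀₀, hg.form₀₁,
      hg.form₀₂, add_zero]
  · rw [hatForm_eq_form hW, hs]
    simp only [sub_eq_add_neg, ← neg_smul, form_add_right, form_smul_right, hg.form₁₀, hg.form₁₁,
      hg.form₁₂, add_zero, zero_add]
  · rw [hatForm_eq_form hW, hs]
    simp only [sub_eq_add_neg, ← neg_smul, form_add_right, form_smul_right, form_add_left,
      form_smul_left, hg.form₂₀, hg.form₂₁, hg.form₂₂, add_zero, zero_add, form_symm, Complex.conj_I]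
    linear_combination (form φ u - Complex.I * form χ u) * κ.kappa_mul_self

theorem contract_map {I J : Type*} (f : I → J) (g : J → ℂ) (φ : List J → ℂ) (L : List I) :
    contract κ g φ (L.map f) = contract κ (fun x => g (f x)) (fun L => φ (L.map f)) L := by
  induction L generalizing φ with
  | nil => rfl
  | cons x L ih =>
    rw [List.map_cons, contract, contract, ih]
    rfl

/-- The gluing sum for a generating state is the amplitude of the glued region, times the
anomaly factor. -/
theorem hasSum_gluedTerm (hg : IsGluedFrom κ W W₁ j₀ j₁ j₂) (hW : IsDynamical κ W)
    (hW₁ : IsDynamical κ W₁) {F : Submodule ℂ U} {d : ℕ} {ξ : Fin d → U} (hξ : IsKreinBasis F ξ)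
    {z : ℂ} (hz : HasSum (fun m => gluedTerm κ W j₁ j₂ ξ m []) z) (L : List V₁)
    (hL : ∀ η ∈ L, HasLiftIn W W₁ j₀ j₁ j₂ F η) :
    HasSum (fun m => gluedTerm κ W j₁ j₂ ξ m (L.map j₀)) (amplList κ W₁ L * z) := by
  have hc := isConjForm_amplList hW
  have hcm : ∀ m, IsConjForm κ (gluedTerm κ W j₁ j₂ ξ m) := fun m => hc.expTerm _ _ _ m
  have hs : ∀ L, Summable fun m => gluedTerm κ W j₁ j₂ ξ m L :=
    summable_expTerm hc.graded (amplList_nil κ W) (amplList_cons hW) hz.summable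
  induction hn : L.length using Nat.strong_induction_on generalizing L with
  | _ n ih =>
  subst hn
  rcases L with - | ⟨η, L⟩
  · simpa [amplList_nil] using hz
  obtain ⟨α, hα, β, hβ, e0, e1, e2⟩ :=
    (hL η List.mem_cons_self).exists_extension hg hW hW₁
  -- The extended vector pairs with the glued boundary as `η` does for `W₁`. The contraction with
  -- the remaining arguments therefore follows Wick's rule for the glued region, and the lists that
  -- occur in it are shorter.
  have hC : HasSum (fun m => 2 * contract κ (hatForm W (j₀ η + (j₁ α + j₂ β)))
      (gluedTerm κ W j₁ j₂ ξ m) (L.map j₀)) (amplList κ W₁ (η :: L) * z) := by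
    have h1 : amplList κ W₁ (η :: L) * z =
        2 * contract κ (hatForm W₁ η) (fun L' => amplList κ W₁ L' * z) L := by
      simp only [mul_comm _ z, contract_smul, amplList_cons hW₁]
      ring
    rw [h1]
    simp only [contract_map, e0]
    refine (hasSum_contract κ fun L' hL' hsub => ?_).mul_left 2
    exact ih _ (by rw [List.length_cons]; omega) L'
      (fun θ hθ => hL θ (List.mem_cons_of_mem _ (hsub hθ))) rfl
  -- The contractions with the inserted pairs are the expansion coefficients of `α` and `β` in the
  -- basis, so by completeness they reproduce `u = j₁ α + j₂ β` as an argument. This needs `α` and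
  -- `β` to lie in `F`.
  have hu : ∀ m, gluedTerm κ W j₁ j₂ ξ m ((j₁ α + j₂ β) :: L.map j₀) =
      ∑ a, κ.kappa * sgn (ξ a) * (hatForm W (j₀ η + (j₁ α + j₂ β)) (j₁ (ξ a)) *
        gluedTerm κ W j₁ j₂ ξ m (j₂ (ξ a) :: L.map j₀) +
        κ.kappa * (hatForm W (j₀ η + (j₁ α + j₂ β)) (j₂ (ξ a)) *
          gluedTerm κ W j₁ j₂ ξ m (j₁ (ξ a) :: L.map j₀))) := by
    intro m
    have h1 : gluedTerm κ W j₁ j₂ ξ m (j₁ α :: L.map j₀) =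
        ∑ a, sgn (ξ a) * form α (ξ a) * gluedTerm κ W j₁ j₂ ξ m (j₁ (ξ a) :: L.map j₀) := by
      conv_lhs => rw [hξ.eq_sum hα, map_sum]
      simp only [map_smul]
      rw [(hcm m).sum]
      simp only [map_mul, conj_sgn, form_symm]
    have h2 : gluedTerm κ W j₁ j₂ ξ m (j₂ β :: L.map j₀) =
        ∑ a, sgn (ξ a) * form (ξ a) β * gluedTerm κ W j₁ j₂ ξ m (j₂ (ξ a) :: L.map j₀) := by
      conv_lhs => rw [hξ.eq_sum hβ, map_sum]
      simp only [LinearMap.map_smulₛₗ]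
      rw [(hcm m).sum]
      simp only [Complex.conj_conj]
    rw [(hcm m).add, h1, h2, ← Finset.sum_add_distrib]
    refine Finset.sum_congr rfl fun a _ => ?_
    rw [e1, e2]
    linear_combination (-(sgn (ξ a) * form (ξ a) β *
      gluedTerm κ W j₁ j₂ ξ m (j₂ (ξ a) :: L.map j₀)) - sgn (ξ a) * form α (ξ a) *
      gluedTerm κ W j₁ j₂ ξ m (j₁ (ξ a) :: L.map j₀)) * κ.kappa_mul_self
  -- Convergence for this list has to be known separately, since the sum is going to be subtracted.
  have hU := (hs ((j₁ α + j₂ β) :: L.map j₀)).hasSum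
  -- The term of degree `m + 1` for `j₀ η + u` is the contraction of degree `m + 1` plus the term of
  -- degree `m` for `u`. In degree `0` there is only the contraction, so the shifted series for `u`
  -- appears in full.
  have hv : HasSum (fun m => gluedTerm κ W j₁ j₂ ξ m ((j₀ η + (j₁ α + j₂ β)) :: L.map j₀))
      (amplList κ W₁ (η :: L) * z +
        ∑' m, gluedTerm κ W j₁ j₂ ξ m ((j₁ α + j₂ β) :: L.map j₀)) := by
    rw [← hasSum_nat_add_iff' 1] at hC ⊢
    convert hC.add hU using 1
    · funext m
      rw [hu, gluedTerm]
      exact expTerm_succ_cons κ _ _ _ hc.graded (amplList_cons hW) m _ _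
    · rw [Finset.sum_range_one, Finset.sum_range_one, gluedTerm,
        expTerm_zero_cons κ _ _ _ (amplList_cons hW)]
      ring
  have hA := hv.sub hU
  simp only [(hcm _).add (j₀ η), add_sub_cancel_right] at hA
  exact hA

end Gluing

open KreinSpace

/-! ### Operations on generating states -/

section Fock

variable {V U : KreinSpace.{u}} (κ : Statistics)

theorem genState_apply {n : ℕ} (ξ : Fin n → V) (η : Fin n → V) :
    genState κ ξ n η = (n.factorial : ℂ)⁻¹ *
      ∑ σ : Equiv.Perm (Fin n), κ.permSign σ * ∏ i, form (ξ i) (η (σ i)) := by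
  rw [genState, Pi.single_eq_same]

theorem genState_of_ne {n m : ℕ} (h : m ≠ n) (ξ : Fin n → V) : genState κ ξ m = 0 := by
  rw [genState, Pi.single_eq_of_ne h]

theorem genState_perm {n : ℕ} (ξ : Fin n → V) (τ : Equiv.Perm (Fin n)) :
    genState κ (ξ ∘ τ) = κ.permSign τ • genState κ ξ := by
  funext m
  by_cases hm : m = n
  · subst hm
    funext η
    rw [Pi.smul_apply, Pi.smul_apply, genState_apply, genState_apply, smul_eq_mul, mul_left_comm]
    congr 1
    rw [Finset.mul_sum, ← Equiv.sum_comp (Equiv.mulRight τ)]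
    refine Finset.sum_congr rfl fun σ _ => ?_
    rw [Equiv.coe_mulRight, κ.permSign_mul, mul_comm (κ.permSign σ), mul_assoc]
    congr 2
    exact Equiv.prod_comp τ fun i => form (ξ i) (η (σ i))
  · rw [Pi.smul_apply, genState_of_ne κ hm, genState_of_ne κ hm, smul_zero]

theorem genState_eq_zero_of_not_injective {n : ℕ} {ξ : Fin n → V} (h : ¬ Function.Injective ξ) :
    genState .fermion ξ = 0 := by
  obtain ⟨i, j, hij, hne⟩ := Function.not_injective_iff.1 h
  have h1 := genState_perm .fermion ξ (Equiv.swap i j)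
  rw [Statistics.permSign_swap, if_neg hne, Statistics.kappa] at h1
  have h2 : ξ ∘ Equiv.swap i j = ξ := by
    funext k
    rw [Function.comp_apply, Equiv.swap_apply_def]
    split_ifs with h3 h4
    · rw [h3, hij]
    · rw [h4, hij]
    · rfl
  rw [h2, neg_one_smul] at h1
  exact self_eq_neg.1 h1

/-- A generating state is built from inner products with its vectors, so the adjoint `j` of the
projection can be moved onto them. -/
theorem pull_genState {pr : V →L[ℂ] U} {j : U → V} (h : ∀ x ζ, form (j x) ζ = form x (pr ζ))
    {n : ℕ} (ξ : Fin n → U) : pull pr (genState κ ξ) = genState κ (j ∘ ξ) := by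
  funext m ζ
  by_cases hm : m = n
  · subst hm
    simp only [pull, genState_apply, Function.comp_apply, h]
  · rw [pull, genState_of_ne κ hm, genState_of_ne κ hm]
    rfl

theorem permSign_conj {n : ℕ} (σ τ : Equiv.Perm (Fin n)) :
    κ.permSign (τ * σ * τ⁻¹) = κ.permSign σ := by
  rw [κ.permSign_mul, κ.permSign_mul, κ.permSign_inv, mul_right_comm, κ.permSign_mul_self, one_mul]

theorem conj_permSign {n : ℕ} (σ : Equiv.Perm (Fin n)) : conj (κ.permSign σ) = κ.permSign σ := by
  cases κ <;> simp [Statistics.permSign]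

/-- Each of the `n` inner products contributes a factor `κ` under reversal of orientation.
Conjugating the permutations by the order reversal preserves their parity, so no other sign arises.
-/
theorem iota_genState {b : V ≃L⋆[ℂ] U} (hb : ∀ x y, form (b x) (b y) = κ.kappa * conj (form x y))
    {n : ℕ} (ξ : Fin n → V) :
    iota b (genState κ ξ) = κ.kappa ^ n • genState κ (fun i => b (ξ (Fin.rev i))) := by
  funext m η
  by_cases hm : m = n
  · subst hm
    rw [iota, Pi.smul_apply, Pi.smul_apply, genState_apply, genState_apply, smul_eq_mul,
      mul_left_comm, map_mul, map_inv₀, Complex.conj_natCast, map_sum]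
    congr 1
    rw [Finset.mul_sum, ← Equiv.sum_comp (MulAut.conj Fin.revPerm).toEquiv]
    refine Finset.sum_congr rfl fun σ _ => ?_
    have h1 : ∀ x y, conj (form x (b.symm y)) = κ.kappa * form (b x) y := by
      intro x y
      have := hb x (b.symm y)
      rw [b.apply_symm_apply] at this
      rw [this, ← mul_assoc, κ.kappa_mul_self, one_mul]
    rw [map_mul, conj_permSign, map_prod, MulEquiv.toEquiv_eq_coe, MulEquiv.coe_toEquiv,
      MulAut.conj_apply, permSign_conj, mul_left_comm]
    congr 1
    simp only [h1]
    rw [Finset.prod_mul_distrib, Finset.prod_const, Finset.card_univ, Fintype.card_fin,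
      ← Equiv.prod_comp Fin.revPerm]
    simp [Equiv.Perm.mul_apply]
  · rw [iota, Pi.smul_apply, genState_of_ne κ hm, genState_of_ne κ hm]
    simp

theorem stateMul_add_left (ψ ψ' φ : FockState V) :
    stateMul κ (ψ + ψ') φ = stateMul κ ψ φ + stateMul κ ψ' φ := by
  funext n ζ
  simp only [stateMul, Pi.add_apply, add_mul, Finset.sum_add_distrib, mul_add]

theorem stateMul_add_right (ψ φ φ' : FockState V) :
    stateMul κ ψ (φ + φ') = stateMul κ ψ φ + stateMul κ ψ φ' := by
  funext n ζ
  simp only [stateMul, Pi.add_apply, Finset.sum_add_distrib, mul_add]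

theorem stateMul_smul_left (z : ℂ) (ψ φ : FockState V) :
    stateMul κ (z • ψ) φ = z • stateMul κ ψ φ := by
  funext n ζ
  simp only [stateMul, Pi.smul_apply, smul_eq_mul, Finset.mul_sum]
  exact Finset.sum_congr rfl fun σ _ => Finset.sum_congr rfl fun p _ => by ring

theorem stateMul_smul_right (z : ℂ) (ψ φ : FockState V) :
    stateMul κ ψ (z • φ) = z • stateMul κ ψ φ := by
  funext n ζ
  simp only [stateMul, Pi.smul_apply, smul_eq_mul, Finset.mul_sum]
  exact Finset.sum_congr rfl fun σ _ => Finset.sum_congr rfl fun p _ => by ring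

theorem stateMul_genState {m k : ℕ} (ξ : Fin m → V) (η : Fin k → V) :
    stateMul κ (genState κ ξ) (genState κ η) = genState κ (Fin.append ξ η) := by
  funext n ζ
  by_cases hn : n = m + k
  · subst hn
    rw [genState_apply, stateMul]
    congr 1
    have h1 : ∀ σ : Equiv.Perm (Fin (m + k)),
        ∑ p : {p : ℕ × ℕ // p ∈ Finset.HasAntidiagonal.antidiagonal (m + k)},
          genState κ ξ p.1.1 (fun i => ζ (σ (Fin.cast
            (Finset.HasAntidiagonal.mem_antidiagonal.1 p.2) (Fin.castAdd p.1.2 i)))) *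
          genState κ η p.1.2 (fun j => ζ (σ (Fin.cast
            (Finset.HasAntidiagonal.mem_antidiagonal.1 p.2) (Fin.natAdd p.1.1 j)))) =
        genState κ ξ m (fun i => ζ (σ (Fin.castAdd k i))) *
          genState κ η k (fun j => ζ (σ (Fin.natAdd m j))) := by
      intro σ
      rw [Finset.sum_eq_single ⟨(m, k), Finset.HasAntidiagonal.mem_antidiagonal.2 rfl⟩]
      · rfl
      · rintro ⟨⟨p, q⟩, hpq⟩ - hne
        have hpm : p ≠ m := by
          rintro rfl
          have := Finset.HasAntidiagonal.mem_antidiagonal.1 hpq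
          exact hne (Subtype.ext (Prod.ext rfl (by simpa using this)))
        rw [genState_of_ne κ hpm]
        simp
      · exact fun h => absurd (Finset.mem_univ _) h
    -- Permutations within the two blocks are absorbed into the permutation of all arguments. Each
    -- of the `m! k!` pairs `(ρ, π)` gives the same sum, which cancels the normalizations of the
    -- factors.
    have h2 : ∀ (ρ : Equiv.Perm (Fin m)) (π : Equiv.Perm (Fin k)),
        ∑ σ : Equiv.Perm (Fin (m + k)), κ.permSign σ * (κ.permSign ρ * κ.permSign π *
          ((∏ i, form (ξ i) (ζ (σ (Fin.castAdd k (ρ i))))) *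
            ∏ j, form (η j) (ζ (σ (Fin.natAdd m (π j)))))) =
        ∑ σ : Equiv.Perm (Fin (m + k)), κ.permSign σ * ∏ i, form (Fin.append ξ η i) (ζ (σ i)) := by
      intro ρ π
      let θ : Equiv.Perm (Fin (m + k)) := finSumFinEquiv.permCongr (Equiv.Perm.sumCongr ρ π)
      have hθ : κ.permSign θ = κ.permSign ρ * κ.permSign π := by
        cases κ
        · simp [Statistics.permSign]
        · simp [Statistics.permSign, θ]
      conv_rhs => rw [← Equiv.sum_comp (Equiv.mulRight θ)]
      refine Finset.sum_congr rfl fun σ _ => ?_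
      rw [Equiv.coe_mulRight, κ.permSign_mul, hθ, mul_assoc (κ.permSign σ), Fin.prod_univ_add]
      simp only [Fin.append_left, Fin.append_right, Equiv.Perm.mul_apply]
      have hl : ∀ i, θ (Fin.castAdd k i) = Fin.castAdd k (ρ i) := fun i => by
        simp [θ, Equiv.permCongr_apply]
      have hr : ∀ i, θ (Fin.natAdd m i) = Fin.natAdd m (π i) := fun i => by
        simp [θ, Equiv.permCongr_apply]
      simp only [hl, hr]
    simp only [h1, genState_apply]
    calc _ = (m.factorial : ℂ)⁻¹ * (k.factorial : ℂ)⁻¹ *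
          ∑ ρ : Equiv.Perm (Fin m), ∑ π : Equiv.Perm (Fin k), ∑ σ : Equiv.Perm (Fin (m + k)),
            κ.permSign σ * (κ.permSign ρ * κ.permSign π *
              ((∏ i, form (ξ i) (ζ (σ (Fin.castAdd k (ρ i))))) *
                ∏ j, form (η j) (ζ (σ (Fin.natAdd m (π j)))))) := by
          rw [Finset.sum_congr rfl fun ρ _ => Finset.sum_comm, Finset.sum_comm, Finset.mul_sum]
          refine Finset.sum_congr rfl fun σ _ => ?_
          simp only [mul_assoc, Finset.mul_sum, Finset.sum_mul]
          rw [Finset.sum_comm]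
          exact Finset.sum_congr rfl fun ρ _ => Finset.sum_congr rfl fun π _ => by ring
      _ = _ := by
          simp only [h2, Finset.sum_const, Finset.card_univ, Fintype.card_perm, Fintype.card_fin,
            nsmul_eq_mul]
          have hm : (m.factorial : ℂ) ≠ 0 := by exact_mod_cast m.factorial_ne_zero
          have hk : (k.factorial : ℂ) ≠ 0 := by exact_mod_cast k.factorial_ne_zero
          field_simp
  · rw [genState_of_ne κ hn, stateMul, Finset.sum_eq_zero]
    · simp
    intro σ _
    rw [Finset.sum_eq_zero, mul_zero]
    rintro ⟨⟨p, q⟩, hpq⟩ -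
    have h1 := Finset.HasAntidiagonal.mem_antidiagonal.1 hpq
    by_cases hpm : p = m
    · have hqk : q ≠ k := by
        rintro rfl
        exact hn (by rw [← hpm]; exact h1.symm)
      rw [genState_of_ne κ hqk]
      simp
    · rw [genState_of_ne κ hpm]
      simp

variable {κ}

theorem genState_mem_stateDom {n : ℕ} (ξ : Fin n → V) : genState κ ξ ∈ stateDom κ V :=
  Submodule.subset_span ⟨⟨n, ξ⟩, rfl⟩

theorem stateMul_mem_stateDom {ψ φ : FockState V} (hψ : ψ ∈ stateDom κ V) (hφ : φ ∈ stateDom κ V) :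
    stateMul κ ψ φ ∈ stateDom κ V := by
  have h0 : ∀ φ : FockState V, stateMul κ 0 φ = 0 := fun φ => by
    simpa using stateMul_smul_left κ 0 0 φ
  have h0' : ∀ ψ : FockState V, stateMul κ ψ 0 = 0 := fun ψ => by
    simpa using stateMul_smul_right κ 0 ψ 0
  induction hψ using Submodule.span_induction with
  | mem ψ h =>
    obtain ⟨⟨m, ξ⟩, rfl⟩ := h
    induction hφ using Submodule.span_induction with
    | mem φ h =>
      obtain ⟨⟨k, η⟩, rfl⟩ := h
      rw [stateMul_genState]
      exact genState_mem_stateDom _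
    | zero => rw [h0']; exact Submodule.zero_mem _
    | add φ φ' _ _ h1 h2 => rw [stateMul_add_right]; exact Submodule.add_mem _ h1 h2
    | smul z φ _ h => rw [stateMul_smul_right]; exact Submodule.smul_mem _ z h
  | zero => rw [h0]; exact Submodule.zero_mem _
  | add ψ ψ' _ _ h1 h2 => rw [stateMul_add_left]; exact Submodule.add_mem _ h1 h2
  | smul z ψ _ h => rw [stateMul_smul_left]; exact Submodule.smul_mem _ z h

theorem pull_mem_stateDom {pr : V →L[ℂ] U} {j : U → V} (h : ∀ x ζ, form (j x) ζ = form x (pr ζ))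
    {ψ : FockState U} (hψ : ψ ∈ stateDom κ U) : pull pr ψ ∈ stateDom κ V := by
  induction hψ using Submodule.span_induction with
  | mem ψ hψ =>
    obtain ⟨⟨m, ξ⟩, rfl⟩ := hψ
    rw [pull_genState κ h]
    exact genState_mem_stateDom _
  | zero => exact Submodule.zero_mem _
  | add ψ ψ' _ _ h1 h2 => exact Submodule.add_mem _ h1 h2
  | smul z ψ _ h => exact Submodule.smul_mem _ z h

theorem iota_smul (b : V ≃L⋆[ℂ] U) (z : ℂ) (ψ : FockState V) :
    iota b (z • ψ) = conj z • iota b ψ := by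
  funext n η
  simp [iota]

theorem iota_add (b : V ≃L⋆[ℂ] U) (ψ ψ' : FockState V) :
    iota b (ψ + ψ') = iota b ψ + iota b ψ' := by
  funext n η
  simp [iota]

theorem iota_mem_stateDom {b : V ≃L⋆[ℂ] U}
    (hb : ∀ x y, form (b x) (b y) = κ.kappa * conj (form x y)) {ψ : FockState V}
    (hψ : ψ ∈ stateDom κ V) : iota b ψ ∈ stateDom κ U := by
  induction hψ using Submodule.span_induction with
  | mem ψ hψ =>
    obtain ⟨⟨m, ξ⟩, rfl⟩ := hψ
    rw [iota_genState κ hb]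
    exact Submodule.smul_mem _ _ (genState_mem_stateDom _)
  | zero =>
    rw [← zero_smul ℂ (0 : FockState V), iota_smul, map_zero, zero_smul]
    exact Submodule.zero_mem _
  | add ψ ψ' _ _ h1 h2 => rw [iota_add]; exact Submodule.add_mem _ h1 h2
  | smul z ψ _ h => rw [iota_smul]; exact Submodule.smul_mem _ _ h

end Fock

/-! ### From ordered index tuples to all index tuples -/

section Multisets

variable {m d : ℕ}

/-- Orbit counting: sorting gives each tuple a unique monotone rearrangement, and each tuple in the
orbit of `a` arises from as many permutations as the stabilizer of `a` has elements. -/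
theorem sum_monotone_inv_card_mul (F : (Fin m → Fin d) → ℂ)
    (hF : ∀ (a : Fin m → Fin d) (σ : Equiv.Perm (Fin m)), F (a ∘ σ) = F a) :
    (m.factorial : ℂ)⁻¹ * ∑ a, F a = open Classical in ∑ a : Fin m → Fin d with Monotone a,
      (Nat.card {σ : Equiv.Perm (Fin m) // a ∘ σ = a} : ℂ)⁻¹ * F a := by
  classical
  have hm : (m.factorial : ℂ) ≠ 0 := by exact_mod_cast m.factorial_ne_zero
  have hone : ∀ b : Fin m → Fin d, ∑ a : Fin m → Fin d with Monotone a,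
      (Nat.card {σ : Equiv.Perm (Fin m) // a ∘ σ = a} : ℂ)⁻¹ *
        ∑ σ : Equiv.Perm (Fin m), (if a ∘ σ = b then 1 else 0) = 1 := by
    intro b
    rw [Finset.sum_eq_single (b ∘ Tuple.sort b)]
    · have h1 : ∑ σ : Equiv.Perm (Fin m), (if (b ∘ Tuple.sort b) ∘ σ = b then (1 : ℂ) else 0) =
          Nat.card {σ : Equiv.Perm (Fin m) // (b ∘ Tuple.sort b) ∘ σ = b ∘ Tuple.sort b} := by
        rw [Finset.sum_boole, Nat.card_eq_fintype_card, Fintype.card_subtype]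
        congr 1
        refine Finset.card_equiv (Equiv.mulRight (Tuple.sort b)) fun σ => ?_
        simp only [Finset.mem_filter, Finset.mem_univ, true_and, Equiv.coe_mulRight,
          Equiv.Perm.coe_mul]
        rw [← Function.comp_assoc, (Tuple.sort b).surjective.injective_comp_right.eq_iff]
      rw [h1, inv_mul_cancel₀]
      have : Nonempty {σ : Equiv.Perm (Fin m) // (b ∘ Tuple.sort b) ∘ σ = b ∘ Tuple.sort b} :=
        ⟨⟨1, rfl⟩⟩
      exact_mod_cast Nat.card_pos.ne'
    · intro a ha hne
      rw [Finset.sum_eq_zero, mul_zero]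
      intro σ _
      rw [if_neg]
      rintro rfl
      refine hne ?_
      have h2 : Monotone ((a ∘ σ) ∘ (σ⁻¹ : Equiv.Perm (Fin m))) := by
        have : (a ∘ σ) ∘ (σ⁻¹ : Equiv.Perm (Fin m)) = a := by
          funext i; simp
        rw [this]
        exact (Finset.mem_filter.1 ha).2
      rw [← Tuple.unique_monotone h2 (Tuple.monotone_sort _)]
      funext i
      simp
    · intro h
      exact absurd (Finset.mem_filter.2 ⟨Finset.mem_univ _, Tuple.monotone_sort b⟩) h
  rw [inv_mul_eq_iff_eq_mul₀ hm]
  calc ∑ b, F b = ∑ b, (∑ a : Fin m → Fin d with Monotone a,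
      (Nat.card {σ : Equiv.Perm (Fin m) // a ∘ σ = a} : ℂ)⁻¹ *
        ∑ σ : Equiv.Perm (Fin m), (if a ∘ σ = b then 1 else 0)) * F b := by
        simp only [hone, one_mul]
    _ = ∑ a : Fin m → Fin d with Monotone a,
        (Nat.card {σ : Equiv.Perm (Fin m) // a ∘ σ = a} : ℂ)⁻¹ *
          ∑ σ : Equiv.Perm (Fin m), F (a ∘ σ) := by
        simp only [Finset.sum_mul]
        rw [Finset.sum_comm]
        refine Finset.sum_congr rfl fun a _ => ?_
        simp only [mul_assoc, ← Finset.mul_sum, Finset.sum_mul]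
        rw [Finset.sum_comm]
        simp
    _ = _ := by
        rw [Finset.mul_sum]
        refine Finset.sum_congr rfl fun a _ => ?_
        simp only [hF, Finset.sum_const, Finset.card_univ, Fintype.card_perm, Fintype.card_fin,
          nsmul_eq_mul]
        ring

/-- A sum over the induced basis of Fock space, with its normalization, is a sum over all
index tuples. -/
theorem sum_fockIndex (κ : Statistics) (F : (Fin m → Fin d) → ℂ)
    (hF : ∀ (a : Fin m → Fin d) (σ : Equiv.Perm (Fin m)), F (a ∘ σ) = F a)
    (h0 : κ = .fermion → ∀ a, ¬ Function.Injective a → F a = 0) :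
    ∑ a ∈ fockIndex κ m d, (Nat.card {σ : Equiv.Perm (Fin m) // a ∘ σ = a} : ℂ)⁻¹ * F a =
      (m.factorial : ℂ)⁻¹ * ∑ a, F a := by
  classical
  rw [sum_monotone_inv_card_mul F hF]
  cases κ with
  | boson => rfl
  | fermion =>
    refine Finset.sum_subset (fun a ha => ?_) fun a ha hna => ?_
    · simp only [fockIndex, Finset.mem_filter, Finset.mem_univ, true_and] at ha ⊢
      exact ha.monotone
    · simp only [fockIndex, Finset.mem_filter, Finset.mem_univ, true_and] at ha hna
      rw [h0 rfl a fun hi => hna (ha.strictMono_of_injective hi), mul_zero]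

end Multisets

/-! ### Glued states in a classical theory and the limit -/

open KreinSpace

theorem reverse_ofFn {α : Type*} {n : ℕ} (f : Fin n → α) :
    (List.ofFn f).reverse = List.ofFn fun i => f (Fin.rev i) := by
  refine List.ext_getElem (by simp) fun k h1 h2 => ?_
  simp only [List.getElem_reverse, List.getElem_ofFn, List.length_ofFn]
  congr 1
  ext
  simp only [Fin.val_rev]
  omega

/-- Adding the image of `E` under the symmetry makes the subspace invariant. The projections `(1 ±
sym) / 2` then split it into its positive and negative parts. -/
theorem exists_isAdapted {V : KreinSpace.{u}} (E : Submodule ℂ V) [FiniteDimensional ℂ E] :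
    ∃ E' : Submodule ℂ V, E ≤ E' ∧ FiniteDimensional ℂ E' ∧ IsAdapted E' := by
  let f : V →ₗ[ℂ] V := (V.sym : V →L[ℂ] V)
  have hf : ∀ v, f v = V.sym v := fun _ => rfl
  refine ⟨E ⊔ E.map f, le_sup_left, inferInstance, fun v hv => ?_⟩
  have hsym : V.sym v ∈ E ⊔ E.map f := by
    obtain ⟨a, ha, b, hb, rfl⟩ := Submodule.mem_sup.1 hv
    obtain ⟨c, hc, rfl⟩ := hb
    rw [map_add, hf, V.sym_sym, add_comm]
    exact Submodule.add_mem_sup hc ⟨a, ha, rfl⟩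
  refine ⟨(2 : ℂ)⁻¹ • (v + V.sym v), Submodule.smul_mem _ _ (Submodule.add_mem _ hv hsym),
    (2 : ℂ)⁻¹ • (v - V.sym v), Submodule.smul_mem _ _ (Submodule.sub_mem _ hv hsym), ?_, ?_, ?_⟩
  · change V.sym _ = _
    rw [map_smul, map_add, V.sym_sym, add_comm]
  · change V.sym _ = -_
    rw [map_smul, map_sub, V.sym_sym, ← smul_neg, neg_sub]
  · module

theorem pull_smul {V U : KreinSpace.{u}} (pr : V →L[ℂ] U) (z : ℂ) (ψ : FockState U) :
    pull pr (z • ψ) = z • pull pr ψ := rfl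

theorem KreinSpace.form_zero_right {V : KreinSpace.{u}} (v : V) : form v 0 = 0 := by
  rw [form, map_zero, inner_zero_right]

namespace ClassicalTheory

variable {κ : Statistics} {X : SpacetimeSystem.{u}} (T : ClassicalTheory.{u, v, w} κ X)

/-- The inclusion of a component of a decomposed hypersurface. -/
noncomputable def emb {S : X.Hyp} {n : ℕ} {p : Fin n → X.Hyp} (D : X.Decomp S p) (i : Fin n) :
    T.L (p i) →ₗ[ℂ] T.L S :=
  ((T.iso D : (∀ i, T.L (p i)) →L[ℂ] T.L S) : (∀ i, T.L (p i)) →ₗ[ℂ] T.L S) ∘ₗ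
    LinearMap.single ℂ (fun i => (T.L (p i) : Type v)) i

theorem emb_apply {S : X.Hyp} {n : ℕ} {p : Fin n → X.Hyp} (D : X.Decomp S p) (i : Fin n)
    (x : T.L (p i)) : T.emb D i x = T.iso D (Pi.single i x) := rfl

/-- The isometry of the decomposition makes inclusions and projections adjoint, as `pull_genState`
requires. -/
theorem form_emb {S : X.Hyp} {n : ℕ} {p : Fin n → X.Hyp} (D : X.Decomp S p) (i : Fin n)
    (x : T.L (p i)) (ζ : T.L S) : form (T.emb D i x) ζ = form x (T.proj D i ζ) := by
  conv_lhs => rw [← (T.iso D).apply_symm_apply ζ, emb_apply, T.form_iso]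
  rw [Finset.sum_eq_single i]
  · rw [Pi.single_eq_same]
    rfl
  · intro j _ hj
    rw [Pi.single_eq_of_ne hj, form, inner_zero_left]
  · exact fun h => absurd (Finset.mem_univ _) h

theorem proj_emb_same {S : X.Hyp} {n : ℕ} {p : Fin n → X.Hyp} (D : X.Decomp S p) (i : Fin n)
    (x : T.L (p i)) : T.proj D i (T.emb D i x) = x := by
  change (T.iso D).symm (T.iso D (Pi.single i x)) i = x
  rw [ContinuousLinearEquiv.symm_apply_apply, Pi.single_eq_same]

theorem proj_emb_of_ne {S : X.Hyp} {n : ℕ} {p : Fin n → X.Hyp} (D : X.Decomp S p) {i j : Fin n}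
    (h : j ≠ i) (x : T.L (p i)) : T.proj D j (T.emb D i x) = 0 := by
  change (T.iso D).symm (T.iso D (Pi.single i x)) j = 0
  rw [ContinuousLinearEquiv.symm_apply_apply, Pi.single_eq_of_ne h]

theorem sum_emb {S : X.Hyp} {n : ℕ} {p : Fin n → X.Hyp} (D : X.Decomp S p)
    (x : ∀ i, T.L (p i)) : ∑ i, T.emb D i (x i) = T.iso D x := by
  simp only [emb_apply, ← map_sum, Finset.univ_sum_single]

variable {T} in
theorem ampl_of_mem {M : X.Reg} {ψ : FockState (T.L (X.bdry M))} (h : ψ ∈ T.dom (X.bdry M)) :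
    T.ampl M ψ = amplitude (T.isDynamical M) ⟨ψ, h⟩ := dif_pos h

theorem ampl_add {M : X.Reg} {ψ φ : FockState (T.L (X.bdry M))} (hψ : ψ ∈ T.dom (X.bdry M))
    (hφ : φ ∈ T.dom (X.bdry M)) : T.ampl M (ψ + φ) = T.ampl M ψ + T.ampl M φ := by
  rw [ampl_of_mem hψ, ampl_of_mem hφ, ampl_of_mem (Submodule.add_mem _ hψ hφ), ← map_add]
  rfl

theorem ampl_smul {M : X.Reg} (z : ℂ) {ψ : FockState (T.L (X.bdry M))}
    (hψ : ψ ∈ T.dom (X.bdry M)) : T.ampl M (z • ψ) = z * T.ampl M ψ := by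
  rw [ampl_of_mem hψ, ampl_of_mem (Submodule.smul_mem _ z hψ), ← smul_eq_mul, ← map_smul]
  rfl

theorem ampl_zero (M : X.Reg) : T.ampl M 0 = 0 := by
  rw [ampl_of_mem (Submodule.zero_mem _)]
  exact map_zero _

theorem ampl_genState {M : X.Reg} {n : ℕ} (ξ : Fin n → T.L (X.bdry M)) :
    T.ampl M (genState κ ξ) = amplList κ (LinearMap.range (T.r M)) (List.ofFn ξ) := by
  rw [amplList_ofFn, ampl_of_mem (T := T) (genState_mem_stateDom ξ)]
  exact amplitude_genState _ ξ

variable {M M₁ : X.Reg} {S : X.Hyp} (g : X.Gluing M S M₁)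

/-- The inclusion of the boundary of the glued region. -/
noncomputable def embBdry : T.L (X.bdry M₁) →ₗ[ℂ] T.L (X.bdry M) := T.emb (X.gluingDecomp g) 0

/-- The inclusion of the gluing hypersurface. -/
noncomputable def embHyp : T.L S →ₗ[ℂ] T.L (X.bdry M) := T.emb (X.gluingDecomp g) 1

/-- The conjugate linear inclusion of the gluing hypersurface as its reversed copy. -/
noncomputable def embRev : T.L S →ₗ⋆[ℂ] T.L (X.bdry M) :=
  (T.emb (X.gluingDecomp g) 2 : T.L (X.rev S) →ₗ[ℂ] T.L (X.bdry M)).comp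
    ((T.bar S).toLinearEquiv : T.L S →ₗ⋆[ℂ] T.L (X.rev S))

theorem isGluedFrom : IsGluedFrom κ (LinearMap.range (T.r M)) (LinearMap.range (T.r M₁))
    (T.embBdry g) (T.embHyp g) (T.embRev g) where
  form₀₀ v w := (T.form_emb (X.gluingDecomp g) 0 v _).trans
    (congrArg (form v) (T.proj_emb_same (X.gluingDecomp g) 0 w))
  form₁₁ v w := (T.form_emb (X.gluingDecomp g) 1 v _).trans
    (congrArg (form v) (T.proj_emb_same (X.gluingDecomp g) 1 w))
  form₂₂ v w := ((T.form_emb (X.gluingDecomp g) 2 (T.bar S v) _).trans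
    (congrArg (form (T.bar S v)) (T.proj_emb_same (X.gluingDecomp g) 2 (T.bar S w)))).trans
    (T.form_bar S w v)
  form₀₁ v w := ((T.form_emb (X.gluingDecomp g) 0 v _).trans (congrArg (form v)
    (T.proj_emb_of_ne (X.gluingDecomp g) (i := 1) (by decide) w))).trans (form_zero_right _)
  form₀₂ v w := ((T.form_emb (X.gluingDecomp g) 0 v _).trans (congrArg (form v)
    (T.proj_emb_of_ne (X.gluingDecomp g) (i := 2) (by decide) (T.bar S w)))).trans (form_zero_right _)
  form₁₂ v w := ((T.form_emb (X.gluingDecomp g) 1 v _).trans (congrArg (form v)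
    (T.proj_emb_of_ne (X.gluingDecomp g) (i := 2) (by decide) (T.bar S w)))).trans (form_zero_right _)
  form₂₁ v w := ((T.form_emb (X.gluingDecomp g) 2 (T.bar S v) _).trans (congrArg (form (T.bar S v))
    (T.proj_emb_of_ne (X.gluingDecomp g) (i := 1) (by decide) w))).trans (form_zero_right _)
  form₁₀ v w := ((T.form_emb (X.gluingDecomp g) 1 v _).trans (congrArg (form v)
    (T.proj_emb_of_ne (X.gluingDecomp g) (i := 0) (by decide) w))).trans (form_zero_right _)
  form₂₀ v w := ((T.form_emb (X.gluingDecomp g) 2 (T.bar S v) _).trans (congrArg (form (T.bar S v))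
    (T.proj_emb_of_ne (X.gluingDecomp g) (i := 0) (by decide) w))).trans (form_zero_right _)
  -- The lift comes from the solution on `M` obtained by ungluing, whose values on the two copies of
  -- `S` agree under `bar`.
  lift := by
    rintro η ⟨y, rfl⟩
    have h1 := T.r_unglue g y
    have h2 := (T.mem_range_unglue g (T.unglue g y)).1 ⟨y, rfl⟩
    refine ⟨(T.iso (X.gluingDecomp g)).symm (T.r M (T.unglue g y)) 1, T.unglue g y, ?_⟩
    have h3 := T.sum_emb (X.gluingDecomp g)
      ((T.iso (X.gluingDecomp g)).symm (T.r M (T.unglue g y)))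
    rw [ContinuousLinearEquiv.apply_symm_apply, Fin.sum_univ_three] at h3
    refine h3.symm.trans ?_
    exact (congrArg₂ (· + ·) (congrArg₂ (· + ·) (congrArg (T.emb (X.gluingDecomp g) 0) h1) rfl)
      (congrArg (T.emb (X.gluingDecomp g) 2) h2.symm))

/-- The projection to the boundary of the glued region. -/
noncomputable def projBdry : T.L (X.bdry M) →L[ℂ] T.L (X.bdry M₁) := T.proj (X.gluingDecomp g) 0

/-- The projection to the gluing hypersurface. -/
noncomputable def projHyp : T.L (X.bdry M) →L[ℂ] T.L S := T.proj (X.gluingDecomp g) 1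

/-- The projection to the reversed copy of the gluing hypersurface. -/
noncomputable def projRev : T.L (X.bdry M) →L[ℂ] T.L (X.rev S) := T.proj (X.gluingDecomp g) 2

theorem gluedState_eq (ψ : FockState (T.L (X.bdry M₁))) (ξ : FockState (T.L S)) :
    T.gluedState g ψ ξ = stateMul κ (pull (T.projBdry g) ψ)
      (stateMul κ (pull (T.projHyp g) ξ) (pull (T.projRev g) (iota (T.bar S) ξ))) := rfl

theorem form_embBdry (x : T.L (X.bdry M₁)) (ζ : T.L (X.bdry M)) :
    form (T.embBdry g x) ζ = form x (T.projBdry g ζ) := T.form_emb (X.gluingDecomp g) 0 x ζ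

theorem form_embHyp (x : T.L S) (ζ : T.L (X.bdry M)) :
    form (T.embHyp g x) ζ = form x (T.projHyp g ζ) := T.form_emb (X.gluingDecomp g) 1 x ζ

theorem form_embRev (x : T.L (X.rev S)) (ζ : T.L (X.bdry M)) :
    form (T.embRev g ((T.bar S).symm x)) ζ = form x (T.projRev g ζ) := by
  refine (T.form_emb (X.gluingDecomp g) 2 (T.bar S ((T.bar S).symm x)) ζ).trans ?_
  exact congrArg (fun y => form y (T.projRev g ζ)) ((T.bar S).apply_symm_apply x)

/-- The factor `κ ^ m` comes from `ι` and explains the weight `κ * sgn` of the pairs in `gluedTerm`.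
-/
theorem gluedState_genState {n m : ℕ} (η : Fin n → T.L (X.bdry M₁)) (ξ : Fin m → T.L S) :
    T.gluedState g (genState κ η) (genState κ ξ) = κ.kappa ^ m • genState κ
      (Fin.append (T.embBdry g ∘ η) (Fin.append (T.embHyp g ∘ ξ) fun i => T.embRev g (ξ (Fin.rev i)))) := by
  have h : ((fun x => T.embRev g ((T.bar S).symm x)) ∘ fun i => T.bar S (ξ (Fin.rev i))) =
      fun i => T.embRev g (ξ (Fin.rev i)) :=
    funext fun i => congrArg (T.embRev g) ((T.bar S).symm_apply_apply _)
  rw [gluedState_eq, iota_genState κ fun x y => T.form_bar S y x, pull_genState κ (T.form_embBdry g),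
    pull_genState κ (T.form_embHyp g)]
  rw [pull_smul, pull_genState κ (T.form_embRev g), h, stateMul_smul_right, stateMul_smul_right,
    stateMul_genState, stateMul_genState]

theorem gluedState_mem_dom {ψ : FockState (T.L (X.bdry M₁))} (hψ : ψ ∈ T.dom (X.bdry M₁))
    {ξ : FockState (T.L S)} (hξ : ξ ∈ T.dom S) : T.gluedState g ψ ξ ∈ T.dom (X.bdry M) := by
  rw [gluedState_eq]
  exact stateMul_mem_stateDom (pull_mem_stateDom (T.form_embBdry g) hψ)
    (stateMul_mem_stateDom (pull_mem_stateDom (T.form_embHyp g) hξ)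
      (pull_mem_stateDom (T.form_embRev g) (iota_mem_stateDom (fun x y => T.form_bar S y x) hξ)))

theorem gluedState_add_left (ψ φ : FockState (T.L (X.bdry M₁))) (ξ : FockState (T.L S)) :
    T.gluedState g (ψ + φ) ξ = T.gluedState g ψ ξ + T.gluedState g φ ξ :=
  stateMul_add_left κ _ _ _

theorem gluedState_smul_left (z : ℂ) (ψ : FockState (T.L (X.bdry M₁))) (ξ : FockState (T.L S)) :
    T.gluedState g (z • ψ) ξ = z • T.gluedState g ψ ξ :=
  stateMul_smul_left κ _ _ _

/-- The state enters once linearly and once, through `ι`, conjugate linearly. Hence signs of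
permutations drop out, and the square root in the Fock basis becomes `1 / (2^m K)`. -/
theorem gluedState_smul_right (ψ : FockState (T.L (X.bdry M₁))) (z : ℂ) (ξ : FockState (T.L S)) :
    T.gluedState g ψ (z • ξ) = (z * conj z) • T.gluedState g ψ ξ := by
  rw [gluedState_eq, iota_smul, pull_smul, pull_smul, stateMul_smul_left, stateMul_smul_right, stateMul_smul_right, stateMul_smul_right, smul_smul,
    gluedState_eq]

theorem fockBasis_mem_dom {d m : ℕ} (ξ : Fin d → T.L S) (a : Fin m → Fin d) :
    fockBasis κ ξ a ∈ T.dom S :=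
  Submodule.smul_mem _ _ (genState_mem_stateDom _)

theorem sigSign_eq_prod {V : KreinSpace.{u}} {d m : ℕ} (ξ : Fin d → V) (a : Fin m → Fin d) :
    sigSign ξ a = ∏ i, sgn (ξ (a i)) := by
  rw [sigSign, ← Finset.prod_pow_eq_pow_sum]
  rfl

/-- The sum over all index tuples of the amplitudes of glued states. -/
theorem sum_ampl_gluedState {n d : ℕ} (η : Fin n → T.L (X.bdry M₁)) (ξ : Fin d → T.L S) (m : ℕ) :
    (2 ^ m * (m.factorial : ℂ))⁻¹ * ∑ a : Fin m → Fin d,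
      sigSign ξ a * T.ampl M (T.gluedState g (genState κ η) (genState κ (ξ ∘ a))) =
    gluedTerm κ (LinearMap.range (T.r M)) (T.embHyp g) (T.embRev g) ξ m
      ((List.ofFn η).map (T.embBdry g)) := by
  rw [gluedTerm, expTerm, pairSum_iterate_eq_sum κ _ _ _ (isGraded_amplList _ _)]
  congr 1
  refine Finset.sum_congr rfl fun a _ => ?_
  rw [gluedState_genState, ampl_smul _ _ (genState_mem_stateDom _), ampl_genState,
    List.ofFn_fin_append, List.ofFn_fin_append, reverse_ofFn, List.map_ofFn, sigSign_eq_prod,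
    Finset.prod_mul_distrib, Finset.prod_const, Finset.card_univ, Fintype.card_fin, mul_left_comm,
    mul_assoc]
  rfl

/-- The vacuum is the generating state of the empty family, so the anomaly factor is the gluing sum
without further arguments. -/
theorem anomalyTerm_eq {d : ℕ} (ξ : Fin d → T.L S) (m : ℕ) :
    T.anomalyTerm g ξ m =
      gluedTerm κ (LinearMap.range (T.r M)) (T.embHyp g) (T.embRev g) ξ m [] := by
  have h := T.sum_ampl_gluedState g (Fin.elim0 : Fin 0 → T.L (X.bdry M₁)) ξ m
  rw [genState_zero] at h
  exact h

/-- The summands are invariant under permutations of the index tuple and, for fermions, vanish at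
repeated indices. So `sum_fockIndex` converts the normalization `1 / (2^m K)` into that of an
exponential series. -/
theorem gluingTerm_eq (ψ : FockState (T.L (X.bdry M₁))) (hψ : ψ ∈ T.dom (X.bdry M₁)) {d : ℕ}
    (ξ : Fin d → T.L S) (m : ℕ) :
    T.gluingTerm g ψ ξ m = (2 ^ m * (m.factorial : ℂ))⁻¹ * ∑ a : Fin m → Fin d,
      sigSign ξ a * T.ampl M (T.gluedState g ψ (genState κ (ξ ∘ a))) := by
  have hdom : ∀ a : Fin m → Fin d, T.gluedState g ψ (genState κ (ξ ∘ a)) ∈ T.dom (X.bdry M) :=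
    fun a => T.gluedState_mem_dom g hψ (genState_mem_stateDom _)
  have hsum := sum_fockIndex (m := m) (d := d) κ
    (fun a => sigSign ξ a * T.ampl M (T.gluedState g ψ (genState κ (ξ ∘ a))))
    (fun a σ => by
      have h1 : sigSign ξ (a ∘ σ) = sigSign ξ a := by
        rw [sigSign_eq_prod, sigSign_eq_prod]
        exact Equiv.prod_comp σ fun i => sgn (ξ (a i))
      rw [h1, ← Function.comp_assoc, genState_perm, gluedState_smul_right, conj_permSign,
        κ.permSign_mul_self, one_smul])
    (fun hκ a ha => by
      subst hκ
      have h1 : T.gluedState g ψ (0 : FockState (T.L S)) = 0 := by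
        simpa using T.gluedState_smul_right g ψ 0 0
      rw [genState_eq_zero_of_not_injective fun h => ha h.of_comp, h1, ampl_zero, mul_zero])
  rw [mul_inv, mul_assoc, ← hsum, gluingTerm, Finset.mul_sum]
  refine Finset.sum_congr rfl fun a _ => ?_
  rw [fockBasis, gluedState_smul_right, ampl_smul _ _ (hdom a)]
  have h2 : ∀ x : ℝ, 0 ≤ x → ((Real.sqrt x : ℝ) : ℂ)⁻¹ * conj ((Real.sqrt x : ℝ) : ℂ)⁻¹ =
      (x : ℂ)⁻¹ := by
    intro x hx
    rw [map_inv₀, Complex.conj_ofReal, ← mul_inv, ← Complex.ofReal_mul, Real.mul_self_sqrt hx]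
  rw [h2 _ (by positivity)]
  push_cast
  rw [mul_inv]
  ring

theorem gluingTerm_add {ψ φ : FockState (T.L (X.bdry M₁))} (hψ : ψ ∈ T.dom (X.bdry M₁))
    (hφ : φ ∈ T.dom (X.bdry M₁)) {d : ℕ} (ξ : Fin d → T.L S) (m : ℕ) :
    T.gluingTerm g (ψ + φ) ξ m = T.gluingTerm g ψ ξ m + T.gluingTerm g φ ξ m := by
  rw [gluingTerm, gluingTerm, gluingTerm, ← Finset.sum_add_distrib]
  refine Finset.sum_congr rfl fun a _ => ?_
  rw [gluedState_add_left, ampl_add _ (T.gluedState_mem_dom g hψ (T.fockBasis_mem_dom ξ a))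
    (T.gluedState_mem_dom g hφ (T.fockBasis_mem_dom ξ a)), mul_add]

theorem gluingTerm_smul (z : ℂ) {ψ : FockState (T.L (X.bdry M₁))} (hψ : ψ ∈ T.dom (X.bdry M₁))
    {d : ℕ} (ξ : Fin d → T.L S) (m : ℕ) :
    T.gluingTerm g (z • ψ) ξ m = z * T.gluingTerm g ψ ξ m := by
  rw [gluingTerm, gluingTerm, Finset.mul_sum]
  refine Finset.sum_congr rfl fun a _ => ?_
  rw [gluedState_smul_left, ampl_smul _ _ (T.gluedState_mem_dom g hψ (T.fockBasis_mem_dom ξ a)),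
    mul_left_comm]

/-- Over every sufficiently large finite-dimensional Krein subspace, the gluing identity holds exactly, with the
restricted anomaly factor. -/
theorem exists_hasSum_gluingTerm {ψ : FockState (T.L (X.bdry M₁))} (hψ : ψ ∈ T.dom (X.bdry M₁)) :
    ∃ E : Submodule ℂ (T.L S), FiniteDimensional ℂ E ∧ ∀ F : Submodule ℂ (T.L S), E ≤ F →
      ∀ (d : ℕ) (ξ : Fin d → T.L S), IsKreinBasis F ξ → ∀ z, HasSum (T.anomalyTerm g ξ) z →
        HasSum (T.gluingTerm g ψ ξ) (T.ampl M₁ ψ * z) := by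
  induction hψ using Submodule.span_induction with
  | mem ψ h =>
    obtain ⟨⟨n, η⟩, rfl⟩ := h
    have hg := T.isGluedFrom g
    have hW₁ := T.isDynamical M₁
    choose φ hφ using fun i => hg.lift _ (hW₁.split_spec (η i)).1
    choose χ hχ using fun i => hg.lift _ (hW₁.split_spec (η i)).2.1
    -- It suffices that the subspace contains the values on `S` of the finitely many solutions that
    -- extend the real and imaginary parts of the `η i`.
    refine ⟨Submodule.span ℂ (Set.range φ ∪ Set.range χ), FiniteDimensional.span_of_finite ℂ
      ((Set.finite_range φ).union (Set.finite_range χ)), fun F hF d ξ hξ z hz => ?_⟩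
    have h := hasSum_gluedTerm hg (T.isDynamical M) hW₁ hξ
      (by simpa only [← anomalyTerm_eq] using hz) (List.ofFn η) (fun θ hθ => by
        obtain ⟨i, rfl⟩ := (List.mem_ofFn' _ _).1 hθ
        exact ⟨φ i, hF (Submodule.subset_span (Or.inl ⟨i, rfl⟩)), χ i,
          hF (Submodule.subset_span (Or.inr ⟨i, rfl⟩)), hφ i, hχ i⟩)
    rw [ampl_genState]
    refine h.congr_fun fun m => ?_
    rw [gluingTerm_eq _ _ _ (genState_mem_stateDom η), sum_ampl_gluedState]
  | zero =>
    refine ⟨⊥, inferInstance, fun F hF d ξ hξ z hz => ?_⟩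
    rw [ampl_zero, zero_mul]
    convert hasSum_zero with m
    simpa using T.gluingTerm_smul g 0 (Submodule.zero_mem (T.dom (X.bdry M₁))) ξ m
  | add ψ φ hψ hφ h1 h2 =>
    obtain ⟨E₁, _, h1⟩ := h1
    obtain ⟨E₂, _, h2⟩ := h2
    refine ⟨E₁ ⊔ E₂, inferInstance, fun F hF d ξ hξ z hz => ?_⟩
    rw [ampl_add _ hψ hφ, add_mul, funext (T.gluingTerm_add g hψ hφ ξ)]
    exact (h1 F (le_sup_left.trans hF) d ξ hξ z hz).add (h2 F (le_sup_right.trans hF) d ξ hξ z hz)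
  | smul c ψ hψ h =>
    obtain ⟨E, hE, h⟩ := h
    refine ⟨E, hE, fun F hF d ξ hξ z hz => ?_⟩
    rw [ampl_smul _ c hψ, mul_assoc, funext (T.gluingTerm_smul g c hψ ξ)]
    exact (h F hF d ξ hξ z hz).mul_left c

theorem hasGluingSum {c : ℂ} (hc : T.IsAnomalyFactor g c) {ψ : FockState (T.L (X.bdry M₁))}
    (hψ : ψ ∈ T.dom (X.bdry M₁)) : T.HasGluingSum g ψ (T.ampl M₁ ψ * c) := by
  intro ε hε
  obtain ⟨E₁, _, hE₁⟩ := T.exists_hasSum_gluingTerm g hψ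
  have hpos : 0 < ‖T.ampl M₁ ψ‖ + 1 := by positivity
  -- The error of the anomaly factor is multiplied by the norm of the amplitude; adding `1` to this
  -- norm avoids division by zero.
  obtain ⟨E₂, _, -, hE₂⟩ := hc (ε / (‖T.ampl M₁ ψ‖ + 1)) (by positivity)
  obtain ⟨E, hE, hEf, hEa⟩ := exists_isAdapted (E₁ ⊔ E₂)
  refine ⟨E, hEf, hEa, fun F hF hFf hFa d ξ hξ => ?_⟩
  obtain ⟨d', ξ', z, hξ', hz, hzc⟩ := hE₂ F ((le_sup_right.trans hE).trans hF) hFf hFa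
  -- The definition of the anomaly factor provides one basis `ξ'` of `F`; independence of the basis
  -- carries the sum over to the given `ξ`.
  have hz' : HasSum (T.anomalyTerm g ξ) z := by
    rw [funext (T.anomalyTerm_eq g ξ), gluedTerm_eq_of_isKreinBasis (T.isDynamical M) hξ hξ',
      ← funext (T.anomalyTerm_eq g ξ')]
    exact hz
  refine ⟨_, hE₁ F ((le_sup_left.trans hE).trans hF) d ξ hξ z hz', ?_⟩
  rw [← mul_sub, norm_mul]
  rw [lt_div_iff₀ hpos] at hzc
  nlinarith [norm_nonneg (z - c), norm_nonneg (T.ampl M₁ ψ)]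

end ClassicalTheory

end GBF

theorem mainTheorem1 (κ : GBF.Statistics) (X : GBF.SpacetimeSystem.{u})
    (T : GBF.ClassicalTheory.{u, v, w} κ X) {M M₁ : X.Reg} {S : X.Hyp} (g : X.Gluing M S M₁)
    (c : ℂ) (hc : T.IsAnomalyFactor g c) (hc0 : c ≠ 0) :
    (∀ ψ ∈ T.dom (X.bdry M₁), ∀ ξ ∈ T.dom S, T.gluedState g ψ ξ ∈ T.dom (X.bdry M)) ∧
      ∀ ψ ∈ T.dom (X.bdry M₁), T.HasGluingSum g ψ (T.ampl M₁ ψ * c) :=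
  ⟨fun _ hψ _ hξ => T.gluedState_mem_dom g hψ hξ, fun _ hψ => T.hasGluingSum g hc hψ⟩
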